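/- **Definitions.** A *weakly toric monoid* is here a finitely generated submonoid $P\subseteq\mathbb Z^m$ (some $m\ge 0$) which is saturated: $p\in P^{\rm gp}$ and $n\cdot p\in P$ for some $n\ge 1$ imply $p\in P$, where $P^{\rm gp}$ is the subgroup generated by $P$. Put $\operatorname{rank}P=\operatorname{rank}P^{\rm gp}$. A *face* of $P$ is a submonoid $F\subseteq P$ such that $p,q\in P$, $p+q\in F$ imply $p,q\in F$; its codimension is $\operatorname{rank}P-\operatorname{rank}F$. Let $X_P$ be the set of monoid morphisms $x:P\to([0,\infty),\cdot)$, with the weakest topology making all $\lambda_p:x\mapsto x(p)$ continuous. The support of $x\in X_P$ is the face $\{p:x(p)\ne0\}$, and the depth of $x$ is the codimension of its support. For $U\subseteq X_P$, a function $U\to\mathbb R$ is smooth if it is $g(\lambda_{r_1},\dots,\lambda_{r_n})$ for some $r_i\in P$ and $g$ smooth on an open set; a function $U\to[0,\infty)$ is smooth if near each point of $U$ it is either $0$ or of the form $\lambda_p\cdot h$ with $p\in P$ and $h>0$ smooth; a map $f$ from $U$ to $X_Q$ is smooth if it is continuous and all $\lambda_q\circ f$, $q\in Q$, are smooth functions to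 $[0,\infty)$. An $n$-*manifold with g-corners* is a second countable Hausdorff space $X$ with a maximal atlas of g-charts $(P,U,\phi)$, where $P$ is weakly toric of rank $n$, $U\subseteq X_P$ is open, $\phi:U\to X$ is a homeomorphism with an open set, and transition maps are diffeomorphisms. It has *ordinary corners* if it is covered by g-charts with $P=\mathbb N^a\times\mathbb Z^{n-a}$. Smooth maps are those which are smooth in g-charts. Let $S^k(X)$ be the set of points of depth $k$ (measured in g-charts). A *local $k$-corner component* $\gamma$ of $X$ at $x\in X$ chooses for each open neighbourhood $V$ of $x$ a connected component $\gamma(V)$ of $V\cap S^k(X)$ with $x\in\overline{\gamma(V)}$, such that $x\in\overline{\gamma(V)\cap\gamma(V')}$ for all $V,V'$. For $k=1$ it is called a *local boundary component*. Let $C_k(X)$ be the set of pairs $(x,\gamma)$ with $x\in X$ and $\gamma$ a local $k$-corner component at $x$. A g-chart $(P,U,\phi)$ on $X$ and a face $F$ of $P$ of codimension $k$ give a chart $(F,(i_F^P)^{-1}(U),\phi_F^P)$ on $C_k(X)$, where $i_F^P:X_F\to X_P$ is extension by $0$ and $\phi^P_F(y)=(x,\gamma)$ with $x=\phi(i_F^P(y))$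 and $\gamma$ the local component given by $\phi(\{u\in U:\operatorname{supp}u=F\})$. These charts define the topology and the maximal g-atlas of $C_k(X)$. Let $\partial X=C_1(X)$ and $\partial^kX=\partial(\partial^{k-1}X)$, $\partial^0X=X$. Two local boundary components $\beta_1,\beta_2$ at $x$ *intersect in codimension* $c$ if for all sufficiently small open neighbourhoods $V$ of $x$ the least depth of a point of $V\cap\overline{\beta_1(V)}\cap\overline{\beta_2(V)}$ is $c$. **Proposition.** Let $X$ be a manifold with g-corners. For $0\le k\le\dim X$, $C_k(X)$ and $\partial^kX$ are manifolds with g-corners of dimension $\dim X-k$. Moreover: **(a)** The map $(x,\gamma)\mapsto(x,\{\beta:\gamma\subseteq\overline\beta\text{ near }x\})$, with $\beta$ ranging over the local boundary components at $x$, is a bijection from $C_2(X)$ to $$\{(x,\{\beta_1,\beta_2\}): x\in X,\ \beta_1,\beta_2\text{ distinct local boundary components of }X\text{ at }x\text{ intersecting in codimension }2\}.$$ Each point $((x,\beta_1),\beta')$ of $\partial^2X$ determines a unique local boundary component $\beta_2\ne\beta_1$ of $X$ at $x$ whose closure contains the image of $\beta'$ in $X$ near $x$, and $((x,\beta_1),\beta')\mapsto(x,\beta_1,\beta_2)$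 is a bijection from $\partial^2X$ to $$\{(x,\beta_1,\beta_2): x\in X,\ \beta_1,\beta_2\text{ distinct local boundary components of }X\text{ at }x\text{ intersecting in codimension }2\}.$$ There is a free action of $S_2\cong\mathbb Z_2$ on $\partial^2X$ by diffeomorphisms, whose nontrivial element is the unique map exchanging $\beta_1,\beta_2$. The quotient $\partial^2X/S_2$ is a manifold with g-corners, and there is a diffeomorphism $C_2(X)\cong\partial^2X/S_2$ which identifies $(x,\{\beta_1,\beta_2\})$ with the class of $(x,\beta_1,\beta_2)$. **(b)** For all $k=0,1,\dots,\dim X$ there is a unique map $\pi:\partial^kX\to C_k(X)$ taking $y$ to $(x,\gamma)$, where $x$ is the image of $y$ in $X$ and $\gamma$ is the local $k$-corner component of $X$ at $x$ into which $\partial^kX\to\cdots\to X$ maps the interior $S^0(\partial^kX)$ near $y$. This $\pi$ is smooth, surjective and étale (a local diffeomorphism). **(c)** For $k\ge2$, $S_k$ is generated by the $k-1$ two-cycles $(12),(23),\dots,(k-1\,k)$, and an $S_k$-action on a set is equivalent to $k-1$ actions of $S_2$, given by involutions $s_1,\dots,s_{k-1}$, which satisfy the relations $s_is_{i+1}s_i=s_{i+1}s_is_{i+1}$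 and $s_is_j=s_js_i$ for $|i-j|\ge2$. For $2\le k\le\dim X$ there are $k-1$ actions of $S_2$ on $\partial^kX$ by diffeomorphisms: for $j=0,\dots,k-2$, take the action on $\partial^{j+2}X=\partial^2(\partial^jX)$ from (a), and apply $\partial^{k-j-2}$. If $X$ has ordinary corners, these satisfy the relations, and so define an $S_k$-action on $\partial^kX$ in which $(j{+}1\ \,j{+}2)$ acts by the $j$-th involution. But for each $k\ge3$ there is a manifold with g-corners $X$ of dimension at least $k$ for which these $S_2$-actions do not satisfy the relations, and generate a group $G\not\cong S_k$ of permutations of $\partial^kX$. -/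

import Mathlib

open Set Topology
open scoped NNReal ContDiff

universe u v

noncomputable section

namespace GCorners

/-! ### Weakly toric monoids (as submonoids of `ℤ^m`) and their faces -/

/-- The group `P^gp` generated by a submonoid `P` of `ℤ^m`. -/
def gp {m : ℕ} (P : AddSubmonoid (Fin m → ℤ)) : AddSubgroup (Fin m → ℤ) :=
  AddSubgroup.closure (P : Set (Fin m → ℤ))

/-- The rank of `P`, i.e. the rank of the free abelian group `P^gp`. -/
def rank {m : ℕ} (P : AddSubmonoid (Fin m → ℤ)) : ℕ := Module.finrank ℤ (gp P)

/-- `P ⊆ ℤ^m` is weakly toric: finitely generated and saturated.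
A submonoid of `ℤ^m` is automatically integral (cancellative) and torsion-free. -/
structure WeaklyToric {m : ℕ} (P : AddSubmonoid (Fin m → ℤ)) : Prop where
  fg : P.FG
  saturated : ∀ p ∈ gp P, ∀ n : ℕ, 1 ≤ n → n • p ∈ P → p ∈ P

/-- `F` is a face of `P`. -/
structure IsFace {m : ℕ} (F P : AddSubmonoid (Fin m → ℤ)) : Prop where
  le : F ≤ P
  of_add_mem : ∀ p ∈ P, ∀ q ∈ P, p + q ∈ F → p ∈ F ∧ q ∈ F

/-- `F` has codimension `k` in `P`, i.e. the group `(P/F)^gp = P^gp/F^gp` has rank `k`. -/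
def HasCodim {m : ℕ} (F P : AddSubmonoid (Fin m → ℤ)) (k : ℕ) : Prop :=
  rank F + k = rank P

/-! ### The model spaces `X_P` -/

/-- `X_P`: the set of monoid morphisms from `P` to `([0,∞), ·)`. -/
def XP {m : ℕ} (P : AddSubmonoid (Fin m → ℤ)) : Type := Multiplicative P →* ℝ≥0

/-- The function `λ_p : X_P → [0,∞)`, `λ_p(x) = x(p)`. -/
def lam {m : ℕ} {P : AddSubmonoid (Fin m → ℤ)} (p : P) (x : XP P) : ℝ≥0 :=
  (show Multiplicative P →* ℝ≥0 from x) (Multiplicative.ofAdd p)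

/-- The weakest topology on `X_P` for which all `λ_p` are continuous. -/
instance {m : ℕ} (P : AddSubmonoid (Fin m → ℤ)) : TopologicalSpace (XP P) :=
  TopologicalSpace.induced (fun x p => lam p x) (inferInstance : TopologicalSpace (P → ℝ≥0))

instance {m : ℕ} (P : AddSubmonoid (Fin m → ℤ)) : Nonempty (XP P) :=
  ⟨(1 : Multiplicative P →* ℝ≥0)⟩

theorem lam_zero {m : ℕ} {P : AddSubmonoid (Fin m → ℤ)} (x : XP P) : lam 0 x = 1 :=
  MonoidHom.map_one (M := Multiplicative P) (N := ℝ≥0) x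

theorem lam_add {m : ℕ} {P : AddSubmonoid (Fin m → ℤ)} (p q : P) (x : XP P) :
    lam (p + q) x = lam p x * lam q x :=
  MonoidHom.map_mul (M := Multiplicative P) (N := ℝ≥0) x _ _

/-- The support `{p ∈ P : x(p) ≠ 0}` of a point of `X_P`. -/
def supp {m : ℕ} {P : AddSubmonoid (Fin m → ℤ)} (x : XP P) : AddSubmonoid (Fin m → ℤ) where
  carrier := {p | ∃ h : p ∈ P, lam ⟨p, h⟩ x ≠ 0}
  zero_mem' := ⟨P.zero_mem, by
    have h := lam_zero x
    change lam (0 : P) x ≠ 0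
    rw [h]; exact one_ne_zero⟩
  add_mem' := by
    rintro a b ⟨ha, ha'⟩ ⟨hb, hb'⟩
    refine ⟨P.add_mem ha hb, ?_⟩
    have h := lam_add (⟨a, ha⟩ : P) ⟨b, hb⟩ x
    change lam ((⟨a, ha⟩ : P) + ⟨b, hb⟩) x ≠ 0
    rw [h]; exact mul_ne_zero ha' hb'

/-- The stratum `X^P_F = {x ∈ X_P : supp x = F}`. -/
def faceStratum {m : ℕ} (P F : AddSubmonoid (Fin m → ℤ)) : Set (XP P) := {x | supp x = F}

/-- The point `x ∈ X_P` has depth `k`: its support has codimension `k` in `P`. -/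
def HasDepth {m : ℕ} {P : AddSubmonoid (Fin m → ℤ)} (x : XP P) (k : ℕ) : Prop :=
  HasCodim (supp x) P k

open Classical in
/-- The inclusion `i_F^P : X_F → X_P`, extending `y : F → [0,∞)` by zero to `P`. -/
def inclFace {m : ℕ} {F P : AddSubmonoid (Fin m → ℤ)} (hF : IsFace F P) (y : XP F) : XP P :=
  ({ toFun := fun p => if h : (p.toAdd : Fin m → ℤ) ∈ F then lam ⟨_, h⟩ y else 0
     map_one' := by
       have h0 : ((1 : Multiplicative P).toAdd : Fin m → ℤ) ∈ F := F.zero_mem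
       rw [dif_pos h0]; exact lam_zero y
     map_mul' := by
       intro p q
       by_cases hp : (p.toAdd : Fin m → ℤ) ∈ F
       · by_cases hq : (q.toAdd : Fin m → ℤ) ∈ F
         · have hpq : ((p * q).toAdd : Fin m → ℤ) ∈ F := F.add_mem hp hq
           rw [dif_pos hp, dif_pos hq, dif_pos hpq]
           exact lam_add (⟨_, hp⟩ : F) ⟨_, hq⟩ y
         · have hpq : ((p * q).toAdd : Fin m → ℤ) ∉ F := fun h =>
             hq (hF.of_add_mem _ p.toAdd.2 _ q.toAdd.2 h).2
           rw [dif_neg hq, dif_neg hpq, mul_zero]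
       · have hpq : ((p * q).toAdd : Fin m → ℤ) ∉ F := fun h =>
           hp (hF.of_add_mem _ p.toAdd.2 _ q.toAdd.2 h).1
         rw [dif_neg hp, dif_neg hpq, zero_mul] } : Multiplicative P →* ℝ≥0)

/-! ### Smooth maps between open subsets of model spaces -/

/-- `f` is a smooth real function on `U ⊆ X_P`: there are `r_1, …, r_n ∈ P` and a smooth `g`,
defined on an open set, with `f(x) = g(x(r_1), …, x(r_n))` on `U`. (Smooth functions on an
open subset of `[0,∞)^n` are the restrictions of smooth functions on open subsets of `ℝ^n`.) -/
def SmoothReal {m : ℕ} {P : AddSubmonoid (Fin m → ℤ)} (f : XP P → ℝ) (U : Set (XP P)) : Prop :=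
  ∃ (n : ℕ) (r : Fin n → P) (W : Set (Fin n → ℝ)) (g : (Fin n → ℝ) → ℝ),
    IsOpen W ∧ ContDiffOn ℝ ∞ g W ∧
    ∀ x ∈ U, (fun i => (lam (r i) x : ℝ)) ∈ W ∧ f x = g (fun i => (lam (r i) x : ℝ))

/-- `f` is smooth on `U ⊆ X_P` as a map to `[0,∞)`: near each point of `U` either
`f = λ_p · h` with `p ∈ P` and `h` smooth and positive, or `f = 0`. -/
def SmoothNonneg {m : ℕ} {P : AddSubmonoid (Fin m → ℤ)} (f : XP P → ℝ≥0) (U : Set (XP P)) :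
    Prop :=
  ∀ u ∈ U, ∃ N : Set (XP P), IsOpen N ∧ u ∈ N ∧
    ((∃ (p : P) (h : XP P → ℝ), SmoothReal h (U ∩ N) ∧ (∀ x ∈ U ∩ N, 0 < h x) ∧
        ∀ x ∈ U ∩ N, (f x : ℝ) = lam p x * h x) ∨
      ∀ x ∈ U ∩ N, f x = 0)

/-- `f` is a smooth map on `U ⊆ X_P` with values in `X_Q`. -/
def ModelSmoothOn {m l : ℕ} {P : AddSubmonoid (Fin m → ℤ)} {Q : AddSubmonoid (Fin l → ℤ)}
    (f : XP P → XP Q) (U : Set (XP P)) : Prop :=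
  ContinuousOn f U ∧ ∀ q : Q, SmoothNonneg (fun x => lam q (f x)) U

/-! ### Generalized charts and manifolds with g-corners -/

/-- The data `(P, U, φ)` of a g-chart; only the values of `φ` on `U` matter. -/
structure Chart (X : Type u) where
  m : ℕ
  P : AddSubmonoid (Fin m → ℤ)
  U : Set (XP P)
  φ : XP P → X

/-- The image `φ(U)` of a chart. -/
def Chart.image {X : Type u} (c : Chart X) : Set X := c.φ '' c.U

/-- The inverse `φ⁻¹ : φ(U) → U` of a chart (with irrelevant values outside `φ(U)`). -/
def Chart.inv {X : Type u} (c : Chart X) : X → XP c.P := Function.invFunOn c.φ c.U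

/-- `(P, U, φ)` is an `n`-dimensional g-chart on the topological space `X`. -/
structure IsGChart {X : Type u} [TopologicalSpace X] (n : ℕ) (c : Chart X) : Prop where
  weaklyToric : WeaklyToric c.P
  rank_eq : rank c.P = n
  isOpen : IsOpen c.U
  isOpenEmbedding : IsOpenEmbedding (fun u : c.U => c.φ u)

/-- The transition map between the two charts is a diffeomorphism. -/
def Compatible {X : Type u} (c d : Chart X) : Prop :=
  ModelSmoothOn (fun x => d.inv (c.φ x)) (c.U ∩ c.φ ⁻¹' d.image) ∧
  ModelSmoothOn (fun x => c.inv (d.φ x)) (d.U ∩ d.φ ⁻¹' c.image)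

/-- All `n`-dimensional g-charts that are compatible with the charts in `A`. If `A` is a
g-atlas, then this is the unique maximal g-atlas containing it. -/
def maximalAtlas {X : Type u} [TopologicalSpace X] (n : ℕ) (A : Set (Chart X)) :
    Set (Chart X) :=
  {c | IsGChart n c ∧ ∀ d ∈ A, Compatible c d}

/-- A topological space with a dimension and a set of charts, with no conditions imposed. The
constructions of corners and quotients are made for these; `IsGManifold` below says
that such an object is a manifold with g-corners. -/
structure GSpace : Type (u + 1) where
  carrier : Type u
  top : TopologicalSpace carrier
  dim : ℕ
  atlas : Set (Chart carrier)

instance : CoeSort GSpace.{u} (Type u) := ⟨GSpace.carrier⟩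

instance (X : GSpace.{u}) : TopologicalSpace X := X.top

/-- `X` is a manifold with g-corners: a second countable Hausdorff space
with a maximal g-atlas of dimension `X.dim`. -/
structure IsGManifold (X : GSpace.{u}) : Prop where
  t2 : T2Space X
  secondCountable : SecondCountableTopology X
  isGChart : ∀ c ∈ X.atlas, IsGChart X.dim c
  compatible : ∀ c ∈ X.atlas, ∀ d ∈ X.atlas, Compatible c d
  cover : ∀ x : X, ∃ c ∈ X.atlas, x ∈ c.image
  maximal : ∀ c : Chart X, IsGChart X.dim c → (∀ d ∈ X.atlas, Compatible c d) → c ∈ X.atlas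

/-- `f` is smooth on the open set `U ⊆ X`: it is continuous there, and smooth in all charts. -/
def SmoothOn {X : GSpace.{u}} {Y : GSpace.{v}} (f : X → Y) (U : Set X) : Prop :=
  ContinuousOn f U ∧ ∀ c ∈ X.atlas, ∀ d ∈ Y.atlas,
    ModelSmoothOn (fun x => d.inv (f (c.φ x))) (c.U ∩ {x | c.φ x ∈ U ∧ f (c.φ x) ∈ d.image})

/-- `f : X → Y` is smooth. -/
def Smooth {X : GSpace.{u}} {Y : GSpace.{v}} (f : X → Y) : Prop := SmoothOn f univ

/-- The bijection `e` is a diffeomorphism. -/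
def IsDiffeo {X : GSpace.{u}} {Y : GSpace.{v}} (e : X ≃ Y) : Prop :=
  Smooth (e : X → Y) ∧ Smooth (e.symm : Y → X)

/-- `f` is étale: every point has an open neighbourhood `U` with `f(U)` open and
`f : U → f(U)` a diffeomorphism. -/
def IsEtale {X : GSpace.{u}} {Y : GSpace.{v}} (f : X → Y) : Prop :=
  ∀ x : X, ∃ U : Set X, IsOpen U ∧ x ∈ U ∧ IsOpen (f '' U) ∧ SmoothOn f U ∧
    ∃ g : Y → X, (∀ z ∈ U, g (f z) = z) ∧ SmoothOn g (f '' U)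

/-- `X` is a manifold with ordinary corners: it is covered by g-charts `(P, U, φ)`
with `P = ℕ^a × ℤ^(m-a) ⊆ ℤ^m`. -/
def HasOrdinaryCorners (X : GSpace.{u}) : Prop :=
  ∀ x : X, ∃ c ∈ X.atlas, x ∈ c.image ∧
    ∃ a ≤ c.m, ∀ p : Fin c.m → ℤ, p ∈ c.P ↔ ∀ i : Fin c.m, (i : ℕ) < a → 0 ≤ p i

/-! ### Depth, local corner components, corners and boundaries -/

/-- The depth `k` stratum `S^k(X)`. -/
def depthStratum (X : GSpace.{u}) (k : ℕ) : Set X :=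
  {x | ∃ c ∈ X.atlas, ∃ y ∈ c.U, c.φ y = x ∧ HasDepth y k}

/-- `V` is an open neighbourhood of `x`. -/
def IsOpenNhd {X : Type u} [TopologicalSpace X] (V : Set X) (x : X) : Prop := IsOpen V ∧ x ∈ V

/-- A local `k`-corner component of `X` at `x`: a choice, for each open neighbourhood `V` of `x`,
of a connected component `comp V` of `V ∩ S^k(X)` with `x` in its closure, such that any two
choices are compatible. (A compatible choice on all sufficiently small `V` extends uniquely
to one on all `V`; the value at sets `V` which are not open neighbourhoods of `x` is `∅`.) -/
@[ext]
structure LocalCorner (X : GSpace.{u}) (k : ℕ) (x : X) where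
  comp : Set X → Set X
  isComponent : ∀ V, IsOpenNhd V x →
    ∃ y ∈ V ∩ depthStratum X k, comp V = connectedComponentIn (V ∩ depthStratum X k) y
  mem_closure : ∀ V, IsOpenNhd V x → x ∈ closure (comp V)
  compat : ∀ V V', IsOpenNhd V x → IsOpenNhd V' x → x ∈ closure (comp V ∩ comp V')
  junk : ∀ V, ¬ IsOpenNhd V x → comp V = ∅

/-- The set `C_k(X)` of pairs `(x, γ)`, with `γ` a local `k`-corner component of `X` at `x`. -/
abbrev CornerSet (X : GSpace.{u}) (k : ℕ) : Type u := Σ x : X, LocalCorner X k x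

/-- The charts `(F, (i_F^P)⁻¹(U), φ_F^P)` on `C_k(X)`, for g-charts `(P, U, φ)` on `X` and faces
`F` of `P` of codimension `k`. Here `φ_F^P(y) = (x, γ)`, with `x = φ(i_F^P(y))` and `γ` the local
`k`-corner component of `X` at `x` which is given by the subset `φ(X^P_F ∩ U)` of `S^k(X)`. -/
def cornerCharts (X : GSpace.{u}) (k : ℕ) : Set (Chart (CornerSet X k)) :=
  {d | ∃ c ∈ X.atlas, ∃ (F : AddSubmonoid (Fin c.m → ℤ)) (hF : IsFace F c.P),
    HasCodim F c.P k ∧ ∃ φ : XP F → CornerSet X k,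
      d = ⟨c.m, F, inclFace hF ⁻¹' c.U, φ⟩ ∧
      ∀ y, inclFace hF y ∈ c.U → (φ y).1 = c.φ (inclFace hF y) ∧
        ∀ V, IsOpenNhd V (φ y).1 →
          (φ y).1 ∈ closure ((φ y).2.comp V ∩ c.φ '' (faceStratum c.P F ∩ c.U))}

/-- The topology on `C_k(X)` determined by the charts `cornerCharts X k`. -/
instance cornerTopology (X : GSpace.{u}) (k : ℕ) : TopologicalSpace (CornerSet X k) :=
  ⨆ d ∈ cornerCharts X k,
    TopologicalSpace.coinduced (fun u : d.U => d.φ u) (inferInstance : TopologicalSpace d.U)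

/-- The `k`-corners `C_k(X)`, of dimension `dim X - k`. -/
def corners (X : GSpace.{u}) (k : ℕ) : GSpace.{u} where
  carrier := CornerSet X k
  top := cornerTopology X k
  dim := X.dim - k
  atlas := maximalAtlas (X.dim - k) (cornerCharts X k)

/-- The boundary `∂X = C_1(X)`. -/
def boundary (X : GSpace.{u}) : GSpace.{u} := corners X 1

/-- The iterated boundary `∂^k X`. -/
def bd (X : GSpace.{u}) : ℕ → GSpace.{u}
  | 0 => X
  | k + 1 => boundary (bd X k)

/-- The projection `∂X → X`, `(x, β) ↦ x`. -/
def bdProj (X : GSpace.{u}) (y : boundary X) : X := Sigma.fst (β := LocalCorner X 1) y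

/-- The composition `∂^k X → ∂^(k-1) X → ⋯ → X`. -/
def bdProjIter (X : GSpace.{u}) : (k : ℕ) → bd X k → X
  | 0, x => x
  | k + 1, y => bdProjIter X k (bdProj (bd X k) y)

/-! ### Local boundary components and `C_2(X)`, `∂²X` -/

/-- Two local boundary components at `x` intersect in codimension `c`: for small `V`, the
smallest depth of a point of `V` in the closures of both of the corresponding components of
`V ∩ S^1(X)` is `c`. -/
def MeetInCodim {X : GSpace.{u}} {x : X} (β₁ β₂ : LocalCorner X 1 x) (c : ℕ) : Prop :=
  ∃ V₀, IsOpenNhd V₀ x ∧ ∀ V ⊆ V₀, IsOpenNhd V x →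
    IsLeast {d | (V ∩ depthStratum X d ∩ closure (β₁.comp V) ∩ closure (β₂.comp V)).Nonempty} c

/-- The local corner component `γ` at `x` lies in the closure of the local boundary component
`β` at `x`. -/
def InClosure {X : GSpace.{u}} {k : ℕ} {x : X} (γ : LocalCorner X k x) (β : LocalCorner X 1 x) :
    Prop :=
  ∃ V₀, IsOpenNhd V₀ x ∧ ∀ V ⊆ V₀, IsOpenNhd V x → γ.comp V ⊆ closure (β.comp V)

/-- The map taking `(x, γ) ∈ C_2(X)` to `x` and the set of local boundary
components of `X` at `x` whose closure contains `γ`. -/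
def boundingSet (X : GSpace.{u}) (p : CornerSet X 2) : Σ x : X, Set (LocalCorner X 1 x) :=
  ⟨p.1, {β | InClosure p.2 β}⟩

/-- The set of triples `(x, β₁, β₂)` of a point and two local boundary components at it. -/
abbrev Triple (X : GSpace.{u}) : Type u := Σ x : X, LocalCorner X 1 x × LocalCorner X 1 x

/-- The point `y = ((x, β₁), β')` of `∂²X` corresponds to the triple `t = (x, β₁, β₂)`: `β₂ ≠ β₁`
is a local boundary component of `X` at `x`, and the image in `X` of the local boundary component
`β'` of `∂X` at `(x, β₁)` lies in the closure of `β₂`. -/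
def Describes {X : GSpace.{u}} (y : boundary (boundary X)) (t : Triple X) : Prop :=
  ∃ (x : X) (β₁ β₂ : LocalCorner X 1 x)
    (β' : LocalCorner (boundary X) 1 (⟨x, β₁⟩ : CornerSet X 1)),
    y = (⟨⟨x, β₁⟩, β'⟩ : CornerSet (boundary X) 1) ∧ t = ⟨x, (β₁, β₂)⟩ ∧ β₂ ≠ β₁ ∧
    ∀ V, IsOpenNhd V x →
      ∃ V₀, IsOpenNhd V₀ (⟨x, β₁⟩ : boundary X) ∧ ∀ V' ⊆ V₀,
        IsOpenNhd V' (⟨x, β₁⟩ : boundary X) →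
          bdProj X '' (β'.comp V') ⊆ closure (β₂.comp V)

/-- `σ` exchanges `β₁, β₂` under the correspondence of points of `∂²X` with
triples `(x, β₁, β₂)`. -/
def IsSwap (X : GSpace.{u}) (σ : boundary (boundary X) → boundary (boundary X)) : Prop :=
  ∀ y (x : X) (β₁ β₂ : LocalCorner X 1 x),
    Describes y ⟨x, (β₁, β₂)⟩ → Describes (σ y) ⟨x, (β₂, β₁)⟩

/-- `g : ∂X → ∂Y` is the map `(x, β) ↦ (f(x), f_*(β))` induced by a diffeomorphism `f : X → Y`. -/
def IsBoundaryMap {X Y : GSpace.{u}} (f : X → Y) (g : boundary X → boundary Y) : Prop :=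
  ∀ (x : X) (β : LocalCorner X 1 x), ∃ β' : LocalCorner Y 1 (f x),
    g (⟨x, β⟩ : CornerSet X 1) = (⟨f x, β'⟩ : CornerSet Y 1) ∧
    ∀ V, IsOpenNhd V (f x) → β'.comp V = f '' (β.comp (f ⁻¹' V))

/-- `σ : ∂^k X → ∂^k X` is obtained by applying `∂^(k-j-2)` to the map of `∂^(j+2) X = ∂²(∂^j X)`
that exchanges two local boundary components of `∂^j X`. -/
def IsSwapAt (X : GSpace.{u}) (j : ℕ) : (k : ℕ) → (bd X k → bd X k) → Prop
  | 0, _ => False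
  | 1, _ => False
  | k + 2, σ => (j = k ∧ IsSwap (bd X k) σ) ∨
      (j < k ∧ ∃ τ : bd X (k + 1) → bd X (k + 1), IsSwapAt X j (k + 1) τ ∧ IsBoundaryMap τ σ)

/-- `π : ∂^k X → C_k(X)` is the natural projection: `π(y) = (x, γ)`, where `x` is the image of `y`
in `X`, and `γ` is the local `k`-corner component of `X` at `x` into which the interior
`S^0(∂^k X)` of `∂^k X` near `y` is mapped by `∂^k X → X`. -/
def IsNaturalProj (X : GSpace.{u}) (k : ℕ) (π : bd X k → corners X k) : Prop :=
  ∀ y : bd X k, ∃ γ : LocalCorner X k (bdProjIter X k y),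
    π y = (⟨bdProjIter X k y, γ⟩ : CornerSet X k) ∧
    ∀ V, IsOpenNhd V (bdProjIter X k y) → ∃ V', IsOpenNhd V' y ∧
      bdProjIter X k '' (V' ∩ depthStratum (bd X k) 0) ⊆ γ.comp V

/-! ### Group actions and quotients -/

/-- The orbit relation of an action of the group `G`. -/
def orbitSetoid {G : Type v} [Group G] {Y : Type u} (ρ : G →* Equiv.Perm Y) : Setoid Y where
  r y z := ∃ g, ρ g y = z
  iseqv :=
    { refl := fun y => ⟨1, by simp⟩
      symm := by
        rintro y z ⟨g, rfl⟩
        exact ⟨g⁻¹, by simp⟩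
      trans := by
        rintro x y z ⟨g, rfl⟩ ⟨h, rfl⟩
        exact ⟨h * g, by simp⟩ }

/-- The quotient of `X` by an equivalence relation, with the quotient topology and the charts
induced by those g-charts `(P, U, φ)` on `X` for which `U → X → X/∼` is injective. -/
def quotient (X : GSpace.{u}) (s : Setoid X) : GSpace.{u} where
  carrier := Quotient s
  top := inferInstance
  dim := X.dim
  atlas := maximalAtlas X.dim
    {d | ∃ c ∈ X.atlas, InjOn (fun x => Quotient.mk s (c.φ x)) c.U ∧
      d = ⟨c.m, c.P, c.U, fun x => Quotient.mk s (c.φ x)⟩}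

/-- The quotient map `X → X/∼`. -/
def quotientMk (X : GSpace.{u}) (s : Setoid X) (x : X) : quotient X s := Quotient.mk s x

/-- The two-cycle `(j j+1)` in the symmetric group on `m + 2` letters. -/
def adjSwap {m : ℕ} (j : Fin (m + 1)) : Equiv.Perm (Fin (m + 2)) :=
  Equiv.swap j.castSucc j.succ

/-- The relations between the two-cycles `(12), (23), …` which define the symmetric group. -/
def CoxeterRelations {m : ℕ} {G : Type u} [Group G] (s : Fin (m + 1) → G) : Prop :=
  (∀ j, s j * s j = 1) ∧
  (∀ i j : Fin (m + 1), (i : ℕ) + 1 = j → s i * s j * s i = s j * s i * s j) ∧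
  (∀ i j : Fin (m + 1), (i : ℕ) + 1 < j → s i * s j = s j * s i)

end GCorners

end

noncomputable section

namespace GCorners

/-! ### Submonoids of `ℤ^m`: generated groups, rational spans, ranks -/

/-! The whole statement is reduced to the combinatorics of faces of a weakly toric monoid, by
reading points of corners and boundaries in a g-chart `(P, U, φ)`.

Fix `u ∈ U`. The local `k`-corner components at `φ u` correspond to the faces of `P` of codimension
`k` which contain `supp u`. This rests on three facts about `X_P`: near a point the support can only
grow (`exists_nhd_supp_le`), every face above `supp u` is the support of points arbitrarily close to
`u` (`exists_mem_supp_eq`), and small boxes meet each stratum in a connected set (`exists_box`). The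
depth does not depend on the chart, because smooth maps are locally monotone on supports
(`codim_le_of_charts`). Transition maps between corner charts are restrictions of transition maps of
`X`, so `C_k(X)` is again a manifold with g-corners (`isGManifold_corners`).

By iteration, the points of `∂^k X` over `φ u` correspond to flags `P = F 0 ⊇ F 1 ⊇ ⋯ ⊇ F k` of
faces, each of codimension one in the previous one, with `supp u ≤ F k`; the chart around such a
point is modelled on `X_{F k}` (`flag_aux`, `exists_flag_of_proj_eq`, `IsFlagPt.flag_unique`).

In this dictionary (a) is the diamond property: a face of codimension two lies in exactly two facets
(`IsFace.exists_pair`, `IsFace.eq_or_eq`). The exchange on `∂²X` replaces `F 1` by the other facet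
containing `F 2`, and the projection `∂^k X → C_k(X)` of (b) forgets everything but `F k`. Both keep
`F k`, hence are the identity in suitable charts (`LocallyIso`), which gives smoothness and
étaleness. Flags of length two with the same end form one orbit of the exchange, so `C_2(X)` is the
quotient; the projection is surjective since every face is the end of a flag.

For (c), the `j`-th involution replaces `F (j + 1)` by the other face between `F j` and `F (j + 2)`
(`exists_isSwapAt`). For ordinary corners a flag is a sequence of coordinates which successively
vanish, and the involutions transpose adjacent terms, so the relations hold. On a cone over an
`N`-gon times an orthant, the product of the first two involutions walks around the polygon, so its
order is a multiple of `N` or infinite; a prime `N > k` excludes both the braid relation and an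
isomorphism with `S_k`. The presentation of `S_k` follows by bounding the order of a group with
these relations by `k!` (`BraidRelations.exists_finset`). -/

theorem mem_gp_iff {m : ℕ} {P : AddSubmonoid (Fin m → ℤ)} {z : Fin m → ℤ} :
    z ∈ gp P ↔ ∃ a ∈ P, ∃ b ∈ P, z = a - b := by
  constructor
  · intro hz
    induction hz using AddSubgroup.closure_induction with
    | mem x hx => exact ⟨x, hx, 0, P.zero_mem, by simp⟩
    | zero => exact ⟨0, P.zero_mem, 0, P.zero_mem, by simp⟩
    | add x y _ _ hx hy =>
      obtain ⟨a, ha, b, hb, rfl⟩ := hx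
      obtain ⟨a', ha', b', hb', rfl⟩ := hy
      exact ⟨a + a', P.add_mem ha ha', b + b', P.add_mem hb hb', by abel⟩
    | neg x _ hx =>
      obtain ⟨a, ha, b, hb, rfl⟩ := hx
      exact ⟨b, hb, a, ha, by abel⟩
  · rintro ⟨a, ha, b, hb, rfl⟩
    exact sub_mem (AddSubgroup.subset_closure ha) (AddSubgroup.subset_closure hb)

/-- The inclusion `ℤ^m → ℚ^m`. -/
def toRat (m : ℕ) : (Fin m → ℤ) →+ (Fin m → ℚ) where
  toFun p i := p i
  map_zero' := by ext; simp
  map_add' p q := by ext; simp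

theorem toRat_injective (m : ℕ) : Function.Injective (toRat m) := by
  intro p q h
  ext i
  have := congrFun h i
  simpa [toRat] using this

/-- The rational span of a submonoid of `ℤ^m`. -/
def qspan {m : ℕ} (P : AddSubmonoid (Fin m → ℤ)) : Submodule ℚ (Fin m → ℚ) :=
  Submodule.span ℚ (toRat m '' P)

theorem toRat_mem_qspan {m : ℕ} {P : AddSubmonoid (Fin m → ℤ)} {p : Fin m → ℤ} (h : p ∈ P) :
    toRat m p ∈ qspan P := Submodule.subset_span ⟨p, h, rfl⟩

theorem toRat_mem_qspan_of_mem_gp {m : ℕ} {P : AddSubmonoid (Fin m → ℤ)} {p : Fin m → ℤ}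
    (h : p ∈ gp P) : toRat m p ∈ qspan P := by
  obtain ⟨a, ha, b, hb, rfl⟩ := mem_gp_iff.1 h
  rw [map_sub]
  exact sub_mem (toRat_mem_qspan ha) (toRat_mem_qspan hb)

theorem exists_nsmul_mem_gp_of_mem_qspan {m : ℕ} {P : AddSubmonoid (Fin m → ℤ)} {v : Fin m → ℚ}
    (hv : v ∈ qspan P) : ∃ n : ℕ, 1 ≤ n ∧ ∃ w ∈ gp P, n • v = toRat m w := by
  induction hv using Submodule.span_induction with
  | mem x hx =>
    obtain ⟨p, hp, rfl⟩ := hx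
    exact ⟨1, le_rfl, p, AddSubgroup.subset_closure hp, by simp⟩
  | zero => exact ⟨1, le_rfl, 0, zero_mem _, by simp⟩
  | add x y _ _ hx hy =>
    obtain ⟨n, hn, w, hw, h⟩ := hx
    obtain ⟨n', hn', w', hw', h'⟩ := hy
    refine ⟨n * n', Nat.mul_pos hn hn', n' • w + n • w',
      add_mem (nsmul_mem hw _) (nsmul_mem hw' _), ?_⟩
    rw [map_add, map_nsmul, map_nsmul, ← h, ← h', smul_add, smul_smul, smul_smul, mul_comm n' n]
  | smul a x _ hx =>
    obtain ⟨n, hn, w, hw, h⟩ := hx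
    refine ⟨a.den * n, Nat.mul_pos a.den_pos hn, a.num • w, zsmul_mem hw _, ?_⟩
    rw [map_zsmul, ← h]
    rw [← Nat.cast_smul_eq_nsmul ℚ, ← Nat.cast_smul_eq_nsmul ℚ, ← Int.cast_smul_eq_zsmul ℚ,
      smul_smul, smul_smul, ← Rat.mul_den_eq_num a]
    congr 1
    push_cast
    ring

theorem exists_nsmul_mem_gp {m : ℕ} {P : AddSubmonoid (Fin m → ℤ)} {z : Fin m → ℤ}
    (hz : toRat m z ∈ qspan P) : ∃ n : ℕ, 1 ≤ n ∧ n • z ∈ gp P := by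
  obtain ⟨n, hn, w, hw, h⟩ := exists_nsmul_mem_gp_of_mem_qspan hz
  refine ⟨n, hn, ?_⟩
  rw [← map_nsmul] at h
  rwa [toRat_injective m h]

/-- A `ℤ`-basis of the generated group stays independent over `ℚ` and spans the rational span. Ranks
of faces can therefore be compared by dimensions of subspaces. -/
theorem rank_eq_finrank {m : ℕ} (P : AddSubmonoid (Fin m → ℤ)) :
    rank P = Module.finrank ℚ (qspan P) := by
  let S : Submodule ℤ (Fin m → ℤ) := (gp P).toIntSubmodule
  have hr : rank P = Module.finrank ℤ S := rfl
  let b := Module.finBasis ℤ S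
  let w : Fin (Module.finrank ℤ S) → (Fin m → ℚ) := fun i => toRat m (b i : Fin m → ℤ)
  have hli : LinearIndependent ℚ w := by
    rw [← LinearIndependent.iff_fractionRing ℤ ℚ]
    have h1 : LinearIndependent ℤ (fun i => (b i : Fin m → ℤ)) :=
      b.linearIndependent.map' S.subtype (Submodule.ker_subtype S)
    exact h1.map' (toRat m).toIntLinearMap (LinearMap.ker_eq_bot.2 (toRat_injective m))
  have hsp : Submodule.span ℚ (Set.range w) = qspan P := by
    apply le_antisymm
    · rw [Submodule.span_le]
      rintro _ ⟨i, rfl⟩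
      exact toRat_mem_qspan_of_mem_gp (b i).2
    · rw [qspan, Submodule.span_le]
      rintro _ ⟨p, hp, rfl⟩
      have hp' : p ∈ S := AddSubgroup.subset_closure hp
      have h2 := b.sum_repr ⟨p, hp'⟩
      have h3 : p = ∑ i, b.repr ⟨p, hp'⟩ i • (b i : Fin m → ℤ) := by
        have h4 := congrArg S.subtype h2
        rw [map_sum] at h4
        exact h4.symm
      rw [SetLike.mem_coe, h3, map_sum]
      refine Submodule.sum_mem _ fun i _ => ?_
      rw [map_zsmul, ← Int.cast_smul_eq_zsmul ℚ]
      exact Submodule.smul_mem _ _ (Submodule.subset_span ⟨i, rfl⟩)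
  rw [hr, ← hsp, finrank_span_eq_card hli, Fintype.card_fin]

theorem qspan_mono {m : ℕ} {F P : AddSubmonoid (Fin m → ℤ)} (h : F ≤ P) : qspan F ≤ qspan P :=
  Submodule.span_mono (Set.image_mono h)

theorem rank_mono {m : ℕ} {F P : AddSubmonoid (Fin m → ℤ)} (h : F ≤ P) : rank F ≤ rank P := by
  rw [rank_eq_finrank, rank_eq_finrank]
  exact Submodule.finrank_mono (qspan_mono h)

theorem rank_le {m : ℕ} (P : AddSubmonoid (Fin m → ℤ)) : rank P ≤ m := by
  rw [rank_eq_finrank]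
  simpa using (qspan P).finrank_le

/-! ### Faces -/

theorem IsFace.refl {m : ℕ} (P : AddSubmonoid (Fin m → ℤ)) : IsFace P P :=
  ⟨le_rfl, fun _ hp _ hq _ => ⟨hp, hq⟩⟩

theorem IsFace.trans {m : ℕ} {F G P : AddSubmonoid (Fin m → ℤ)} (h : IsFace F G)
    (h' : IsFace G P) : IsFace F P :=
  ⟨h.le.trans h'.le, fun p hp q hq hpq =>
    let h1 := h'.of_add_mem p hp q hq (h.le hpq)
    h.of_add_mem p h1.1 q h1.2 hpq⟩

theorem IsFace.inf {m : ℕ} {F G P : AddSubmonoid (Fin m → ℤ)} (h : IsFace F P)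
    (h' : IsFace G P) : IsFace (F ⊓ G) P :=
  ⟨inf_le_left.trans h.le, fun p hp q hq hpq =>
    ⟨⟨(h.of_add_mem p hp q hq hpq.1).1, (h'.of_add_mem p hp q hq hpq.2).1⟩,
      ⟨(h.of_add_mem p hp q hq hpq.1).2, (h'.of_add_mem p hp q hq hpq.2).2⟩⟩⟩

theorem IsFace.of_le {m : ℕ} {F G P : AddSubmonoid (Fin m → ℤ)} (h : IsFace F P)
    (hFG : F ≤ G) (hGP : G ≤ P) : IsFace F G :=
  ⟨hFG, fun p hp q hq hpq => h.of_add_mem p (hGP hp) q (hGP hq) hpq⟩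

theorem IsFace.mem_of_nsmul_mem {m : ℕ} {F P : AddSubmonoid (Fin m → ℤ)} (h : IsFace F P)
    {p : Fin m → ℤ} (hp : p ∈ P) {n : ℕ} (hn : 1 ≤ n) (hnp : n • p ∈ F) : p ∈ F := by
  obtain ⟨k, rfl⟩ := Nat.exists_eq_add_of_le hn
  rw [add_smul, one_smul] at hnp
  exact (h.of_add_mem p hp (k • p) (nsmul_mem hp k) hnp).1

/-- Some positive multiple of `p` is a difference `a - b` of elements of `F`; then `n • p + b = a`
lies in `F`, and the face property gives `p`. So a face is cut out of `P` by its rational span. -/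
theorem IsFace.mem_of_mem_qspan {m : ℕ} {F P : AddSubmonoid (Fin m → ℤ)} (h : IsFace F P)
    {p : Fin m → ℤ} (hp : p ∈ P) (hq : toRat m p ∈ qspan F) : p ∈ F := by
  obtain ⟨n, hn, hw⟩ := exists_nsmul_mem_gp hq
  obtain ⟨a, ha, b, hb, hab⟩ := mem_gp_iff.1 hw
  refine h.mem_of_nsmul_mem hp hn
    (h.of_add_mem (n • p) (nsmul_mem hp n) b (h.le hb) ?_).1
  rw [hab, sub_add_cancel]
  exact ha

/-- After multiplication by both denominators the combination is a sum of natural multiples of `p`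
and `q`, to which the face property applies. This is how signs of coefficients decide membership in
facets. -/
theorem IsFace.mem_of_combination {m : ℕ} {F P : AddSubmonoid (Fin m → ℤ)} (h : IsFace F P)
    {p q : Fin m → ℤ} (hp : p ∈ P) (hq : q ∈ P) {a b : ℚ} (ha : 0 < a) (hb : 0 ≤ b)
    (hab : a • toRat m p + b • toRat m q ∈ qspan F) : p ∈ F := by
  have hA : 1 ≤ a.num.natAbs * b.den := Nat.mul_pos
    (Int.natAbs_pos.2 (Rat.num_pos.2 ha).ne') b.den_pos
  have ea : ((a.num.natAbs : ℕ) : ℚ) = a * a.den := by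
    have h0 : ((a.num.natAbs : ℕ) : ℤ) = a.num := by have := Rat.num_pos.2 ha; omega
    rw [Rat.mul_den_eq_num, ← Int.cast_natCast, h0]
  have eb : ((b.num.natAbs : ℕ) : ℚ) = b * b.den := by
    have h0 : ((b.num.natAbs : ℕ) : ℤ) = b.num := by have := Rat.num_nonneg.2 hb; omega
    rw [Rat.mul_den_eq_num, ← Int.cast_natCast, h0]
  refine h.mem_of_nsmul_mem hp hA (h.of_add_mem _ (nsmul_mem hp _)
    ((b.num.natAbs * a.den) • q) (nsmul_mem hq _)
    (h.mem_of_mem_qspan (add_mem (nsmul_mem hp _) (nsmul_mem hq _)) ?_)).1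
  convert Submodule.smul_mem _ ((a.den : ℚ) * b.den) hab using 1
  rw [map_add, map_nsmul, map_nsmul, ← Nat.cast_smul_eq_nsmul ℚ, ← Nat.cast_smul_eq_nsmul ℚ]
  push_cast
  rw [ea, eb]
  module

/-- Equal dimension forces equal rational spans, and a face is determined by its span. -/
theorem IsFace.eq_of_rank_le {m : ℕ} {F P : AddSubmonoid (Fin m → ℤ)} (h : IsFace F P)
    (hr : rank P ≤ rank F) : F = P := by
  rw [rank_eq_finrank, rank_eq_finrank] at hr
  have := Submodule.eq_of_le_of_finrank_le (qspan_mono h.le) hr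
  refine le_antisymm h.le fun p hp => h.mem_of_mem_qspan hp ?_
  rw [this]
  exact toRat_mem_qspan hp

theorem IsFace.rank_lt {m : ℕ} {F P : AddSubmonoid (Fin m → ℤ)} (h : IsFace F P)
    (hne : F ≠ P) : rank F < rank P :=
  lt_of_not_ge fun hr => hne (h.eq_of_rank_le hr)

/-- Comparable faces of the same codimension are equal. -/
theorem IsFace.eq_of_codim {m k : ℕ} {F G P : AddSubmonoid (Fin m → ℤ)} (h : IsFace F P)
    (hG : IsFace G P) (hFG : F ≤ G) (hk : HasCodim F P k) (hk' : HasCodim G P k) : F = G :=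
  (h.of_le hFG hG.le).eq_of_rank_le (by unfold HasCodim at *; omega)

/-- If a sum of generators lies in a face, so does each summand. Hence faces inherit finite
generation, and there are only finitely many of them. -/
theorem IsFace.eq_closure {m : ℕ} {F P : AddSubmonoid (Fin m → ℤ)} (h : IsFace F P)
    {S : Set (Fin m → ℤ)} (hS : AddSubmonoid.closure S = P) :
    F = AddSubmonoid.closure {s ∈ S | s ∈ F} := by
  apply le_antisymm
  · intro p hp
    have hpP : p ∈ AddSubmonoid.closure S := hS ▸ h.le hp
    revert hp
    induction hpP using AddSubmonoid.closure_induction with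
    | mem x hx => exact fun hp => AddSubmonoid.subset_closure ⟨hx, hp⟩
    | zero => exact fun _ => zero_mem _
    | add x y hx hy ihx ihy =>
      intro hp
      rw [hS] at hx hy
      have := h.of_add_mem x hx y hy hp
      exact add_mem (ihx this.1) (ihy this.2)
  · rw [AddSubmonoid.closure_le]
    exact fun s hs => hs.2

theorem IsFace.fg {m : ℕ} {F P : AddSubmonoid (Fin m → ℤ)} (h : IsFace F P) (hP : P.FG) :
    F.FG := by
  obtain ⟨S, hS⟩ := hP
  classical
  refine ⟨S.filter (· ∈ F), ?_⟩
  rw [h.eq_closure hS]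
  congr 1
  ext s
  simp only [Finset.coe_filter]
  rw [← h.eq_closure hS]
  rfl

theorem finite_faces {m : ℕ} {P : AddSubmonoid (Fin m → ℤ)} (hP : P.FG) :
    {F | IsFace F P}.Finite := by
  obtain ⟨S, hS⟩ := hP
  refine Set.Finite.of_finite_image (f := fun F => {s ∈ (S : Set (Fin m → ℤ)) | s ∈ F}) ?_ ?_
  · refine (S.finite_toSet.finite_subsets).subset ?_
    rintro _ ⟨F, _, rfl⟩
    exact fun s hs => hs.1
  · intro F hF G hG hFG
    rw [IsFace.eq_closure hF hS, IsFace.eq_closure hG hS]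
    exact congrArg _ hFG

theorem WeaklyToric.face {m : ℕ} {F P : AddSubmonoid (Fin m → ℤ)} (hP : WeaklyToric P)
    (h : IsFace F P) : WeaklyToric F := by
  refine ⟨h.fg hP.fg, fun p hp n hn hnp => ?_⟩
  have hpP : p ∈ P := hP.saturated p (AddSubgroup.closure_mono h.le hp) n hn (h.le hnp)
  exact h.mem_of_nsmul_mem hpP hn hnp

theorem isFace_zeroSet {m : ℕ} (P : AddSubmonoid (Fin m → ℤ)) (f : (Fin m → ℤ) →+ ℚ)
    (hf : ∀ p ∈ P, 0 ≤ f p) : IsFace (P ⊓ AddMonoidHom.mker f) P := by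
  refine ⟨inf_le_left, fun p hp q hq hpq => ?_⟩
  have h0 : f p + f q = 0 := by rw [← map_add]; exact hpq.2
  have h1 := hf p hp
  have h2 := hf q hq
  exact ⟨⟨hp, (by linarith : f p = 0)⟩, ⟨hq, (by linarith : f q = 0)⟩⟩

/-! ### Supporting functionals -/

/-- Gordan's alternative: either some nontrivial natural combination of the vectors vanishes,
or some linear functional is positive on all of them. -/
theorem gordan : ∀ (n : ℕ) (V : Type) [AddCommGroup V] [Module ℚ V] (v : Fin n → V),
    (∃ a : Fin n → ℕ, a ≠ 0 ∧ ∑ i, a i • v i = 0) ∨ ∃ f : V →ₗ[ℚ] ℚ, ∀ i, 0 < f (v i) := by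
  intro n
  induction n with
  | zero => exact fun V _ _ v => Or.inr ⟨0, fun i => i.elim0⟩
  | succ n ih =>
    intro V _ _ v
    by_cases hv0 : v 0 = 0
    · refine Or.inl ⟨Pi.single 0 1, by simp, ?_⟩
      rw [Finset.sum_eq_single 0] <;> simp +contextual [hv0]
    rcases ih V (fun i => v i.succ) with ⟨a, ha, h⟩ | ⟨f, hf⟩
    · refine Or.inl ⟨Fin.cons 0 a, ?_, by simpa [Fin.sum_univ_succ] using h⟩
      intro h0
      exact ha (funext fun i => by simpa using congrFun h0 i.succ)
    -- Modulo `v 0`, a relation among the remaining vectors reads `∑ a i • v (i + 1) = c • v 0`. For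
    -- `c ≤ 0` this is a relation of the required kind; for `0 < c` it forces `f (v 0) > 0`.
    rcases ih (V ⧸ Submodule.span ℚ {v 0})
      (fun i => Submodule.Quotient.mk (v i.succ)) with ⟨a, ha, h⟩ | ⟨g, hg⟩
    · have h' : ∑ i, a i • v i.succ ∈ Submodule.span ℚ {v 0} := by
        rw [← Submodule.Quotient.mk_eq_zero, ← h]
        change (Submodule.mkQ _) _ = ∑ i, a i • (Submodule.mkQ _) (v i.succ)
        simp
      obtain ⟨c, hc⟩ := Submodule.mem_span_singleton.1 h'
      rcases le_or_gt c 0 with hc0 | hc0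
      · refine Or.inl ⟨Fin.cons c.num.natAbs (fun i => c.den * a i), ?_, ?_⟩
        · intro h0
          refine ha (funext fun i => ?_)
          have := congrFun h0 i.succ
          simpa using this
        · rw [Fin.sum_univ_succ]
          simp only [Fin.cons_zero, Fin.cons_succ, mul_smul]
          rw [← Finset.smul_sum, ← hc, ← Nat.cast_smul_eq_nsmul ℚ, ← Nat.cast_smul_eq_nsmul ℚ,
            smul_smul, ← add_smul]
          have h3 : ((c.num.natAbs : ℕ) : ℚ) = -c.num := by
            have : c.num ≤ 0 := Rat.num_nonpos.2 hc0
            have h4 : ((c.num.natAbs : ℕ) : ℤ) = -c.num := by omega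
            have h5 := congrArg (Int.cast : ℤ → ℚ) h4
            rwa [Int.cast_natCast, Int.cast_neg] at h5
          have h5 := Rat.mul_den_eq_num c
          rw [show ((c.num.natAbs : ℕ) : ℚ) + (c.den : ℚ) * c = 0 by rw [h3, ← h5]; ring,
            zero_smul]
      · refine Or.inr ⟨f, fun i => ?_⟩
        refine Fin.cases ?_ hf i
        have h1 : c * f (v 0) = ∑ i, (a i : ℚ) * f (v i.succ) := by
          have := congrArg f hc
          simpa using this
        obtain ⟨j, hj⟩ : ∃ j, a j ≠ 0 := Function.ne_iff.1 ha
        have h2 : 0 < ∑ i, (a i : ℚ) * f (v i.succ) := by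
          refine Finset.sum_pos' (fun i _ => mul_nonneg (Nat.cast_nonneg _) (hf i).le)
            ⟨j, Finset.mem_univ _, mul_pos ?_ (hf j)⟩
          exact_mod_cast Nat.pos_of_ne_zero hj
        rw [← h1] at h2
        exact (mul_pos_iff_of_pos_left hc0).1 h2
    · obtain ⟨e, he, -⟩ := Submodule.exists_le_ker_of_notMem (K := ℚ) (p := (⊥ : Submodule ℚ V))
        (v := v 0) (by simpa using hv0)
      -- The functional `g` vanishes on `v 0` and is positive on the other vectors, so a large
      -- multiple of it absorbs the values of `(e (v 0))⁻¹ • e`, which is `1` at `v 0`.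
      let N : ℚ := ∑ i : Fin n, |(e (v 0))⁻¹ * e (v i.succ)| / g (Submodule.Quotient.mk (v i.succ)) + 1
      refine Or.inr ⟨N • (g ∘ₗ Submodule.mkQ _) + (e (v 0))⁻¹ • e, fun i => ?_⟩
      refine Fin.cases ?_ (fun i => ?_) i
      · have h0 : Submodule.mkQ (Submodule.span ℚ {v 0}) (v 0) = 0 := by
          rw [Submodule.mkQ_apply, Submodule.Quotient.mk_eq_zero]
          exact Submodule.mem_span_singleton_self _
        change 0 < N * g (Submodule.mkQ _ (v 0)) + (e (v 0))⁻¹ * e (v 0)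
        rw [h0, map_zero, mul_zero, zero_add, inv_mul_cancel₀ he]
        exact zero_lt_one
      · have h1 : |(e (v 0))⁻¹ * e (v i.succ)| / g (Submodule.Quotient.mk (v i.succ)) + 1 ≤ N := by
          have := Finset.single_le_sum (f := fun i : Fin n => |(e (v 0))⁻¹ * e (v i.succ)| /
            g (Submodule.Quotient.mk (v i.succ)))
            (fun j _ => div_nonneg (abs_nonneg _) (hg j).le) (Finset.mem_univ i)
          linarith
        have h2 := mul_le_mul_of_nonneg_right h1 (hg i).le
        rw [add_mul, div_mul_cancel₀ _ (hg i).ne', one_mul] at h2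
        have h3 := neg_abs_le ((e (v 0))⁻¹ * e (v i.succ))
        have h4 := hg i
        change 0 < N * g (Submodule.Quotient.mk (v i.succ)) + (e (v 0))⁻¹ * e (v i.succ)
        linarith

/-- Gordan's alternative is applied to the generators outside `G`, modulo the span of `G`. A
nontrivial relation would put a sum of such generators into `G`, hence one of them, so the positive
functional exists. -/
theorem IsFace.exists_supporting {m : ℕ} {G P : AddSubmonoid (Fin m → ℤ)} (h : IsFace G P)
    (hP : P.FG) : ∃ f : (Fin m → ℤ) →+ ℚ, (∀ p ∈ P, 0 ≤ f p) ∧ ∀ p ∈ P, f p = 0 ↔ p ∈ G := by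
  classical
  obtain ⟨S, hS⟩ := hP
  let T := S.filter (· ∉ G)
  let e := T.equivFin.symm
  have hSP : ∀ s ∈ S, s ∈ P := fun s hs => hS ▸ AddSubmonoid.subset_closure hs
  rcases gordan T.card ((Fin m → ℚ) ⧸ qspan G)
    (fun i => Submodule.Quotient.mk (toRat m (e i))) with ⟨a, ha, h0⟩ | ⟨f, hf⟩
  · exfalso
    have h1 : toRat m (∑ i, a i • (e i : Fin m → ℤ)) ∈ qspan G := by
      rw [← Submodule.Quotient.mk_eq_zero, ← h0, map_sum]
      change (Submodule.mkQ _) _ = ∑ i, a i • (Submodule.mkQ _) (toRat m (e i))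
      rw [map_sum]
      exact Finset.sum_congr rfl fun i _ => by rw [map_nsmul, map_nsmul]
    have heP : ∀ i, (e i : Fin m → ℤ) ∈ P := fun i => hSP _ (Finset.mem_filter.1 (e i).2).1
    obtain ⟨j, hj⟩ : ∃ j, a j ≠ 0 := Function.ne_iff.1 ha
    have hsum := h.mem_of_mem_qspan (sum_mem fun i _ => nsmul_mem (heP i) (a i)) h1
    rw [← Finset.add_sum_erase _ _ (Finset.mem_univ j)] at hsum
    have h2 := (h.of_add_mem _ (nsmul_mem (heP j) (a j)) _
      (sum_mem fun i _ => nsmul_mem (heP i) (a i)) hsum).1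
    exact (Finset.mem_filter.1 (e j).2).2
      (h.mem_of_nsmul_mem (heP j) (Nat.one_le_iff_ne_zero.2 hj) h2)
  · let g : (Fin m → ℤ) →+ ℚ := (f ∘ₗ Submodule.mkQ _).toAddMonoidHom.comp (toRat m)
    have hgG : ∀ p ∈ G, g p = 0 := fun p hp => by
      change f (Submodule.mkQ _ (toRat m p)) = 0
      rw [Submodule.mkQ_apply, (Submodule.Quotient.mk_eq_zero _).2 (toRat_mem_qspan hp), map_zero]
    have hgS : ∀ s ∈ S, s ∉ G → 0 < g s := fun s hs hsG => by
      have := hf (e.symm ⟨s, Finset.mem_filter.2 ⟨hs, hsG⟩⟩)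
      rw [Equiv.apply_symm_apply] at this
      exact this
    have key : ∀ p ∈ P, 0 ≤ g p ∧ (g p = 0 → p ∈ G) := by
      intro p hp
      rw [← hS] at hp
      induction hp using AddSubmonoid.closure_induction with
      | mem x hx =>
        by_cases hxG : x ∈ G
        · exact ⟨(hgG x hxG).ge, fun _ => hxG⟩
        · exact ⟨(hgS x hx hxG).le, fun h0 => absurd h0 (hgS x hx hxG).ne'⟩
      | zero => exact ⟨by simp, fun _ => zero_mem _⟩
      | add x y _ _ hx hy =>
        rw [map_add]
        exact ⟨add_nonneg hx.1 hy.1, fun h0 => add_mem (hx.2 (by linarith [hx.1, hy.1]))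
          (hy.2 (by linarith [hx.1, hy.1]))⟩
    exact ⟨g, fun p hp => (key p hp).1, fun p hp => ⟨(key p hp).2, hgG p⟩⟩

/-- Let `f` support `G`, and let `μ` vanish on `G` without being proportional to `f` on `P`. If `ρ₁`
and `ρ₂` are the least and greatest values of `μ / f` on generators outside `G`, then `μ - ρ₁ f` and
`ρ₂ f - μ` are nonnegative on `P` and cut out two proper faces larger than `G`. Their sum is a
positive multiple of `f`, so the two faces meet in `G`. -/
theorem IsFace.exists_two_between {m : ℕ} {G P : AddSubmonoid (Fin m → ℤ)} (h : IsFace G P)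
    (hP : P.FG) (hr : rank G + 2 ≤ rank P) :
    ∃ F₁ F₂, IsFace F₁ P ∧ IsFace F₂ P ∧ F₁ ≠ P ∧ F₂ ≠ P ∧ G ≠ F₁ ∧ G ≠ F₂ ∧ F₁ ⊓ F₂ = G := by
  classical
  obtain ⟨f, hf0, hf⟩ := h.exists_supporting hP
  obtain ⟨S, hS⟩ := hP
  have hSP : ∀ s ∈ S, s ∈ P := fun s hs => hS ▸ AddSubmonoid.subset_closure hs
  have hGP : ¬ P ≤ G := fun hle => by have := rank_mono hle; omega
  obtain ⟨p₁, hp₁, hp₁G⟩ := SetLike.not_le_iff_exists.1 hGP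
  -- The span of `G` and one further element has dimension at most `rank G + 1`, so the rank gap of
  -- two leaves an element of `P` outside it.
  let E : Submodule ℚ (Fin m → ℚ) := qspan G ⊔ Submodule.span ℚ {toRat m p₁}
  have hE : ∃ p₂ ∈ P, toRat m p₂ ∉ E := by
    by_contra! hcon
    have h1 : qspan P ≤ E := by
      rw [qspan, Submodule.span_le]
      rintro _ ⟨p, hp, rfl⟩
      exact hcon p hp
    have h2 := Submodule.finrank_mono h1
    have h3 := Submodule.finrank_add_le_finrank_add_finrank (qspan G)
      (Submodule.span ℚ {toRat m p₁})
    have h4 : Module.finrank ℚ (Submodule.span ℚ {toRat m p₁}) ≤ 1 := by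
      simpa using finrank_span_le_card (R := ℚ) ({toRat m p₁} : Set (Fin m → ℚ))
    rw [rank_eq_finrank, rank_eq_finrank] at hr
    change _ ≤ Module.finrank ℚ E at h2
    change Module.finrank ℚ E ≤ _ at h3
    omega
  obtain ⟨p₂, hp₂, hp₂E⟩ := hE
  obtain ⟨μ', hμ'₂, hμ'E⟩ := Submodule.exists_le_ker_of_notMem hp₂E
  let μ : (Fin m → ℤ) →+ ℚ := μ'.toAddMonoidHom.comp (toRat m)
  have hμ₂ : μ p₂ ≠ 0 := hμ'₂
  have hμ₁ : μ p₁ = 0 := hμ'E (Submodule.mem_sup_right (Submodule.mem_span_singleton_self _))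
  have hμG : ∀ p ∈ G, μ p = 0 := fun p hp => hμ'E (Submodule.mem_sup_left (toRat_mem_qspan hp))
  let T := S.filter (· ∉ G)
  have hT : T.Nonempty := by
    by_contra hT
    rw [Finset.not_nonempty_iff_eq_empty, Finset.filter_eq_empty_iff] at hT
    refine hGP ?_
    rw [← hS, AddSubmonoid.closure_le]
    intro s hs
    by_contra hsG
    exact hT hs hsG
  have hfT : ∀ s ∈ T, 0 < f s := fun s hs => by
    rw [Finset.mem_filter] at hs
    exact lt_of_le_of_ne (hf0 s (hSP s hs.1)) fun h0 => hs.2 ((hf s (hSP s hs.1)).1 h0.symm)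
  -- an inequality for `μ` and `f` on the generators outside `G` holds on all of `P`
  have hext : ∀ φ : (Fin m → ℤ) →+ ℚ, (∀ p ∈ G, φ p = 0) → (∀ s ∈ T, 0 ≤ φ s) →
      ∀ p ∈ P, 0 ≤ φ p := by
    intro φ hG hφ p hp
    rw [← hS] at hp
    induction hp using AddSubmonoid.closure_induction with
    | mem x hx =>
      by_cases hxG : x ∈ G
      · exact (hG x hxG).ge
      · exact hφ x (Finset.mem_filter.2 ⟨hx, hxG⟩)
    | zero => simp
    | add x y _ _ hx hy => rw [map_add]; exact add_nonneg hx hy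
  obtain ⟨g₁, hg₁, hmin⟩ := T.exists_min_image (fun s => μ s / f s) hT
  obtain ⟨g₂, hg₂, hmax⟩ := T.exists_max_image (fun s => μ s / f s) hT
  set ρ₁ := μ g₁ / f g₁ with hρ₁
  set ρ₂ := μ g₂ / f g₂ with hρ₂
  let φ₁ : (Fin m → ℤ) →+ ℚ := μ - (AddMonoidHom.mulLeft ρ₁).comp f
  let φ₂ : (Fin m → ℤ) →+ ℚ := (AddMonoidHom.mulLeft ρ₂).comp f - μ
  have e₁ : ∀ p, φ₁ p = μ p - ρ₁ * f p := fun p => rfl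
  have e₂ : ∀ p, φ₂ p = ρ₂ * f p - μ p := fun p => rfl
  have hfG : ∀ p ∈ G, f p = 0 := fun p hp => (hf p (h.le hp)).2 hp
  have h₁ : ∀ p ∈ P, 0 ≤ φ₁ p := by
    refine hext φ₁ (fun p hp => by rw [e₁, hμG p hp, hfG p hp]; ring) fun s hs => ?_
    have := (le_div_iff₀ (hfT s hs)).1 (hmin s hs)
    rw [e₁]; linarith
  have h₂ : ∀ p ∈ P, 0 ≤ φ₂ p := by
    refine hext φ₂ (fun p hp => by rw [e₂, hμG p hp, hfG p hp]; ring) fun s hs => ?_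
    have := (div_le_iff₀ (hfT s hs)).1 (hmax s hs)
    rw [e₂]; linarith
  -- Equality would make `μ` proportional to `f` on `P`. At `p₁`, where `μ` vanishes and `f` does
  -- not, the factor is zero; this contradicts `μ p₂ ≠ 0`.
  have hne : ρ₁ ≠ ρ₂ := by
    intro heq
    have h3 : ∀ p ∈ P, μ p = ρ₁ * f p := fun p hp => by
      have a1 := h₁ p hp
      have a2 := h₂ p hp
      rw [e₁] at a1
      rw [e₂, ← heq] at a2
      linarith
    have h4 := h3 p₁ hp₁
    rw [hμ₁] at h4
    have h5 : f p₁ ≠ 0 := fun h0 => hp₁G ((hf p₁ hp₁).1 h0)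
    have h6 : ρ₁ = 0 := by
      rcases mul_eq_zero.1 h4.symm with h | h
      · exact h
      · exact absurd h h5
    exact hμ₂ (by rw [h3 p₂ hp₂, h6, zero_mul])
  have hTP : ∀ s ∈ T, s ∈ P ∧ s ∉ G := fun s hs =>
    ⟨hSP s (Finset.mem_filter.1 hs).1, (Finset.mem_filter.1 hs).2⟩
  have z₁ : φ₁ g₁ = 0 := by
    rw [e₁, hρ₁, div_mul_cancel₀ _ (hfT g₁ hg₁).ne', sub_self]
  have z₂ : φ₂ g₂ = 0 := by
    rw [e₂, hρ₂, div_mul_cancel₀ _ (hfT g₂ hg₂).ne', sub_self]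
  have hsum : ∀ p, φ₁ p + φ₂ p = (ρ₂ - ρ₁) * f p := fun p => by rw [e₁, e₂]; ring
  have hGφ₁ : ∀ p ∈ G, φ₁ p = 0 := fun p hp => by rw [e₁, hμG p hp, hfG p hp]; ring
  have hGφ₂ : ∀ p ∈ G, φ₂ p = 0 := fun p hp => by rw [e₂, hμG p hp, hfG p hp]; ring
  refine ⟨_, _, isFace_zeroSet P φ₁ h₁, isFace_zeroSet P φ₂ h₂, ?_, ?_, ?_, ?_, ?_⟩
  · intro heq
    have h3 : φ₁ g₂ = 0 := (heq.ge (hTP g₂ hg₂).1).2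
    have := hsum g₂
    rw [h3, z₂, add_zero] at this
    rcases mul_eq_zero.1 this.symm with h | h
    · exact hne (sub_eq_zero.1 h).symm
    · exact (hfT g₂ hg₂).ne' h
  · intro heq
    have h3 : φ₂ g₁ = 0 := (heq.ge (hTP g₁ hg₁).1).2
    have := hsum g₁
    rw [h3, z₁, add_zero] at this
    rcases mul_eq_zero.1 this.symm with h | h
    · exact hne (sub_eq_zero.1 h).symm
    · exact (hfT g₁ hg₁).ne' h
  · intro heq
    exact (hTP g₁ hg₁).2 (heq.ge ⟨(hTP g₁ hg₁).1, z₁⟩)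
  · intro heq
    exact (hTP g₂ hg₂).2 (heq.ge ⟨(hTP g₂ hg₂).1, z₂⟩)
  · apply le_antisymm
    · rintro p ⟨⟨hp, hp1⟩, ⟨_, hp2⟩⟩
      have := hsum p
      rw [show φ₁ p = 0 from hp1, show φ₂ p = 0 from hp2, add_zero] at this
      rcases mul_eq_zero.1 this.symm with h | h
      · exact absurd (sub_eq_zero.1 h).symm hne
      · exact (hf p hp).1 h
    · exact fun p hp => ⟨⟨h.le hp, hGφ₁ p hp⟩, ⟨h.le hp, hGφ₂ p hp⟩⟩

/-- A proper face above `G` of maximal rank works: if its codimension were at least two,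
`IsFace.exists_two_between` would give a larger proper face. -/
theorem IsFace.exists_codim_one {m : ℕ} {G P : AddSubmonoid (Fin m → ℤ)} (h : IsFace G P)
    (hP : P.FG) (hne : G ≠ P) : ∃ F, IsFace F P ∧ G ≤ F ∧ HasCodim F P 1 := by
  have hfin : {F | IsFace F P ∧ G ≤ F ∧ F ≠ P}.Finite :=
    (finite_faces hP).subset fun F hF => hF.1
  obtain ⟨F, ⟨hF, hGF, hFP⟩, hmax⟩ := Set.exists_max_image _ rank hfin ⟨G, h, le_rfl, hne⟩
  refine ⟨F, hF, hGF, ?_⟩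
  have h1 := hF.rank_lt hFP
  by_contra hcon
  obtain ⟨F₁, F₂, hF₁, hF₂, hF₁P, -, hne₁, -, hinf⟩ :=
    hF.exists_two_between hP (by unfold HasCodim at hcon; omega)
  have hle : F ≤ F₁ := by rw [← hinf]; exact inf_le_left
  have h2 := (hF.of_le hle hF₁.le).rank_lt hne₁
  have h3 := hmax F₁ ⟨hF₁, hGF.trans hle, hF₁P⟩
  omega

/-- A face of codimension two lies in exactly two faces of codimension one. -/
theorem IsFace.exists_pair {m : ℕ} {G P : AddSubmonoid (Fin m → ℤ)} (h : IsFace G P)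
    (hP : P.FG) (hk : HasCodim G P 2) :
    ∃ F₁ F₂, IsFace F₁ P ∧ IsFace F₂ P ∧ HasCodim F₁ P 1 ∧ HasCodim F₂ P 1 ∧ F₁ ≠ F₂ ∧
      F₁ ⊓ F₂ = G := by
  obtain ⟨F₁, F₂, hF₁, hF₂, h1, h2, h3, h4, hinf⟩ := h.exists_two_between hP hk.le
  have hl1 : G ≤ F₁ := by rw [← hinf]; exact inf_le_left
  have hl2 : G ≤ F₂ := by rw [← hinf]; exact inf_le_right
  have a1 := hF₁.rank_lt h1
  have a2 := hF₂.rank_lt h2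
  have a3 := (h.of_le hl1 hF₁.le).rank_lt h3
  have a4 := (h.of_le hl2 hF₂.le).rank_lt h4
  refine ⟨F₁, F₂, hF₁, hF₂, ?_, ?_, ?_, hinf⟩
  · unfold HasCodim at *; omega
  · unfold HasCodim at *; omega
  · rintro rfl
    rw [inf_idem] at hinf
    exact h3 hinf.symm

/-- The intersection is a proper face of `F₁`, so its rank is at most that of `G`, which it
contains. -/
theorem IsFace.inf_eq {m : ℕ} {G F₁ F₂ P : AddSubmonoid (Fin m → ℤ)} (hG : IsFace G P)
    (h₁ : IsFace F₁ P) (h₂ : IsFace F₂ P) (hk : HasCodim G P 2) (hk₁ : HasCodim F₁ P 1)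
    (hk₂ : HasCodim F₂ P 1) (hl₁ : G ≤ F₁) (hl₂ : G ≤ F₂) (hne : F₁ ≠ F₂) : F₁ ⊓ F₂ = G := by
  have h3 : IsFace (F₁ ⊓ F₂) F₁ := (h₁.inf h₂).of_le inf_le_left h₁.le
  have h4 : F₁ ⊓ F₂ ≠ F₁ := fun h => hne (h₁.eq_of_codim h₂ (inf_eq_left.1 h) hk₁ hk₂)
  have h5 := h3.rank_lt h4
  refine ((hG.of_le (le_inf hl₁ hl₂) (h₁.inf h₂).le).eq_of_rank_le ?_).symm
  unfold HasCodim at *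
  omega

/-- Three different facets above `G` would meet pairwise in `G`. Choose a point outside `G` in each;
modulo the span of `G` these lie in a plane, so `x₃ = c₁ x₁ + c₂ x₂` there. -/
theorem IsFace.eq_or_eq {m : ℕ} {G F₁ F₂ F₃ P : AddSubmonoid (Fin m → ℤ)} (hG : IsFace G P)
    (h₁ : IsFace F₁ P) (h₂ : IsFace F₂ P) (h₃ : IsFace F₃ P) (hk : HasCodim G P 2)
    (hk₁ : HasCodim F₁ P 1) (hk₂ : HasCodim F₂ P 1) (hk₃ : HasCodim F₃ P 1)
    (hl₁ : G ≤ F₁) (hl₂ : G ≤ F₂) (hl₃ : G ≤ F₃) (hne : F₁ ≠ F₂) : F₃ = F₁ ∨ F₃ = F₂ := by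
  by_contra! hcon
  obtain ⟨h31, h32⟩ := hcon
  have key : ∀ F, IsFace F P → HasCodim F P 1 → G ≤ F → ∃ x ∈ F, x ∉ G := by
    intro F _ hF' _
    refine SetLike.not_le_iff_exists.1 fun hle => ?_
    have := rank_mono hle
    unfold HasCodim at *
    omega
  obtain ⟨x₁, hx₁, hx₁G⟩ := key F₁ h₁ hk₁ hl₁
  obtain ⟨x₂, hx₂, hx₂G⟩ := key F₂ h₂ hk₂ hl₂
  obtain ⟨x₃, hx₃, hx₃G⟩ := key F₃ h₃ hk₃ hl₃
  have i12 := hG.inf_eq h₁ h₂ hk hk₁ hk₂ hl₁ hl₂ hne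
  have i13 := hG.inf_eq h₁ h₃ hk hk₁ hk₃ hl₁ hl₃ (Ne.symm h31)
  have i23 := hG.inf_eq h₂ h₃ hk hk₂ hk₃ hl₂ hl₃ (Ne.symm h32)
  have hx₂1 : x₂ ∉ F₁ := fun h => hx₂G (i12.le ⟨h, hx₂⟩)
  have step : ∀ (E E' : Submodule ℚ (Fin m → ℚ)) (x : Fin m → ℚ), E ≤ E' → x ∈ E' → x ∉ E →
      Module.finrank ℚ E' = Module.finrank ℚ E + 1 → ∀ y ∈ E', ∃ c : ℚ, y - c • x ∈ E := by
    intro E E' x hEE' hx hxE hd y hy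
    have h1 : E ⊔ Submodule.span ℚ {x} ≤ E' :=
      sup_le hEE' ((Submodule.span_singleton_le_iff_mem _ _).2 hx)
    have h2 : E < E ⊔ Submodule.span ℚ {x} := by
      refine lt_of_le_of_ne le_sup_left fun h => hxE ?_
      rw [h]
      exact Submodule.mem_sup_right (Submodule.mem_span_singleton_self x)
    have h3 := Submodule.finrank_lt_finrank_of_lt h2
    have h4 := Submodule.eq_of_le_of_finrank_le h1 (by omega)
    rw [← h4] at hy
    obtain ⟨e, he, z, hz, rfl⟩ := Submodule.mem_sup.1 hy
    obtain ⟨c, rfl⟩ := Submodule.mem_span_singleton.1 hz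
    exact ⟨c, by simpa using he⟩
  unfold HasCodim at hk hk₁ hk₂ hk₃
  simp only [rank_eq_finrank] at hk hk₁ hk₂ hk₃
  obtain ⟨c₂, hc₂⟩ := step (qspan F₁) (qspan P) (toRat m x₂) (qspan_mono h₁.le)
    (toRat_mem_qspan (h₂.le hx₂)) (fun h => hx₂1 (h₁.mem_of_mem_qspan (h₂.le hx₂) h))
    hk₁.symm (toRat m x₃) (toRat_mem_qspan (h₃.le hx₃))
  obtain ⟨c₁, hc₁⟩ := step (qspan G) (qspan F₁) (toRat m x₁) (qspan_mono hl₁)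
    (toRat_mem_qspan hx₁) (fun h => hx₁G (hG.mem_of_mem_qspan (h₁.le hx₁) h))
    (by omega) _ hc₂
  have hx₁P := h₁.le hx₁
  have hx₂P := h₂.le hx₂
  have hx₃P := h₃.le hx₃
  have hG3 := qspan_mono hl₃ hc₁
  have hG2 := qspan_mono hl₂ hc₁
  have q₁ := toRat_mem_qspan hx₁
  have q₂ := toRat_mem_qspan hx₂
  have q₃ := toRat_mem_qspan hx₃
  -- For every sign pattern of `c₁, c₂`, moving terms across gives a nonnegative combination in the
  -- span of one of the faces; this puts some `xᵢ` into a second facet, or directly into `G`.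
  rcases lt_trichotomy c₁ 0 with h | h | h
  · rcases le_or_gt c₂ 0 with h' | h'
    · refine hx₃G (i13.le ⟨h₁.mem_of_combination hx₃P hx₂P one_pos (neg_nonneg.2 h') ?_, hx₃⟩)
      convert hc₂ using 1
      module
    · refine hx₃G (i23.le ⟨h₂.mem_of_combination hx₃P hx₁P one_pos (neg_nonneg.2 h.le) ?_, hx₃⟩)
      convert add_mem hG2 (Submodule.smul_mem _ c₂ q₂) using 1
      module
  · subst h
    rcases lt_trichotomy c₂ 0 with h' | h' | h'
    · refine hx₃G (hG.mem_of_combination hx₃P hx₂P one_pos (neg_nonneg.2 h'.le) ?_)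
      convert hc₁ using 1
      module
    · subst h'
      exact hx₃G (hG.mem_of_mem_qspan hx₃P (by simpa using hc₁))
    · refine hx₂G (i23.le ⟨hx₂, h₃.mem_of_combination hx₂P hx₁P h' le_rfl ?_⟩)
      convert sub_mem q₃ hG3 using 1
      module
  · rcases le_or_gt 0 c₂ with h' | h'
    · refine hx₁G (i13.le ⟨hx₁, h₃.mem_of_combination hx₁P hx₂P h h' ?_⟩)
      convert sub_mem q₃ hG3 using 1
      module
    · refine hx₃G (i13.le ⟨h₁.mem_of_combination hx₃P hx₂P one_pos (neg_nonneg.2 h'.le) ?_, hx₃⟩)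
      convert hc₂ using 1
      module

/-- A face of codimension `k` is the end of a flag of faces, each of codimension one in the
previous one. -/
theorem IsFace.exists_flag {m : ℕ} : ∀ (k : ℕ) {G P : AddSubmonoid (Fin m → ℤ)} (_ : IsFace G P)
    (_ : P.FG) (_ : HasCodim G P k), ∃ F : ℕ → AddSubmonoid (Fin m → ℤ), F 0 = P ∧ F k = G ∧
      ∀ i < k, IsFace (F (i + 1)) (F i) ∧ HasCodim (F (i + 1)) (F i) 1
  | 0, G, P, h, _, hk => ⟨fun _ => P, rfl, (h.eq_of_rank_le (by unfold HasCodim at hk; omega)).symm,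
      by simp⟩
  | k + 1, G, P, h, hP, hk => by
    obtain ⟨F₁, hF₁, hle, hk₁⟩ := h.exists_codim_one hP
      (by rintro rfl; unfold HasCodim at hk; omega)
    obtain ⟨F, h0, hk', hF⟩ := IsFace.exists_flag k (h.of_le hle hF₁.le) (hF₁.fg hP)
      (by unfold HasCodim at *; omega)
    refine ⟨fun i => Nat.casesOn i P F, rfl, hk', fun i hi => ?_⟩
    cases i with
    | zero => exact ⟨by simpa [h0] using hF₁, by simpa [h0] using hk₁⟩
    | succ i => exact hF i (by omega)

/-- Real valued additive functions on a submonoid of `ℤ^m` extend to `ℤ^m`. -/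
theorem exists_extension {m : ℕ} {G : AddSubmonoid (Fin m → ℤ)} (w : G →+ ℝ) :
    ∃ W : (Fin m → ℤ) →+ ℝ, ∀ g : G, W g = w g := by
  have hw : ∀ z : gp G, ∃ r : ℝ, ∀ a b : G, (z : Fin m → ℤ) = a - b → r = w a - w b := by
    rintro ⟨z, hz⟩
    obtain ⟨a, ha, b, hb, rfl⟩ := mem_gp_iff.1 hz
    refine ⟨w ⟨a, ha⟩ - w ⟨b, hb⟩, fun a' b' h => ?_⟩
    have : (⟨a, ha⟩ : G) + b' = a' + ⟨b, hb⟩ := by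
      ext1
      have : a - b = a' - b' := h
      change a + b' = a' + b
      rw [sub_eq_sub_iff_add_eq_add] at this
      exact this
    have := congrArg w this
    rw [map_add, map_add] at this
    linarith
  choose r hr using hw
  let R : gp G →+ ℝ := AddMonoidHom.mk' r fun x y => by
    obtain ⟨a, ha, b, hb, hx⟩ := mem_gp_iff.1 x.2
    obtain ⟨a', ha', b', hb', hy⟩ := mem_gp_iff.1 y.2
    rw [hr x ⟨a, ha⟩ ⟨b, hb⟩ hx, hr y ⟨a', ha'⟩ ⟨b', hb'⟩ hy,
      hr (x + y) (⟨a, ha⟩ + ⟨a', ha'⟩) (⟨b, hb⟩ + ⟨b', hb'⟩), map_add, map_add]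
    · ring
    · change (x : Fin m → ℤ) + y = (a + a') - (b + b')
      rw [hx, hy]; abel
  -- The group `ℝ` is divisible, hence injective, so the homomorphism extends from the generated
  -- group to all of `ℤ^m`.
  obtain ⟨W, hW⟩ := (Module.Baer.of_divisible ℝ).extension_property_addMonoidHom
    (gp G).subtype Subtype.val_injective R
  refine ⟨W, fun g => ?_⟩
  have hg : (g : Fin m → ℤ) ∈ gp G := AddSubgroup.subset_closure g.2
  have := DFunLike.congr_fun hW (⟨g, hg⟩ : gp G)
  refine this.trans ?_
  change r _ = _
  rw [hr ⟨g, hg⟩ g 0 (by simp), map_zero, sub_zero]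


/-! ### The model spaces: points, supports and topology -/

section Model

variable {m : ℕ} {P F G : AddSubmonoid (Fin m → ℤ)}

theorem XP.ext {x y : XP P} (h : ∀ p, lam p x = lam p y) : x = y :=
  MonoidHom.ext (M := Multiplicative P) (N := ℝ≥0) fun p => h p.toAdd

/-- The point of `X_P` with given values. -/
def XP.mk (f : P → ℝ≥0) (h0 : f 0 = 1) (hadd : ∀ p q, f (p + q) = f p * f q) : XP P :=
  ({ toFun := fun p => f p.toAdd
     map_one' := h0
     map_mul' := fun p q => hadd p.toAdd q.toAdd } : Multiplicative P →* ℝ≥0)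

@[simp] theorem lam_mk (f : P → ℝ≥0) (h0 : f 0 = 1) (hadd : ∀ p q, f (p + q) = f p * f q)
    (p : P) : lam p (XP.mk f h0 hadd) = f p := rfl

theorem continuous_lam (p : P) : Continuous (lam p : XP P → ℝ≥0) :=
  (continuous_apply p).comp continuous_induced_dom

theorem XP.continuous_iff {T : Type*} [TopologicalSpace T] {f : T → XP P} :
    Continuous f ↔ ∀ p, Continuous fun t => lam p (f t) := by
  rw [continuous_induced_rng, continuous_pi_iff]
  rfl

theorem XP.tendsto_iff {T : Type*} {l : Filter T} {f : T → XP P} {x : XP P} :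
    Filter.Tendsto f l (𝓝 x) ↔ ∀ p, Filter.Tendsto (fun t => lam p (f t)) l (𝓝 (lam p x)) := by
  rw [nhds_induced, Filter.tendsto_comap_iff, tendsto_pi_nhds]
  rfl

theorem XP.coordinates_injective :
    Function.Injective (fun (x : XP P) (p : P) => lam p x) :=
  fun _ _ h => XP.ext fun p => congrFun h p

instance : T2Space (XP P) :=
  T2Space.of_injective_continuous XP.coordinates_injective continuous_induced_dom

instance : SecondCountableTopology (XP P) :=
  (Topology.IsInducing.mk rfl : Topology.IsInducing fun (x : XP P) (p : P) => lam p x).secondCountableTopology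

theorem mem_supp {x : XP P} {p : Fin m → ℤ} : p ∈ supp x ↔ ∃ h : p ∈ P, lam ⟨p, h⟩ x ≠ 0 :=
  Iff.rfl

theorem supp_le (x : XP P) : supp x ≤ P := fun _ h => h.1

theorem coe_mem_supp {x : XP P} {p : P} : (p : Fin m → ℤ) ∈ supp x ↔ lam p x ≠ 0 :=
  ⟨fun h => h.2, fun h => ⟨p.2, h⟩⟩

theorem supp_isFace (x : XP P) : IsFace (supp x) P := by
  refine ⟨supp_le x, fun p hp q hq hpq => ?_⟩
  have h1 : lam ((⟨p, hp⟩ : P) + ⟨q, hq⟩) x ≠ 0 := hpq.2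
  rw [lam_add] at h1
  exact ⟨⟨hp, left_ne_zero_of_mul h1⟩, ⟨hq, right_ne_zero_of_mul h1⟩⟩

theorem supp_le_iff {x : XP P} : supp x ≤ F ↔ ∀ p : P, (p : Fin m → ℤ) ∉ F → lam p x = 0 := by
  constructor
  · intro h p hp
    by_contra h0
    exact hp (h (coe_mem_supp.2 h0))
  · rintro h p ⟨hp, h0⟩
    by_contra hpF
    exact h0 (h ⟨p, hp⟩ hpF)

theorem isClosed_supp_le (F : AddSubmonoid (Fin m → ℤ)) : IsClosed {x : XP P | supp x ≤ F} := by
  have : {x : XP P | supp x ≤ F} = ⋂ (p : P) (_ : (p : Fin m → ℤ) ∉ F), {x | lam p x = 0} := by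
    ext x
    simp only [mem_ofPred_eq, mem_iInter, supp_le_iff]
  rw [this]
  exact isClosed_iInter fun p => isClosed_iInter fun _ =>
    isClosed_singleton.preimage (continuous_lam p)

/-- The support is a finitely generated face, so nonvanishing at finitely many elements, an open
condition, keeps all of it in the support. -/
theorem exists_nhd_supp_le (hP : P.FG) (x : XP P) :
    ∃ N, IsOpen N ∧ x ∈ N ∧ ∀ y ∈ N, supp x ≤ supp y := by
  obtain ⟨S, hS⟩ := (supp_isFace x).fg hP
  have hSx : ∀ s ∈ S, s ∈ supp x := fun s hs => hS ▸ AddSubmonoid.subset_closure hs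
  refine ⟨⋂ s ∈ S.attach, {y : XP P | lam ⟨s, supp_le x (hSx s s.2)⟩ y ≠ 0}, ?_, ?_, ?_⟩
  · exact isOpen_biInter_finset fun s _ => isOpen_ne.preimage (continuous_lam _)
  · simp only [mem_iInter]
    exact fun s _ => (hSx s s.2).2
  · intro y hy
    simp only [mem_iInter] at hy
    rw [← hS, AddSubmonoid.closure_le]
    intro s hs
    exact ⟨supp_le x (hSx s hs), hy ⟨s, hs⟩ (Finset.mem_attach _ _)⟩

/-! ### Extension by zero and restriction -/

open Classical in
theorem lam_inclFace (hF : IsFace F P) (y : XP F) (p : P) :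
    lam p (inclFace hF y) = if h : (p : Fin m → ℤ) ∈ F then lam ⟨p, h⟩ y else 0 := rfl

theorem lam_inclFace_of_mem (hF : IsFace F P) (y : XP F) {p : P} (h : (p : Fin m → ℤ) ∈ F) :
    lam p (inclFace hF y) = lam ⟨p, h⟩ y := by rw [lam_inclFace, dif_pos h]

theorem lam_inclFace_of_notMem (hF : IsFace F P) (y : XP F) {p : P} (h : (p : Fin m → ℤ) ∉ F) :
    lam p (inclFace hF y) = 0 := by rw [lam_inclFace, dif_neg h]

/-- Restriction of points of `X_P` to a submonoid. -/
def restr (h : F ≤ P) (x : XP P) : XP F :=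
  XP.mk (fun p => lam ⟨p, h p.2⟩ x) (lam_zero x) fun p q => lam_add ⟨p, h p.2⟩ ⟨q, h q.2⟩ x

@[simp] theorem lam_restr (h : F ≤ P) (x : XP P) (p : F) :
    lam p (restr h x) = lam ⟨p, h p.2⟩ x := rfl

theorem supp_inclFace (hF : IsFace F P) (y : XP F) : supp (inclFace hF y) = supp y := by
  ext p
  rw [mem_supp, mem_supp]
  constructor
  · rintro ⟨h, h0⟩
    by_cases hp : p ∈ F
    · exact ⟨hp, by rwa [lam_inclFace_of_mem hF y (p := ⟨p, h⟩) hp] at h0⟩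
    · exact absurd (lam_inclFace_of_notMem hF y (p := ⟨p, h⟩) hp) h0
  · rintro ⟨h, h0⟩
    exact ⟨hF.le h, by rwa [lam_inclFace_of_mem hF y (p := ⟨p, hF.le h⟩) h]⟩

theorem supp_inclFace_le (hF : IsFace F P) (y : XP F) : supp (inclFace hF y) ≤ F := by
  rw [supp_inclFace]
  exact supp_le y

@[simp] theorem restr_inclFace (hF : IsFace F P) (y : XP F) : restr hF.le (inclFace hF y) = y :=
  XP.ext fun p => by rw [lam_restr, lam_inclFace_of_mem hF y p.2]

theorem inclFace_restr (hF : IsFace F P) {x : XP P} (h : supp x ≤ F) :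
    inclFace hF (restr hF.le x) = x := by
  refine XP.ext fun p => ?_
  by_cases hp : (p : Fin m → ℤ) ∈ F
  · rw [lam_inclFace_of_mem hF _ hp, lam_restr]
  · rw [lam_inclFace_of_notMem hF _ hp, supp_le_iff.1 h p hp]

theorem inclFace_injective (hF : IsFace F P) : Function.Injective (inclFace hF) :=
  Function.LeftInverse.injective (restr_inclFace hF)

theorem continuous_inclFace (hF : IsFace F P) : Continuous (inclFace hF) := by
  refine XP.continuous_iff.2 fun p => ?_
  by_cases hp : (p : Fin m → ℤ) ∈ F
  · simp only [lam_inclFace_of_mem hF _ hp]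
    exact continuous_lam _
  · simp only [lam_inclFace_of_notMem hF _ hp]
    exact continuous_const

theorem continuous_restr (h : F ≤ P) : Continuous (restr h) :=
  XP.continuous_iff.2 fun p => continuous_lam (⟨p, h p.2⟩ : P)

theorem inclFace_inclFace (hF : IsFace F P) (hG : IsFace G F) (y : XP G) :
    inclFace hF (inclFace hG y) = inclFace (hG.trans hF) y := by
  refine XP.ext fun p => ?_
  by_cases hp : (p : Fin m → ℤ) ∈ G
  · rw [lam_inclFace_of_mem (hG.trans hF) _ hp, lam_inclFace_of_mem hF _ (hG.le hp)]
    exact lam_inclFace_of_mem hG y (p := ⟨p, hG.le hp⟩) hp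
  · rw [lam_inclFace_of_notMem (hG.trans hF) _ hp]
    by_cases hp' : (p : Fin m → ℤ) ∈ F
    · rw [lam_inclFace_of_mem hF _ hp']
      exact lam_inclFace_of_notMem hG y (p := ⟨p, hp'⟩) hp
    · rw [lam_inclFace_of_notMem hF _ hp']

theorem inclFace_refl (y : XP P) : inclFace (IsFace.refl P) y = y :=
  XP.ext fun p => lam_inclFace_of_mem _ _ p.2

/-! ### Strata near a point -/

/-- Let `W` extend `log u` from `supp u`, and let `f` support `supp u` as a face of `F`. The points
with values `exp (W p + s * f p)` on `F` and `0` elsewhere have support `F`; as `s → -∞` they tend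
to `u`, because `f` vanishes on `supp u` and is positive on the rest of `F`. -/
theorem exists_mem_supp_eq (hP : P.FG) (hF : IsFace F P) {u : XP P} (hu : supp u ≤ F)
    {O : Set (XP P)} (hO : IsOpen O) (huO : u ∈ O) : ∃ x ∈ O, supp x = F := by
  obtain ⟨f, hf0, hf⟩ := ((supp_isFace u).of_le hu hF.le).exists_supporting (hF.fg hP)
  let w : supp u →+ ℝ :=
    { toFun := fun p => Real.log (lam ⟨p, supp_le u p.2⟩ u)
      map_zero' := by
        rw [show (⟨((0 : supp u) : Fin m → ℤ), supp_le u (0 : supp u).2⟩ : P) = 0 from rfl,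
          lam_zero]
        simp
      map_add' := fun p q => by
        rw [← Real.log_mul (NNReal.coe_ne_zero.2 p.2.2) (NNReal.coe_ne_zero.2 q.2.2),
          ← NNReal.coe_mul, ← lam_add]
        rfl }
  obtain ⟨W, hW⟩ := exists_extension w
  let x : ℝ → XP F := fun s => XP.mk
    (fun p => (Real.exp (W p + s * (f p : ℚ))).toNNReal)
    (by simp) (fun p q => by
      rw [← Real.toNNReal_mul (Real.exp_pos _).le, ← Real.exp_add, AddSubmonoid.coe_add, map_add,
        map_add, Rat.cast_add]
      ring_nf)
  have hx : ∀ s, supp (inclFace hF (x s)) = F := fun s => by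
    rw [supp_inclFace]
    refine le_antisymm (supp_le _) fun p hp => ⟨hp, ?_⟩
    exact (Real.toNNReal_pos.2 (Real.exp_pos _)).ne'
  have ht : Filter.Tendsto (fun s => inclFace hF (x s)) Filter.atBot (𝓝 u) := by
    rw [XP.tendsto_iff]
    intro p
    by_cases hp : (p : Fin m → ℤ) ∈ F
    · simp only [lam_inclFace_of_mem hF _ hp]
      rw [← NNReal.tendsto_coe]
      have hc : ∀ s, ((lam ⟨p, hp⟩ (x s) : ℝ≥0) : ℝ) = Real.exp (W p + s * (f p : ℚ)) :=
        fun s => Real.coe_toNNReal _ (Real.exp_pos _).le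
      simp only [hc]
      by_cases hpu : (p : Fin m → ℤ) ∈ supp u
      · rw [(hf p hp).2 hpu]
        have h1 : W p = Real.log (lam p u) := hW ⟨p, hpu⟩
        simp only [Rat.cast_zero, mul_zero, add_zero, h1]
        rw [Real.exp_log (NNReal.coe_pos.2 (pos_iff_ne_zero.2 hpu.2))]
        exact tendsto_const_nhds
      · have h1 : lam p u = 0 := by
          by_contra h0
          exact hpu (coe_mem_supp.2 h0)
        have h2 : (0 : ℝ) < (f p : ℚ) := by
          have := lt_of_le_of_ne (hf0 p hp) fun h => hpu ((hf p hp).1 h.symm)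
          exact_mod_cast this
        rw [h1, NNReal.coe_zero]
        refine Real.tendsto_exp_atBot.comp ?_
        exact Filter.tendsto_atBot_add_const_left _ _ (Filter.tendsto_id.atBot_mul_const h2)
    · simp only [lam_inclFace_of_notMem hF _ hp]
      rw [supp_le_iff.1 hu p hp]
      exact tendsto_const_nhds
  obtain ⟨s, hs⟩ := (ht.eventually (hO.mem_nhds huO)).exists
  exact ⟨_, hs, hx s⟩

theorem rpow_mul_rpow_mem_uIcc {a b : ℝ≥0} (ha : a ≠ 0) (hb : b ≠ 0) {s : ℝ} (h0 : 0 ≤ s)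
    (h1 : s ≤ 1) : a ^ (1 - s) * b ^ s ∈ uIcc a b := by
  have key : ∀ c : ℝ≥0, c ≠ 0 → c ^ (1 - s) * c ^ s = c := fun c hc => by
    rw [← NNReal.rpow_add hc]
    simp
  have h2 : 0 ≤ 1 - s := by linarith
  rw [mem_uIcc]
  rcases le_total a b with h | h
  · refine Or.inl ⟨?_, ?_⟩
    · calc a = a ^ (1 - s) * a ^ s := (key a ha).symm
        _ ≤ _ := by gcongr
    · calc a ^ (1 - s) * b ^ s ≤ b ^ (1 - s) * b ^ s := by gcongr
        _ = b := key b hb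
  · refine Or.inr ⟨?_, ?_⟩
    · calc b = b ^ (1 - s) * b ^ s := (key b hb).symm
        _ ≤ _ := by gcongr
    · calc a ^ (1 - s) * b ^ s ≤ a ^ (1 - s) * a ^ s := by gcongr
        _ = a := key a ha

/-- Every point has arbitrarily small neighbourhoods which meet each stratum in a connected set. -/
theorem exists_box {u : XP P} {O : Set (XP P)} (hO : IsOpen O) (hu : u ∈ O) :
    ∃ B ⊆ O, IsOpen B ∧ u ∈ B ∧ ∀ F, IsPreconnected (B ∩ faceStratum P F) := by
  obtain ⟨O', hO', rfl⟩ := isOpen_induced_iff.1 hO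
  obtain ⟨T, W, hW, hTW⟩ := isOpen_pi_iff.1 hO' _ hu
  have hball : ∀ p : T, ∃ ε > 0, Metric.ball (lam p.1 u) ε ⊆ W p := fun p =>
    Metric.isOpen_iff.1 (hW p p.2).1 _ (hW p p.2).2
  choose ε hε hεW using hball
  refine ⟨⋂ p : T, {x | lam p.1 x ∈ Metric.ball (lam p.1 u) (ε p)}, ?_, ?_, ?_, ?_⟩
  · intro x hx
    rw [mem_iInter] at hx
    exact hTW fun p hp => hεW ⟨p, hp⟩ (hx ⟨p, hp⟩)
  · exact isOpen_iInter_of_finite fun p => Metric.isOpen_ball.preimage (continuous_lam _)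
  · exact mem_iInter.2 fun p => Metric.mem_ball_self (hε p)
  · intro F
    refine isPreconnected_of_forall_pair fun x hx y hy => ?_
    have hxF : supp x = F := hx.2
    have hyF : supp y = F := hy.2
    have hF : IsFace F P := hxF ▸ supp_isFace x
    have hx0 : ∀ p (hp : p ∈ F), lam ⟨p, hF.le hp⟩ x ≠ 0 := fun p hp => (hxF.ge hp).2
    have hy0 : ∀ p (hp : p ∈ F), lam ⟨p, hF.le hp⟩ y ≠ 0 := fun p hp => (hyF.ge hp).2
    -- Geometric interpolation is multiplicative in `p`, keeps the support equal to `F`, and stays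
    -- between the end values in each coordinate, so the path remains in the box.
    let γ : ℝ → XP F := fun s => XP.mk
      (fun p => lam ⟨p, hF.le p.2⟩ x ^ (1 - s) * lam ⟨p, hF.le p.2⟩ y ^ s)
      (by
        rw [show (⟨((0 : F) : Fin m → ℤ), hF.le (0 : F).2⟩ : P) = 0 from rfl, lam_zero, lam_zero]
        simp)
      (fun p q => by
        rw [show (⟨((p + q : F) : Fin m → ℤ), hF.le (p + q).2⟩ : P) =
          ⟨p, hF.le p.2⟩ + ⟨q, hF.le q.2⟩ from rfl, lam_add, lam_add, NNReal.mul_rpow,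
          NNReal.mul_rpow]
        ring)
    have hγ : Continuous γ := by
      refine XP.continuous_iff.2 fun p => ?_
      change Continuous fun s : ℝ => lam _ x ^ (1 - s) * lam _ y ^ s
      refine Continuous.mul ?_ ?_
      · exact continuous_iff_continuousAt.2 fun s =>
          Filter.Tendsto.nnrpow tendsto_const_nhds
            (Continuous.tendsto (by fun_prop) s) (Or.inl (hx0 p p.2))
      · exact continuous_iff_continuousAt.2 fun s =>
          Filter.Tendsto.nnrpow tendsto_const_nhds
            (Continuous.tendsto (by fun_prop) s) (Or.inl (hy0 p p.2))
    have hγs : ∀ s, supp (inclFace hF (γ s)) = F := fun s => by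
      rw [supp_inclFace]
      refine le_antisymm (supp_le _) fun p hp => ⟨hp, ?_⟩
      change lam _ x ^ (1 - s) * lam _ y ^ s ≠ 0
      exact mul_ne_zero (by simp [NNReal.rpow_eq_zero_iff, hx0 p hp])
        (by simp [NNReal.rpow_eq_zero_iff, hy0 p hp])
    have e0 : inclFace hF (γ 0) = x := by
      rw [← inclFace_restr hF hxF.le]
      congr 1
      exact XP.ext fun p => by simp [γ]
    have e1 : inclFace hF (γ 1) = y := by
      rw [← inclFace_restr hF hyF.le]
      congr 1
      exact XP.ext fun p => by simp [γ]
    refine ⟨(fun s => inclFace hF (γ s)) '' Icc 0 1, ?_, ⟨0, by simp, e0⟩, ⟨1, by simp, e1⟩,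
      isPreconnected_Icc.image _ ((continuous_inclFace hF).comp hγ).continuousOn⟩
    rintro _ ⟨s, hs, rfl⟩
    refine ⟨mem_iInter.2 fun p => ?_, hγs s⟩
    have hxb := mem_iInter.1 hx.1 p
    have hyb := mem_iInter.1 hy.1 p
    by_cases hp : (p.1 : Fin m → ℤ) ∈ F
    · have h1 : lam p.1 (inclFace hF (γ s)) ∈ uIcc (lam p.1 x) (lam p.1 y) := by
        rw [lam_inclFace_of_mem hF _ hp]
        exact rpow_mul_rpow_mem_uIcc (hx0 _ hp) (hy0 _ hp) hs.1 hs.2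
      rw [mem_ofPred_eq, Metric.mem_ball, NNReal.dist_eq, abs_lt] at hxb hyb ⊢
      rw [mem_uIcc, ← NNReal.coe_le_coe, ← NNReal.coe_le_coe, ← NNReal.coe_le_coe,
        ← NNReal.coe_le_coe] at h1
      constructor <;> rcases h1 with h1 | h1 <;> linarith [h1.1, h1.2, hxb.1, hxb.2, hyb.1, hyb.2]
    · have h1 := lam_inclFace_of_notMem hF (γ s) hp
      have h2 : lam p.1 x = 0 := supp_le_iff.1 hxF.le p.1 hp
      rw [mem_ofPred_eq, h1, ← h2]
      exact hxb

end Model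


/-! ### Smooth maps between model spaces -/

section ModelSmooth

variable {m l k : ℕ} {P F : AddSubmonoid (Fin m → ℤ)} {Q : AddSubmonoid (Fin l → ℤ)}
  {R : AddSubmonoid (Fin k → ℤ)}

theorem SmoothReal.mono {f : XP P → ℝ} {U V : Set (XP P)} (h : SmoothReal f V) (hUV : U ⊆ V) :
    SmoothReal f U := by
  obtain ⟨n, r, W, g, hW, hg, hf⟩ := h
  exact ⟨n, r, W, g, hW, hg, fun x hx => hf x (hUV hx)⟩

theorem SmoothReal.congr {f f' : XP P → ℝ} {U : Set (XP P)} (h : SmoothReal f U)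
    (hff : ∀ x ∈ U, f' x = f x) : SmoothReal f' U := by
  obtain ⟨n, r, W, g, hW, hg, hf⟩ := h
  exact ⟨n, r, W, g, hW, hg, fun x hx => ⟨(hf x hx).1, (hff x hx).trans (hf x hx).2⟩⟩

theorem SmoothReal.of_fintype {κ : Type} [Fintype κ] {f : XP P → ℝ} {U : Set (XP P)} (r : κ → P)
    {W : Set (κ → ℝ)} {g : (κ → ℝ) → ℝ} (hW : IsOpen W) (hg : ContDiffOn ℝ ∞ g W)
    (hf : ∀ x ∈ U, (fun i => (lam (r i) x : ℝ)) ∈ W ∧ f x = g fun i => (lam (r i) x : ℝ)) :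
    SmoothReal f U := by
  let e := Fintype.equivFin κ
  have hc : ContDiff ℝ ∞ fun (y : Fin (Fintype.card κ) → ℝ) (i : κ) => y (e i) := by fun_prop
  refine ⟨_, fun i => r (e.symm i), (fun y i => y (e i)) ⁻¹' W, fun y => g fun i => y (e i),
    hW.preimage hc.continuous, hg.comp hc.contDiffOn fun _ h => h, fun x hx => ?_⟩
  simpa using hf x hx

theorem smoothReal_lam (p : P) (U : Set (XP P)) : SmoothReal (fun x => (lam p x : ℝ)) U :=
  SmoothReal.of_fintype (κ := Unit) (fun _ => p) isOpen_univ
    (g := fun y => y ()) (by fun_prop) fun _ _ => ⟨mem_univ _, rfl⟩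

theorem smoothReal_const (c : ℝ) (U : Set (XP P)) : SmoothReal (fun _ => c) U :=
  SmoothReal.of_fintype (κ := Empty) Empty.elim isOpen_univ
    (g := fun _ => c) (by fun_prop) fun _ _ => ⟨mem_univ _, rfl⟩

/-- Smooth functions of finitely many smooth functions are smooth. -/
theorem SmoothReal.comp_contDiffOn {n : ℕ} {f : Fin n → XP P → ℝ} {U : Set (XP P)}
    (hf : ∀ i, SmoothReal (f i) U) {W : Set (Fin n → ℝ)} {g : (Fin n → ℝ) → ℝ} (hW : IsOpen W)
    (hg : ContDiffOn ℝ ∞ g W) (hfW : ∀ x ∈ U, (fun i => f i x) ∈ W) :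
    SmoothReal (fun x => g fun i => f i x) U := by
  choose N r V h hV hh hfh using hf
  let κ := Σ i : Fin n, Fin (N i)
  let O : Set (κ → ℝ) := {y | ∀ i, (fun j => y ⟨i, j⟩) ∈ V i}
  have hpr : ∀ i, ContDiff ℝ ∞ fun (y : κ → ℝ) (j : Fin (N i)) => y ⟨i, j⟩ := fun i => by fun_prop
  have hO : IsOpen O := by
    have : O = ⋂ i, (fun (y : κ → ℝ) (j : Fin (N i)) => y ⟨i, j⟩) ⁻¹' V i := by
      ext y; simp [O]
    rw [this]
    exact isOpen_iInter_of_finite fun i => (hV i).preimage (hpr i).continuous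
  let H : (κ → ℝ) → Fin n → ℝ := fun y i => h i fun j => y ⟨i, j⟩
  have hH : ContDiffOn ℝ ∞ H O := contDiffOn_pi.2 fun i =>
    (hh i).comp (hpr i).contDiffOn fun y hy => hy i
  refine SmoothReal.of_fintype (κ := κ) (fun i => r i.1 i.2) (W := O ∩ H ⁻¹' W)
    (g := fun y => g (H y)) (hH.continuousOn.isOpen_inter_preimage hO hW)
    (hg.comp (hH.mono inter_subset_left) fun y hy => hy.2) fun x hx => ?_
  have hx' : (fun i => f i x) = H fun i => (lam (r i.1 i.2) x : ℝ) :=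
    funext fun i => (hfh i x hx).2
  refine ⟨⟨fun i => (hfh i x hx).1, ?_⟩, ?_⟩
  · rw [mem_preimage, ← hx']; exact hfW x hx
  · rw [hx']

theorem SmoothReal.mul {f g : XP P → ℝ} {U : Set (XP P)} (hf : SmoothReal f U)
    (hg : SmoothReal g U) : SmoothReal (fun x => f x * g x) U := by
  have := SmoothReal.comp_contDiffOn (f := ![f, g]) (U := U)
    (by intro i; fin_cases i <;> assumption) (g := fun y => y 0 * y 1) isOpen_univ
    (by fun_prop) fun _ _ => mem_univ _
  exact this

theorem SmoothNonneg.smoothReal {f : XP P → ℝ≥0} {U : Set (XP P)} (hf : SmoothNonneg f U)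
    {u : XP P} (hu : u ∈ U) :
    ∃ N, IsOpen N ∧ u ∈ N ∧ SmoothReal (fun x => (f x : ℝ)) (U ∩ N) := by
  obtain ⟨N, hN, huN, ⟨p, h, hh, -, hfh⟩ | h0⟩ := hf u hu
  · exact ⟨N, hN, huN, ((smoothReal_lam p _).mul hh).congr hfh⟩
  · exact ⟨N, hN, huN, (smoothReal_const 0 _).congr fun x hx => by rw [h0 x hx, NNReal.coe_zero]⟩

theorem ModelSmoothOn.mono {f : XP P → XP Q} {U V : Set (XP P)} (h : ModelSmoothOn f V)
    (hUV : U ⊆ V) : ModelSmoothOn f U := by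
  refine ⟨h.1.mono hUV, fun q u hu => ?_⟩
  obtain ⟨N, hN, huN, ⟨p, k, hk, hk0, hf⟩ | h0⟩ := h.2 q u (hUV hu)
  · exact ⟨N, hN, huN, Or.inl ⟨p, k, hk.mono (inter_subset_inter_left _ hUV),
      fun x hx => hk0 x ⟨hUV hx.1, hx.2⟩, fun x hx => hf x ⟨hUV hx.1, hx.2⟩⟩⟩
  · exact ⟨N, hN, huN, Or.inr fun x hx => h0 x ⟨hUV hx.1, hx.2⟩⟩

theorem ModelSmoothOn.congr {f f' : XP P → XP Q} {U : Set (XP P)} (h : ModelSmoothOn f U)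
    (hff : ∀ x ∈ U, f' x = f x) : ModelSmoothOn f' U := by
  refine ⟨h.1.congr hff, fun q u hu => ?_⟩
  obtain ⟨N, hN, huN, ⟨p, k, hk, hk0, hf⟩ | h0⟩ := h.2 q u hu
  · exact ⟨N, hN, huN, Or.inl ⟨p, k, hk, hk0, fun x hx => by
      change (lam q (f' x) : ℝ) = _
      rw [hff x hx.1]; exact hf x hx⟩⟩
  · exact ⟨N, hN, huN, Or.inr fun x hx => by
      change lam q (f' x) = 0
      rw [hff x hx.1]; exact h0 x hx⟩

/-- Both ingredients, continuity and `SmoothNonneg`, are local. This matters because `SmoothReal`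
asks for a single formula on the whole set. -/
theorem ModelSmoothOn.of_locally {f : XP P → XP Q} {U : Set (XP P)}
    (h : ∀ u ∈ U, ∃ N, IsOpen N ∧ u ∈ N ∧ ModelSmoothOn f (U ∩ N)) : ModelSmoothOn f U := by
  constructor
  · intro u hu
    obtain ⟨N, hN, huN, hf⟩ := h u hu
    exact (hf.1 u ⟨hu, huN⟩).mono_of_mem_nhdsWithin
      (Filter.inter_mem self_mem_nhdsWithin (mem_nhdsWithin_of_mem_nhds (hN.mem_nhds huN)))
  · intro q u hu
    obtain ⟨N, hN, huN, hf⟩ := h u hu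
    obtain ⟨N', hN', huN', h'⟩ := hf.2 q u ⟨hu, huN⟩
    refine ⟨N ∩ N', hN.inter hN', ⟨huN, huN'⟩, ?_⟩
    rwa [inter_assoc] at h'

theorem modelSmoothOn_id (U : Set (XP P)) : ModelSmoothOn (fun x => x) U :=
  ⟨continuousOn_id, fun p _ _ => ⟨univ, isOpen_univ, mem_univ _, Or.inl ⟨p, fun _ => 1,
    smoothReal_const 1 _, fun _ _ => one_pos, fun _ _ => by rw [mul_one]⟩⟩⟩

theorem modelSmoothOn_inclFace (hF : IsFace F P) (U : Set (XP F)) :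
    ModelSmoothOn (inclFace hF) U := by
  refine ⟨(continuous_inclFace hF).continuousOn, fun p u _ =>
    ⟨univ, isOpen_univ, mem_univ _, ?_⟩⟩
  by_cases hp : (p : Fin m → ℤ) ∈ F
  · exact Or.inl ⟨⟨p, hp⟩, fun _ => 1, smoothReal_const 1 _, fun _ _ => one_pos, fun x _ => by
      change (lam p (inclFace hF x) : ℝ) = _
      rw [lam_inclFace_of_mem hF x hp, mul_one]⟩
  · exact Or.inr fun x _ => lam_inclFace_of_notMem hF x hp

theorem modelSmoothOn_restr (h : F ≤ P) (U : Set (XP P)) : ModelSmoothOn (restr h) U :=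
  ⟨(continuous_restr h).continuousOn, fun p _ _ => ⟨univ, isOpen_univ, mem_univ _,
    Or.inl ⟨⟨p, h p.2⟩, fun _ => 1, smoothReal_const 1 _, fun _ _ => one_pos,
      fun _ _ => (mul_one _).symm⟩⟩⟩

theorem ContinuousOn.exists_open_inter_subset {f : XP P → XP Q} {U : Set (XP P)}
    (hf : ContinuousOn f U) {u : XP P} (hu : u ∈ U) {N : Set (XP Q)} (hN : IsOpen N)
    (huN : f u ∈ N) : ∃ N', IsOpen N' ∧ u ∈ N' ∧ ∀ x ∈ U ∩ N', f x ∈ N := by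
  obtain ⟨O, hO, hOe⟩ := (continuousOn_iff'.1 hf) N hN
  refine ⟨O, hO, (hOe.le ⟨huN, hu⟩).1, fun x hx => (hOe.ge ⟨hx.2, hx.1⟩).1⟩

/-- The conclusion is only local, since each `λ_r ∘ f` has a formula as a smooth real function only
near a given point. Finitely many `r` occur, so the neighbourhoods can be intersected. -/
theorem SmoothReal.comp_model {f : XP P → XP Q} {U : Set (XP P)} (hf : ModelSmoothOn f U)
    {h : XP Q → ℝ} {V : Set (XP Q)} (hh : SmoothReal h V) (hUV : MapsTo f U V) {u : XP P}
    (hu : u ∈ U) : ∃ N, IsOpen N ∧ u ∈ N ∧ SmoothReal (fun x => h (f x)) (U ∩ N) := by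
  obtain ⟨n, r, W, g, hW, hg, hhg⟩ := hh
  have := fun i => (hf.2 (r i)).smoothReal hu
  choose N hN huN hs using this
  refine ⟨⋂ i, N i, isOpen_iInter_of_finite hN, mem_iInter.2 huN, ?_⟩
  refine (SmoothReal.comp_contDiffOn (fun i => (hs i).mono ?_) hW hg fun x hx => ?_).congr
    fun x hx => (hhg (f x) (hUV hx.1)).2
  · exact inter_subset_inter_right _ (iInter_subset _ i)
  · exact (hhg (f x) (hUV hx.1)).1

theorem ModelSmoothOn.comp {f : XP P → XP Q} {g : XP Q → XP R} {U : Set (XP P)} {V : Set (XP Q)}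
    (hg : ModelSmoothOn g V) (hf : ModelSmoothOn f U) (hUV : MapsTo f U V) :
    ModelSmoothOn (fun x => g (f x)) U := by
  refine ⟨hg.1.comp hf.1 hUV, fun r u hu => ?_⟩
  obtain ⟨N, hN, huN, h⟩ := hg.2 r (f u) (hUV hu)
  obtain ⟨N', hN', huN', hNN'⟩ := ContinuousOn.exists_open_inter_subset hf.1 hu hN huN
  have hmap : ∀ x ∈ U ∩ N', f x ∈ V ∩ N := fun x hx => ⟨hUV hx.1, hNN' x hx⟩
  rcases h with ⟨q, k, hk, hk0, hgk⟩ | h0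
  · obtain ⟨N₂, hN₂, huN₂, h₂⟩ := hf.2 q u hu
    rcases h₂ with ⟨p, k', hk', hk'0, hfk⟩ | h0
    · obtain ⟨N₃, hN₃, huN₃, hs⟩ :=
        SmoothReal.comp_model (hf.mono inter_subset_left) hk hmap ⟨hu, huN'⟩
      refine ⟨N' ∩ N₂ ∩ N₃, (hN'.inter hN₂).inter hN₃, ⟨⟨huN', huN₂⟩, huN₃⟩,
        Or.inl ⟨p, fun x => k' x * k (f x), ?_, ?_, ?_⟩⟩
      · exact (hk'.mono fun x hx => ⟨hx.1, hx.2.1.2⟩).mul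
          (hs.mono fun x hx => ⟨⟨hx.1, hx.2.1.1⟩, hx.2.2⟩)
      · exact fun x hx => mul_pos (hk'0 x ⟨hx.1, hx.2.1.2⟩) (hk0 _ (hmap x ⟨hx.1, hx.2.1.1⟩))
      · intro x hx
        rw [hgk _ (hmap x ⟨hx.1, hx.2.1.1⟩), hfk x ⟨hx.1, hx.2.1.2⟩, mul_assoc]
    · refine ⟨N' ∩ N₂, hN'.inter hN₂, ⟨huN', huN₂⟩, Or.inr fun x hx => ?_⟩
      have h1 := hgk _ (hmap x ⟨hx.1, hx.2.1⟩)
      rw [show lam q (f x) = 0 from h0 x ⟨hx.1, hx.2.2⟩, NNReal.coe_zero, zero_mul] at h1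
      exact NNReal.coe_eq_zero.1 h1
  · exact ⟨N', hN', huN', Or.inr fun x hx => h0 _ (hmap x hx)⟩

/-- Near a point, the support of the image under a smooth map is a monotone function of the
support. -/
theorem ModelSmoothOn.exists_supp_mono {f : XP P → XP Q} {U : Set (XP P)}
    (hf : ModelSmoothOn f U) (hQ : Q.FG) {u : XP P} (hu : u ∈ U) :
    ∃ N, IsOpen N ∧ u ∈ N ∧
      ∀ x ∈ U ∩ N, ∀ y ∈ U ∩ N, supp x ≤ supp y → supp (f x) ≤ supp (f y) := by
  obtain ⟨S, hS⟩ := hQ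
  -- Near `u` the function `λ_q ∘ f` is either zero or `λ_p` times a positive function. In the
  -- second case its vanishing at a point depends only on whether `p` lies in the support.
  have key : ∀ q : Q, ∃ N, IsOpen N ∧ u ∈ N ∧ ∀ x ∈ U ∩ N, ∀ y ∈ U ∩ N, supp x ≤ supp y →
      lam q (f x) ≠ 0 → lam q (f y) ≠ 0 := by
    intro q
    obtain ⟨N, hN, huN, ⟨p, h, -, h0, hfh⟩ | h0⟩ := hf.2 q u hu
    · refine ⟨N, hN, huN, fun x hx y hy hxy hqx => ?_⟩
      have h1 : lam p x ≠ 0 := fun hp => hqx (by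
        have := hfh x hx
        rw [hp, NNReal.coe_zero, zero_mul] at this
        exact NNReal.coe_eq_zero.1 this)
      have h2 : lam p y ≠ 0 := coe_mem_supp.1 (hxy (coe_mem_supp.2 h1))
      rw [← NNReal.coe_ne_zero, hfh y hy]
      exact mul_ne_zero (NNReal.coe_ne_zero.2 h2) (h0 y hy).ne'
    · exact ⟨N, hN, huN, fun x hx _ _ _ hqx => absurd (h0 x hx) hqx⟩
  choose N hN huN hNs using key
  have hSQ : ∀ s ∈ S, s ∈ Q := fun s hs => hS ▸ AddSubmonoid.subset_closure hs
  refine ⟨⋂ s ∈ S.attach, N ⟨s, hSQ s s.2⟩, isOpen_biInter_finset fun s _ => hN _, ?_, ?_⟩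
  · simp only [mem_iInter]
    exact fun s _ => huN _
  · intro x hx y hy hxy
    have hx' := mem_iInter₂.1 hx.2
    have hy' := mem_iInter₂.1 hy.2
    rw [(supp_isFace (f x)).eq_closure hS, AddSubmonoid.closure_le]
    rintro s ⟨hs, hsQ, hsx⟩
    have hm := Finset.mem_attach S ⟨s, hs⟩
    exact ⟨hsQ, hNs _ x ⟨hx.1, hx' _ hm⟩ y ⟨hy.1, hy' _ hm⟩ hxy hsx⟩

end ModelSmooth


/-! ### Charts -/

theorem Chart.φ_inv {X : Type u} {c : Chart X} {x : X} (hx : x ∈ c.image) : c.φ (c.inv x) = x :=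
  Function.invFunOn_eq hx

theorem Chart.inv_mem {X : Type u} {c : Chart X} {x : X} (hx : x ∈ c.image) : c.inv x ∈ c.U :=
  Function.invFunOn_mem hx

/-- The transition map from `c` to `d` is smooth. -/
def SmoothTransition {X : Type u} (c d : Chart X) : Prop :=
  ModelSmoothOn (fun x => d.inv (c.φ x)) (c.U ∩ c.φ ⁻¹' d.image)

theorem SmoothTransition.trans {X : Type u} {c d e : Chart X} (hcd : SmoothTransition c d) (hde : SmoothTransition d e) :
    ModelSmoothOn (fun x => e.inv (c.φ x)) (c.U ∩ c.φ ⁻¹' e.image ∩ (c.U ∩ c.φ ⁻¹' d.image)) := by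
  have h1 : MapsTo (fun x => d.inv (c.φ x))
      (c.U ∩ c.φ ⁻¹' e.image ∩ (c.U ∩ c.φ ⁻¹' d.image)) (d.U ∩ d.φ ⁻¹' e.image) := by
    rintro x ⟨⟨_, hxe⟩, _, hxd⟩
    exact ⟨d.inv_mem hxd, by rw [mem_preimage, d.φ_inv hxd]; exact hxe⟩
  refine (hde.comp (hcd.mono inter_subset_right) h1).congr fun x hx => ?_
  rw [d.φ_inv hx.2.2]

section Charts

variable {X : Type u} [TopologicalSpace X] {n : ℕ} {c d e : Chart X}

theorem IsGChart.injOn (h : IsGChart n c) : InjOn c.φ c.U :=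
  injOn_iff_injective.2 h.isOpenEmbedding.injective

theorem IsGChart.continuousOn (h : IsGChart n c) : ContinuousOn c.φ c.U :=
  continuousOn_iff_continuous_domRestrict.2 h.isOpenEmbedding.continuous

theorem IsGChart.isOpen_image_of_subset (h : IsGChart n c) {O : Set (XP c.P)} (hO : IsOpen O)
    (hOU : O ⊆ c.U) : IsOpen (c.φ '' O) := by
  have := h.isOpenEmbedding.isOpenMap _ (hO.preimage continuous_subtype_val)
  convert this using 1
  ext x
  constructor
  · rintro ⟨u, hu, rfl⟩
    exact ⟨⟨u, hOU hu⟩, hu, rfl⟩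
  · rintro ⟨u, hu, rfl⟩
    exact ⟨u, hu, rfl⟩

theorem IsGChart.isOpen_image (h : IsGChart n c) : IsOpen c.image :=
  h.isOpen_image_of_subset h.isOpen subset_rfl

theorem IsGChart.isOpen_inter_preimage (h : IsGChart n c) {V : Set X} (hV : IsOpen V) :
    IsOpen (c.U ∩ c.φ ⁻¹' V) :=
  h.continuousOn.isOpen_inter_preimage h.isOpen hV

theorem IsGChart.inv_φ (h : IsGChart n c) {u : XP c.P} (hu : u ∈ c.U) : c.inv (c.φ u) = u :=
  h.injOn.leftInvOn_invFunOn hu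

theorem IsGChart.continuousOn_inv (h : IsGChart n c) : ContinuousOn c.inv c.image := by
  refine (continuousOn_open_iff h.isOpen_image).2 fun O hO => ?_
  convert h.isOpen_image_of_subset (hO.inter h.isOpen) inter_subset_right using 1
  ext x
  constructor
  · rintro ⟨hx, hxO⟩
    exact ⟨c.inv x, ⟨hxO, c.inv_mem hx⟩, c.φ_inv hx⟩
  · rintro ⟨u, ⟨huO, hu⟩, rfl⟩
    exact ⟨⟨u, hu, rfl⟩, by rw [mem_preimage, h.inv_φ hu]; exact huO⟩

theorem IsGChart.of_isOpen_image (hP : WeaklyToric c.P) (hr : rank c.P = n) (hU : IsOpen c.U)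
    (hc : ContinuousOn c.φ c.U) (hi : InjOn c.φ c.U)
    (ho : ∀ O ⊆ c.U, IsOpen O → IsOpen (c.φ '' O)) : IsGChart n c := by
  refine ⟨hP, hr, hU, .of_continuous_injective_isOpenMap
    (continuousOn_iff_continuous_domRestrict.1 hc) (injOn_iff_injective.1 hi) fun O hO => ?_⟩
  have := ho (Subtype.val '' O) (by rintro _ ⟨u, -, rfl⟩; exact u.2)
    (hU.isOpenMap_subtype_val O hO)
  rwa [image_image] at this

/-- Near each point the transition factors through a chart of the atlas `A`. It follows that charts
compatible with `A` are compatible with each other. -/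
theorem smoothTransition_of_cover {A : Set (Chart X)} (hA : ∀ d ∈ A, IsGChart n d)
    (hcover : ∀ x, ∃ d ∈ A, x ∈ d.image) (hc : IsGChart n c)
    (hcA : ∀ d ∈ A, SmoothTransition c d) (hAe : ∀ d ∈ A, SmoothTransition d e) :
    SmoothTransition c e := by
  refine ModelSmoothOn.of_locally fun u hu => ?_
  obtain ⟨d, hd, hud⟩ := hcover (c.φ u)
  exact ⟨_, hc.isOpen_inter_preimage (hA d hd).isOpen_image, ⟨hu.1, hud⟩,
    SmoothTransition.trans (hcA d hd) (hAe d hd)⟩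

theorem subset_maximalAtlas {A : Set (Chart X)} (hA : ∀ d ∈ A, IsGChart n d)
    (hcompat : ∀ c ∈ A, ∀ d ∈ A, Compatible c d) : A ⊆ maximalAtlas n A :=
  fun c hc => ⟨hA c hc, hcompat c hc⟩

end Charts

/-- A g-atlas determines a manifold with g-corners. -/
theorem isGManifold_of_atlas {X : GSpace.{u}} {A : Set (Chart X)} (hX : T2Space X)
    (hX' : SecondCountableTopology X) (hA : ∀ d ∈ A, IsGChart X.dim d)
    (hcompat : ∀ c ∈ A, ∀ d ∈ A, SmoothTransition c d)
    (hcover : ∀ x : X, ∃ d ∈ A, x ∈ d.image) (hXA : X.atlas = maximalAtlas X.dim A) :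
    IsGManifold X where
  t2 := hX
  secondCountable := hX'
  isGChart c hc := by rw [hXA] at hc; exact hc.1
  compatible c hc d hd := by
    rw [hXA] at hc hd
    exact ⟨smoothTransition_of_cover hA hcover hc.1 (fun e he => (hc.2 e he).1)
      fun e he => (hd.2 e he).2, smoothTransition_of_cover hA hcover hd.1
      (fun e he => (hd.2 e he).1) fun e he => (hc.2 e he).2⟩
  cover x := by
    obtain ⟨d, hd, hx⟩ := hcover x
    exact ⟨d, hXA ▸ subset_maximalAtlas hA
      (fun c hc d hd => ⟨hcompat c hc d hd, hcompat d hd c hc⟩) hd, hx⟩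
  maximal c hc hcd := by
    rw [hXA] at hcd ⊢
    exact ⟨hc, fun d hd => hcd d (subset_maximalAtlas hA
      (fun c hc d hd => ⟨hcompat c hc d hd, hcompat d hd c hc⟩) hd)⟩

section Manifold

variable {X : GSpace.{u}} {Y : GSpace.{v}}

theorem IsGManifold.smoothTransition (hX : IsGManifold X) {c d : Chart X} (hc : c ∈ X.atlas)
    (hd : d ∈ X.atlas) : SmoothTransition c d := (hX.compatible c hc d hd).1

/-- Charts can be shrunk. -/
theorem IsGManifold.restrict_mem (hX : IsGManifold X) {c : Chart X} (hc : c ∈ X.atlas)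
    {V : Set (XP c.P)} (hV : IsOpen V) (hVU : V ⊆ c.U) {ψ : XP c.P → X}
    (hψ : ∀ v ∈ V, ψ v = c.φ v) : (⟨c.m, c.P, V, ψ⟩ : Chart X) ∈ X.atlas := by
  have hc' := hX.isGChart c hc
  have him : ∀ O ⊆ V, ψ '' O = c.φ '' O := fun O hO => image_congr fun v hv => hψ v (hO hv)
  have hi : InjOn ψ V := (hc'.injOn.mono hVU).congr fun v hv => (hψ v hv).symm
  have he : IsGChart X.dim (⟨c.m, c.P, V, ψ⟩ : Chart X) :=
    .of_isOpen_image hc'.weaklyToric hc'.rank_eq hV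
      ((hc'.continuousOn.mono hVU).congr hψ) hi
      fun O hO hO' => by
        change IsOpen (ψ '' O)
        rw [him O hO]
        exact hc'.isOpen_image_of_subset hO' (hO.trans hVU)
  refine hX.maximal _ he fun d hd => ⟨?_, ?_⟩
  · refine ((hX.smoothTransition hc hd).mono ?_).congr ?_
    · rintro v ⟨hv, hvd⟩
      exact ⟨hVU hv, by rwa [mem_preimage, ← hψ v hv]⟩
    · rintro v ⟨hv, hvd⟩
      exact congrArg d.inv (hψ v hv)
  · refine ((hX.smoothTransition hd hc).mono ?_).congr ?_
    · rintro w ⟨hw, v, hv, hvw⟩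
      exact ⟨hw, v, hVU hv, by rw [← hvw]; exact (hψ v hv).symm⟩
    · rintro w ⟨hw, v, hv, hvw⟩
      change Chart.inv ⟨c.m, c.P, V, ψ⟩ (d.φ w) = c.inv (d.φ w)
      rw [← show ψ v = d.φ w from hvw]
      refine (he.inv_φ hv).trans ?_
      rw [hψ v hv, hc'.inv_φ (hVU hv)]

/-- A map which is the identity in suitable charts is smooth. -/
theorem smoothOn_of_charts (hX : IsGManifold X) (hY : IsGManifold Y) {f : X → Y} {U : Set X}
    (h : ∀ x ∈ U, ∃ (m : ℕ) (P : AddSubmonoid (Fin m → ℤ)) (D D' : Set (XP P)) (φ : XP P → X)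
      (φ' : XP P → Y), (⟨m, P, D, φ⟩ : Chart X) ∈ X.atlas ∧ (⟨m, P, D', φ'⟩ : Chart Y) ∈ Y.atlas ∧
        (∃ u ∈ D, φ u = x) ∧ ∀ v ∈ D, v ∈ D' ∧ f (φ v) = φ' v) : SmoothOn f U := by
  constructor
  · intro x hx
    obtain ⟨m, P, D, D', φ, φ', hc, hd, ⟨u, hu, rfl⟩, hf⟩ := h x hx
    have hc' := hX.isGChart _ hc
    have hd' := hY.isGChart _ hd
    refine ContinuousAt.continuousWithinAt ?_
    have h1 : ContinuousOn (fun y => φ' (Chart.inv (⟨m, P, D, φ⟩ : Chart X) y))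
        (Chart.image (⟨m, P, D, φ⟩ : Chart X)) :=
      hd'.continuousOn.comp hc'.continuousOn_inv fun y hy => (hf _ (Chart.inv_mem hy)).1
    have h2 := h1.continuousAt (hc'.isOpen_image.mem_nhds ⟨u, hu, rfl⟩)
    refine h2.congr ?_
    filter_upwards [hc'.isOpen_image.mem_nhds ⟨u, hu, rfl⟩] with y hy
    rw [← (hf _ (Chart.inv_mem hy)).2]
    congr 1
    exact Chart.φ_inv hy
  · intro c' hc' d' hd'
    refine ModelSmoothOn.of_locally fun w hw => ?_
    obtain ⟨m, P, D, D', φ, φ', hc, hd, ⟨u, hu, hux⟩, hf⟩ := h (c'.φ w) hw.2.1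
    have gc := hX.isGChart _ hc
    have gd := hY.isGChart _ hd
    have gc' := hX.isGChart _ hc'
    refine ⟨_, gc'.isOpen_inter_preimage gc.isOpen_image, ⟨hw.1, u, hu, hux⟩, ?_⟩
    have h1 := hX.smoothTransition hc' hc
    have h2 := hY.smoothTransition hd hd'
    refine (h2.comp (h1.mono inter_subset_right) ?_).congr ?_
    · rintro z ⟨⟨hz, hzU, hzd⟩, -, hzc⟩
      have h3 := hf _ (Chart.inv_mem hzc)
      refine ⟨h3.1, ?_⟩
      have h4 : φ (Chart.inv (⟨m, P, D, φ⟩ : Chart X) (c'.φ z)) = c'.φ z := Chart.φ_inv hzc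
      rw [h4] at h3
      change φ' _ ∈ d'.image
      rw [← h3.2]
      exact hzd
    · rintro z ⟨⟨hz, hzU, hzd⟩, -, hzc⟩
      have h3 := hf _ (Chart.inv_mem hzc)
      have h4 : φ (Chart.inv (⟨m, P, D, φ⟩ : Chart X) (c'.φ z)) = c'.φ z := Chart.φ_inv hzc
      rw [h4] at h3
      change d'.inv (f (c'.φ z)) = d'.inv (φ' _)
      rw [h3.2]

/-! ### Invariance of the depth -/

/-- A flag from `c.P` down to `supp y` is realised by the supports of points close to `y`. The
transition map and its inverse are monotone on supports near `y` and `z`, so the image supports form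
a strictly decreasing chain of `a` steps ending at `supp z`. Each step costs at least one in rank.
-/
theorem codim_le_of_charts {Z : Type u} [TopologicalSpace Z] {n : ℕ} {c d : Chart Z}
    (hc : IsGChart n c) (hd : IsGChart n d) (hcd : Compatible c d) {y : XP c.P} {z : XP d.P}
    (hy : y ∈ c.U) (hz : z ∈ d.U) (hyz : c.φ y = d.φ z) {a b : ℕ} (ha : HasDepth y a)
    (hb : HasDepth z b) : a ≤ b := by
  obtain ⟨F, hF0, hFa, hF⟩ := (supp_isFace y).exists_flag a hc.weaklyToric.fg ha
  have hyd : y ∈ c.U ∩ c.φ ⁻¹' d.image := ⟨hy, by rw [mem_preimage, hyz]; exact ⟨z, hz, rfl⟩⟩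
  have hzd : z ∈ d.U ∩ d.φ ⁻¹' c.image := ⟨hz, by rw [mem_preimage, ← hyz]; exact ⟨y, hy, rfl⟩⟩
  obtain ⟨N₁, hN₁, hyN₁, h₁⟩ := hcd.1.exists_supp_mono hd.weaklyToric.fg hyd
  obtain ⟨N₂, hN₂, hzN₂, h₂⟩ := hcd.2.exists_supp_mono hc.weaklyToric.fg hzd
  have hfy : d.inv (c.φ y) = z := by rw [hyz, hd.inv_φ hz]
  have hgf : ∀ x ∈ c.U ∩ c.φ ⁻¹' d.image, c.inv (d.φ (d.inv (c.φ x))) = x := fun x hx => by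
    rw [d.φ_inv hx.2, hc.inv_φ hx.1]
  have hfm : ∀ x ∈ c.U ∩ c.φ ⁻¹' d.image, d.inv (c.φ x) ∈ d.U ∩ d.φ ⁻¹' c.image :=
    fun x hx => ⟨d.inv_mem hx.2, by rw [mem_preimage, d.φ_inv hx.2]; exact ⟨x, hx.1, rfl⟩⟩
  obtain ⟨N₃, hN₃, hyN₃, h₃⟩ := ContinuousOn.exists_open_inter_subset hcd.1.1 hyd hN₂
    (by rw [hfy]; exact hzN₂)
  have hO : IsOpen (c.U ∩ c.φ ⁻¹' d.image ∩ N₁ ∩ N₃) :=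
    ((hc.isOpen_inter_preimage hd.isOpen_image).inter hN₁).inter hN₃
  have hanti : ∀ j, ∀ i ≤ j, j ≤ a → IsFace (F j) (F i) := by
    intro j
    induction j with
    | zero => intro i hi _; rw [Nat.le_zero.1 hi]; exact IsFace.refl _
    | succ j ih =>
      intro i hi hj
      rcases hi.eq_or_lt with rfl | hi
      · exact IsFace.refl _
      · exact (hF j (by omega)).1.trans (ih i (by omega) (by omega))
  -- The last point of the chain is `y` itself, so that the chain of image supports ends exactly at
  -- `supp z`.
  have hex : ∀ i, ∃ x ∈ c.U ∩ c.φ ⁻¹' d.image ∩ N₁ ∩ N₃, (i ≤ a → supp x = F i) ∧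
      (i = a → x = y) := by
    intro i
    by_cases hi : i < a
    · obtain ⟨x, hx, hxF⟩ := exists_mem_supp_eq (u := y) hc.weaklyToric.fg
        (hF0 ▸ hanti i 0 (by omega) hi.le) (hFa ▸ (hanti a i hi.le le_rfl).le) hO
        ⟨⟨hyd, hyN₁⟩, hyN₃⟩
      exact ⟨x, hx, fun _ => hxF, by omega⟩
    · exact ⟨y, ⟨⟨hyd, hyN₁⟩, hyN₃⟩, fun hi' => by
        rw [show i = a by omega]; exact hFa.symm, fun _ => rfl⟩
  choose w hw hwF hwa using hex
  have hr : ∀ i ≤ a, rank (supp (d.inv (c.φ (w i)))) + i ≤ rank d.P := by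
    intro i
    induction i with
    | zero => intro _; exact rank_mono (supp_le _)
    | succ i ih =>
      intro hi
      have h4 := ih (by omega)
      have hle : supp (w (i + 1)) ≤ supp (w i) := by
        rw [hwF _ hi, hwF _ (by omega)]
        exact (hF i (by omega)).1.le
      have hle' := h₁ _ ⟨(hw (i + 1)).1.1, (hw (i + 1)).1.2⟩ _ ⟨(hw i).1.1, (hw i).1.2⟩ hle
      -- Strictness comes from the inverse transition: equal image supports would give `F i ≤ F (i +
      -- 1)`.
      have hne : supp (d.inv (c.φ (w (i + 1)))) ≠ supp (d.inv (c.φ (w i))) := by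
        intro heq
        have h5 := h₂ _ ⟨hfm _ (hw i).1.1, h₃ _ ⟨(hw i).1.1, (hw i).2⟩⟩ _
          ⟨hfm _ (hw (i + 1)).1.1, h₃ _ ⟨(hw (i + 1)).1.1, (hw (i + 1)).2⟩⟩ heq.ge
        rw [hgf _ (hw i).1.1, hgf _ (hw (i + 1)).1.1, hwF _ hi, hwF _ (by omega)] at h5
        have h6 := rank_mono h5
        have h7 := (hF i (by omega)).2
        unfold HasCodim at h7
        omega
      have h8 := ((supp_isFace _).of_le hle' (supp_le _)).rank_lt hne
      omega
  have h9 := hr a le_rfl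
  rw [hwa a rfl, hfy] at h9
  unfold HasDepth HasCodim at hb
  omega

theorem exists_hasDepth {m : ℕ} {P : AddSubmonoid (Fin m → ℤ)} (x : XP P) : ∃ k, HasDepth x k :=
  ⟨rank P - rank (supp x), Nat.add_sub_cancel' (rank_mono (supp_le x))⟩

theorem HasCodim.unique {m a b : ℕ} {F P : AddSubmonoid (Fin m → ℤ)} (h : HasCodim F P a)
    (h' : HasCodim F P b) : a = b := by unfold HasCodim at *; omega

theorem hasDepth_iff_of_charts {Z : Type u} [TopologicalSpace Z] {n : ℕ} {c d : Chart Z}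
    (hc : IsGChart n c) (hd : IsGChart n d) (hcd : Compatible c d) {y : XP c.P} {z : XP d.P}
    (hy : y ∈ c.U) (hz : z ∈ d.U) (hyz : c.φ y = d.φ z) (k : ℕ) :
    HasDepth y k ↔ HasDepth z k := by
  obtain ⟨a, ha⟩ := exists_hasDepth y
  obtain ⟨b, hb⟩ := exists_hasDepth z
  have h1 : a = b := le_antisymm (codim_le_of_charts hc hd hcd hy hz hyz ha hb)
    (codim_le_of_charts hd hc hcd.symm hz hy hyz.symm hb ha)
  subst h1
  exact ⟨fun h => HasCodim.unique ha h ▸ hb, fun h => HasCodim.unique hb h ▸ ha⟩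

theorem mem_depthStratum_iff (hX : IsGManifold X) {c : Chart X} (hc : c ∈ X.atlas)
    {y : XP c.P} (hy : y ∈ c.U) {k : ℕ} : c.φ y ∈ depthStratum X k ↔ HasDepth y k := by
  constructor
  · rintro ⟨d, hd, z, hz, hzy, hk⟩
    exact (hasDepth_iff_of_charts (hX.isGChart d hd) (hX.isGChart c hc)
      (hX.compatible d hd c hc) hz hy hzy k).1 hk
  · exact fun h => ⟨c, hc, y, hy, rfl, h⟩

end Manifold


/-! ### Local corner components in charts -/

section LocalCorners

variable {X : GSpace.{u}} {k : ℕ} {x : X}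

theorem isOpen_le_supp {m : ℕ} {P : AddSubmonoid (Fin m → ℤ)} (hP : P.FG)
    (F : AddSubmonoid (Fin m → ℤ)) : IsOpen {y : XP P | F ≤ supp y} := by
  refine isOpen_iff_forall_mem_open.2 fun y hy => ?_
  obtain ⟨N, hN, hyN, h⟩ := exists_nhd_supp_le hP y
  exact ⟨N, fun z hz => hy.trans (h z hz), hN, hyN⟩

/-- The part `φ(X^P_F ∩ U)` of the image of a chart. -/
def Chart.stratum {X : Type u} (c : Chart X) (F : AddSubmonoid (Fin c.m → ℤ)) : Set X :=
  c.φ '' (faceStratum c.P F ∩ c.U)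

/-- The local corner component `γ` at `x` is given by the set `S` near `x`. -/
def Represents (γ : LocalCorner X k x) (S : Set X) : Prop :=
  ∀ V, IsOpenNhd V x → x ∈ closure (γ.comp V ∩ S)

theorem LocalCorner.comp_subset (γ : LocalCorner X k x) {V : Set X} (hV : IsOpenNhd V x) :
    γ.comp V ⊆ V ∩ depthStratum X k := by
  obtain ⟨y, -, hy⟩ := γ.isComponent V hV
  rw [hy]
  exact connectedComponentIn_subset _ _

theorem LocalCorner.isPreconnected (γ : LocalCorner X k x) {V : Set X} (hV : IsOpenNhd V x) :
    IsPreconnected (γ.comp V) := by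
  obtain ⟨y, -, hy⟩ := γ.isComponent V hV
  rw [hy]
  exact isPreconnected_connectedComponentIn

theorem LocalCorner.nonempty_inter (γ : LocalCorner X k x) {V W : Set X} (hV : IsOpenNhd V x)
    (hW : IsOpenNhd W x) : (W ∩ γ.comp V).Nonempty :=
  mem_closure_iff.1 (γ.mem_closure V hV) W hW.1 hW.2

theorem LocalCorner.nonempty (γ : LocalCorner X k x) {V : Set X} (hV : IsOpenNhd V x) :
    (γ.comp V).Nonempty := (γ.nonempty_inter hV hV).mono inter_subset_right

theorem LocalCorner.comp_eq (γ : LocalCorner X k x) {V : Set X} (hV : IsOpenNhd V x) {z : X}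
    (hz : z ∈ γ.comp V) : γ.comp V = connectedComponentIn (V ∩ depthStratum X k) z := by
  obtain ⟨y, -, hy⟩ := γ.isComponent V hV
  rw [hy] at hz ⊢
  exact connectedComponentIn_eq hz

theorem LocalCorner.subset_comp (γ : LocalCorner X k x) {V T : Set X} (hV : IsOpenNhd V x)
    (hT : IsPreconnected T) (hTV : T ⊆ V ∩ depthStratum X k) (h : (T ∩ γ.comp V).Nonempty) :
    T ⊆ γ.comp V := by
  obtain ⟨z, hzT, hz⟩ := h
  rw [γ.comp_eq hV hz]
  exact hT.subset_connectedComponentIn hzT hTV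

/-- Connected components of the same set which share a point coincide. -/
theorem LocalCorner.ext_of_inter {γ γ' : LocalCorner X k x}
    (h : ∀ V, IsOpenNhd V x → (γ.comp V ∩ γ'.comp V).Nonempty) : γ = γ' := by
  refine LocalCorner.ext (funext fun V => ?_)
  by_cases hV : IsOpenNhd V x
  · obtain ⟨z, hz, hz'⟩ := h V hV
    rw [γ.comp_eq hV hz, γ'.comp_eq hV hz']
  · rw [γ.junk V hV, γ'.junk V hV]

theorem Represents.mono {γ : LocalCorner X k x} {S T : Set X} (h : Represents γ S)
    {W : Set X} (hW : IsOpenNhd W x) (hST : W ∩ S ⊆ T) : Represents γ T := by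
  intro V hV
  rw [mem_closure_iff]
  intro O hO hxO
  obtain ⟨z, hz, hzγ, hzS⟩ := mem_closure_iff.1 (h V hV) (O ∩ W) (hO.inter hW.1) ⟨hxO, hW.2⟩
  exact ⟨z, hz.1, hzγ, hST ⟨hz.2, hzS⟩⟩

variable {c : Chart X} {F G : AddSubmonoid (Fin c.m → ℤ)} {u : XP c.P}

theorem isOpenNhd_image (hX : IsGManifold X) (hc : c ∈ X.atlas) (hu : u ∈ c.U) :
    IsOpenNhd c.image (c.φ u) :=
  ⟨(hX.isGChart c hc).isOpen_image, u, hu, rfl⟩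

theorem mem_stratum_iff (hX : IsGManifold X) (hc : c ∈ X.atlas) (hu : u ∈ c.U) :
    c.φ u ∈ c.stratum F ↔ supp u = F := by
  constructor
  · rintro ⟨v, ⟨hv, hvU⟩, hvu⟩
    rw [← (hX.isGChart c hc).injOn hvU hu hvu]
    exact hv
  · exact fun h => ⟨u, ⟨h, hu⟩, rfl⟩

theorem stratum_subset_depthStratum (hX : IsGManifold X) (hc : c ∈ X.atlas)
    (hk : HasCodim F c.P k) : c.stratum F ⊆ depthStratum X k := by
  rintro _ ⟨v, ⟨hv, hvU⟩, rfl⟩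
  rw [mem_depthStratum_iff hX hc hvU, HasDepth, show supp v = F from hv]
  exact hk

/-- A connected subset of the depth `k` stratum in the image of a chart lies in one stratum
of that chart. -/
theorem subset_stratum (hX : IsGManifold X) (hc : c ∈ X.atlas) {T : Set X}
    (hT : IsPreconnected T) (hTc : T ⊆ c.image) (hTk : T ⊆ depthStratum X k)
    (h : (T ∩ c.stratum F).Nonempty) : T ⊆ c.stratum F := by
  have gc := hX.isGChart c hc
  have hd : ∀ y ∈ T, HasDepth (c.inv y) k := fun y hy => by
    rw [← mem_depthStratum_iff hX hc (c.inv_mem (hTc hy)), c.φ_inv (hTc hy)]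
    exact hTk hy
  have hT' := hT.image _ (gc.continuousOn_inv.mono hTc)
  obtain ⟨z, hzT, w, ⟨hwF, hwU⟩, rfl⟩ := h
  have hwF' : supp w = F := hwF
  have hw : c.inv (c.φ w) = w := gc.inv_φ hwU
  have hwd : HasDepth w k := hw ▸ hd _ hzT
  intro y hy
  by_contra hcon
  have hyF : supp (c.inv y) ≠ F := fun h => hcon
    ⟨c.inv y, ⟨h, c.inv_mem (hTc hy)⟩, c.φ_inv (hTc hy)⟩
  have heq : ∀ v : XP c.P, HasDepth v k → supp v ≤ F → supp v = F := fun v hv hle => by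
    subst hwF'
    exact (supp_isFace v).eq_of_codim (supp_isFace w) hle hv hwd
  -- Comparable faces of the same codimension agree, so on `T` the open conditions `F ≤ supp v` and
  -- `¬ supp v ≤ F` are complementary. Connectedness then excludes a second stratum.
  obtain ⟨v, ⟨y', hy', rfl⟩, hv1, hv2⟩ := hT' {v | F ≤ supp v} {v | ¬ supp v ≤ F}
    (isOpen_le_supp gc.weaklyToric.fg F) (isClosed_supp_le F).isOpen_compl
    (by
      rintro _ ⟨y', hy', rfl⟩
      by_cases h : supp (c.inv y') ≤ F
      · exact Or.inl (heq _ (hd y' hy') h).ge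
      · exact Or.inr h)
    ⟨w, ⟨_, hzT, hw⟩, hwF'.ge⟩
    ⟨c.inv y, ⟨y, hy, rfl⟩, fun h => hyF (heq _ (hd y hy) h)⟩
  refine hv2 (le_of_eq ?_)
  subst hwF'
  exact ((supp_isFace w).eq_of_codim (supp_isFace _) hv1 hwd (hd y' hy')).symm

theorem nonempty_inter_stratum (hX : IsGManifold X) (hc : c ∈ X.atlas) (hu : u ∈ c.U)
    (hF : IsFace F c.P) (huF : supp u ≤ F) {W : Set X} (hW : IsOpenNhd W (c.φ u)) :
    (W ∩ c.stratum F).Nonempty := by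
  have gc := hX.isGChart c hc
  obtain ⟨v, hv, hvF⟩ := exists_mem_supp_eq gc.weaklyToric.fg hF huF
    (gc.isOpen_inter_preimage hW.1) ⟨hu, hW.2⟩
  exact ⟨c.φ v, hv.2, v, ⟨hvF, hv.1⟩, rfl⟩

/-- Points near `c.φ u` in the strata of `F` have arbitrarily small neighbourhoods which meet
all strata in connected sets. -/
theorem exists_box_image (hX : IsGManifold X) (hc : c ∈ X.atlas) (hu : u ∈ c.U) {V : Set X}
    (hV : IsOpenNhd V (c.φ u)) : ∃ W, IsOpenNhd W (c.φ u) ∧ W ⊆ V ∧ W ⊆ c.image ∧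
      ∀ F, IsPreconnected (W ∩ c.stratum F) := by
  have gc := hX.isGChart c hc
  obtain ⟨B, hBO, hB, huB, hBF⟩ := exists_box (gc.isOpen_inter_preimage hV.1) ⟨hu, hV.2⟩
  have hBU : B ⊆ c.U := hBO.trans inter_subset_left
  refine ⟨c.φ '' B, ⟨gc.isOpen_image_of_subset hB hBU, u, huB, rfl⟩, ?_, image_mono hBU,
    fun F => ?_⟩
  · rintro _ ⟨v, hv, rfl⟩
    exact (hBO hv).2
  · have : c.φ '' B ∩ c.stratum F = c.φ '' (B ∩ faceStratum c.P F) := by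
      ext y
      constructor
      · rintro ⟨⟨v, hv, rfl⟩, h⟩
        exact ⟨v, ⟨hv, (mem_stratum_iff hX hc (hBU hv)).1 h⟩, rfl⟩
      · rintro ⟨v, ⟨hv, hvF⟩, rfl⟩
        exact ⟨⟨v, hv, rfl⟩, v, ⟨hvF, hBU hv⟩, rfl⟩
    rw [this]
    exact (hBF F).image _ (gc.continuousOn.mono (inter_subset_left.trans hBU))

/-! ### Uniqueness and local description of the component given by a face -/

section

variable {γ γ' : LocalCorner X k x}

theorem Represents.exists_mem (h : Represents γ (c.stratum F))
    {W : Set X} (hW : IsOpenNhd W x) : ∃ v ∈ c.U, c.φ v ∈ W ∧ supp v = F := by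
  obtain ⟨z, hzW, -, v, ⟨hvF, hv⟩, rfl⟩ := mem_closure_iff.1 (h W hW) W hW.1 hW.2
  exact ⟨v, hv, hzW, hvF⟩

theorem Represents.isFace (h : Represents γ (c.stratum F)) :
    IsFace F c.P := by
  obtain ⟨v, -, -, rfl⟩ := h.exists_mem ⟨isOpen_univ, mem_univ x⟩
  exact supp_isFace v

theorem Represents.codim (hX : IsGManifold X) (hc : c ∈ X.atlas)
    (h : Represents γ (c.stratum F)) : HasCodim F c.P k := by
  have hU : IsOpenNhd (univ : Set X) x := ⟨isOpen_univ, mem_univ x⟩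
  obtain ⟨z, -, hz, v, ⟨hvF, hv⟩, rfl⟩ := mem_closure_iff.1 (h _ hU) univ isOpen_univ (mem_univ _)
  have h1 := (mem_depthStratum_iff hX hc hv).1 (γ.comp_subset hU hz).2
  rwa [HasDepth, show supp v = F from hvF] at h1

/-- Points of the stratum of `F` accumulate at `c.φ u`, and points near `u` have support at least
`supp u`. -/
theorem Represents.supp_le (hX : IsGManifold X) (hc : c ∈ X.atlas) (hu : u ∈ c.U)
    (hux : c.φ u = x) (h : Represents γ (c.stratum F)) : supp u ≤ F := by
  subst hux
  have gc := hX.isGChart c hc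
  obtain ⟨N, hN, huN, hNs⟩ := exists_nhd_supp_le gc.weaklyToric.fg u
  obtain ⟨v, hv, ⟨w, hw, hwv⟩, rfl⟩ := h.exists_mem
    (W := c.φ '' (N ∩ c.U)) ⟨gc.isOpen_image_of_subset (hN.inter gc.isOpen) inter_subset_right,
      u, ⟨huN, hu⟩, rfl⟩
  rw [← gc.injOn hw.2 hv hwv]
  exact hNs w hw.1

theorem Represents.comp_subset (hX : IsGManifold X) (hc : c ∈ X.atlas)
    (h : Represents γ (c.stratum F)) {V : Set X} (hV : IsOpenNhd V x) (hVc : V ⊆ c.image) :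
    γ.comp V ⊆ c.stratum F := by
  refine subset_stratum hX hc (γ.isPreconnected hV) ?_ ?_ ?_ (k := k)
  · exact fun y hy => hVc (γ.comp_subset hV hy).1
  · exact fun y hy => (γ.comp_subset hV hy).2
  · obtain ⟨z, -, hz⟩ := mem_closure_iff.1 (h V hV) univ isOpen_univ (mem_univ _)
    exact ⟨z, hz⟩

/-- A small box meets the stratum of `F` in a connected set which also meets the chosen component,
so that set lies inside the component. Near `x` the component thus contains the whole stratum. -/
theorem Represents.exists_subset_comp (hX : IsGManifold X) (hc : c ∈ X.atlas) (hu : u ∈ c.U)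
    (hux : c.φ u = x) (h : Represents γ (c.stratum F)) {V : Set X} (hV : IsOpenNhd V x) :
    ∃ W, IsOpenNhd W x ∧ W ⊆ V ∧ W ⊆ c.image ∧ W ∩ c.stratum F ⊆ γ.comp V := by
  subst hux
  obtain ⟨W, hW, hWV, hWc, hWF⟩ := exists_box_image hX hc hu hV
  refine ⟨W, hW, hWV, hWc, γ.subset_comp hV (hWF F) ?_ ?_⟩
  · exact fun y hy => ⟨hWV hy.1, stratum_subset_depthStratum hX hc (h.codim hX hc) hy.2⟩
  · obtain ⟨z, hzW, hz, hzF⟩ := mem_closure_iff.1 (h V hV) W hW.1 hW.2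
    exact ⟨z, ⟨hzW, hzF⟩, hz⟩

theorem Represents.unique (hX : IsGManifold X) (hc : c ∈ X.atlas) (hu : u ∈ c.U)
    (hux : c.φ u = x) (h : Represents γ (c.stratum F)) (h' : Represents γ' (c.stratum F)) :
    γ = γ' := by
  refine LocalCorner.ext_of_inter fun V hV => ?_
  obtain ⟨W, hW, -, -, hWγ⟩ := h.exists_subset_comp hX hc hu hux hV
  obtain ⟨W', hW', -, -, hWγ'⟩ := h'.exists_subset_comp hX hc hu hux hV
  subst hux
  obtain ⟨z, hz, hzF⟩ := nonempty_inter_stratum hX hc hu (h.isFace) (h.supp_le hX hc hu rfl)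
    (W := W ∩ W') ⟨hW.1.inter hW'.1, hW.2, hW'.2⟩
  exact ⟨z, hWγ ⟨hz.1, hzF⟩, hWγ' ⟨hz.2, hzF⟩⟩

theorem Represents.face_unique (hX : IsGManifold X) (hc : c ∈ X.atlas) (hu : u ∈ c.U)
    (hux : c.φ u = x) (h : Represents γ (c.stratum F)) (h' : Represents γ (c.stratum G)) :
    F = G := by
  subst hux
  have hV := isOpenNhd_image hX hc hu
  obtain ⟨z, hz⟩ := γ.nonempty hV
  have h1 := h.comp_subset hX hc hV subset_rfl hz
  obtain ⟨v, ⟨hvF, hv⟩, rfl⟩ := h'.comp_subset hX hc hV subset_rfl hz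
  rw [mem_stratum_iff hX hc hv] at h1
  exact h1.symm.trans hvF

end

/-- The component chosen for the whole chart image is connected, hence lies in one stratum;
compatibility with that choice carries this over to every neighbourhood. -/
theorem LocalCorner.exists_face (hX : IsGManifold X) (hc : c ∈ X.atlas) (hu : u ∈ c.U)
    (hux : c.φ u = x) (γ : LocalCorner X k x) : ∃ F, Represents γ (c.stratum F) := by
  subst hux
  have hV := isOpenNhd_image hX hc hu
  obtain ⟨z, hz⟩ := γ.nonempty hV
  obtain ⟨v, hv, rfl⟩ := (γ.comp_subset hV hz).1
  have hsub : γ.comp c.image ⊆ c.stratum (supp v) :=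
    subset_stratum hX hc (γ.isPreconnected hV) (fun y hy => (γ.comp_subset hV hy).1)
      (fun y hy => (γ.comp_subset hV hy).2) ⟨_, hz, v, ⟨rfl, hv⟩, rfl⟩
  exact ⟨supp v, fun V hV' => closure_mono (inter_subset_inter_right _ hsub)
    (γ.compat V _ hV' hV)⟩

-- For each `V`, take the component containing the intersection of a small box with the stratum of
-- `F`. Any two of these choices contain the stratum near `c.φ u`, and the stratum accumulates
-- there, so they are compatible.
open Classical in
theorem exists_represents (hX : IsGManifold X) (hc : c ∈ X.atlas) (hu : u ∈ c.U)
    (hF : IsFace F c.P) (hk : HasCodim F c.P k) (huF : supp u ≤ F) :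
    ∃ γ : LocalCorner X k (c.φ u), Represents γ (c.stratum F) := by
  have key : ∀ V, ∃ C : Set X, (IsOpenNhd V (c.φ u) → ∃ W, IsOpenNhd W (c.φ u) ∧
      W ∩ c.stratum F ⊆ C ∧ ∃ z ∈ V ∩ depthStratum X k,
        C = connectedComponentIn (V ∩ depthStratum X k) z) ∧ (¬ IsOpenNhd V (c.φ u) → C = ∅) := by
    intro V
    by_cases hV : IsOpenNhd V (c.φ u)
    · obtain ⟨W, hW, hWV, hWc, hWF⟩ := exists_box_image hX hc hu hV
      obtain ⟨z, hz⟩ := nonempty_inter_stratum hX hc hu hF huF hW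
      have hsub : W ∩ c.stratum F ⊆ V ∩ depthStratum X k := fun y hy =>
        ⟨hWV hy.1, stratum_subset_depthStratum hX hc hk hy.2⟩
      exact ⟨_, fun _ => ⟨W, hW, (hWF F).subset_connectedComponentIn hz hsub, z, hsub hz, rfl⟩,
        fun h => absurd hV h⟩
    · exact ⟨∅, fun h => absurd h hV, fun _ => rfl⟩
  choose C hC hC' using key
  have hcl : ∀ V, IsOpenNhd V (c.φ u) → ∀ V', IsOpenNhd V' (c.φ u) →
      c.φ u ∈ closure (C V ∩ C V' ∩ c.stratum F) := by
    intro V hV V' hV'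
    obtain ⟨W, hW, hWC, -⟩ := hC V hV
    obtain ⟨W', hW', hWC', -⟩ := hC V' hV'
    rw [mem_closure_iff]
    intro O hO huO
    obtain ⟨z, hz, hzF⟩ := nonempty_inter_stratum hX hc hu hF huF (W := O ∩ (W ∩ W'))
      ⟨hO.inter (hW.1.inter hW'.1), huO, hW.2, hW'.2⟩
    exact ⟨z, hz.1, ⟨hWC ⟨hz.2.1, hzF⟩, hWC' ⟨hz.2.2, hzF⟩⟩, hzF⟩
  refine ⟨⟨C, fun V hV => ?_, fun V hV => ?_, fun V V' hV hV' => ?_, fun V hV => hC' V hV⟩,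
    fun V hV => ?_⟩
  · obtain ⟨_, _, _, z, hz, h⟩ := hC V hV
    exact ⟨z, hz, h⟩
  · exact closure_mono (fun y hy => hy.1.1) (hcl V hV V hV)
  · exact closure_mono (fun y hy => hy.1) (hcl V hV V' hV')
  · exact closure_mono (inter_subset_inter_left _ inter_subset_left) (hcl V hV V hV)

/-- If the same local corner component is given by strata of two charts, then these strata
agree near the point. -/
theorem Represents.exists_stratum_subset (hX : IsGManifold X) (hc : c ∈ X.atlas) (hu : u ∈ c.U)
    (hux : c.φ u = x) {d : Chart X} (hd : d ∈ X.atlas) (hxd : x ∈ d.image)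
    {G : AddSubmonoid (Fin d.m → ℤ)} {γ : LocalCorner X k x} (h : Represents γ (c.stratum F))
    (h' : Represents γ (d.stratum G)) :
    ∃ W, IsOpenNhd W x ∧ W ⊆ c.image ∩ d.image ∧ W ∩ c.stratum F ⊆ d.stratum G := by
  have hV : IsOpenNhd (c.image ∩ d.image) x :=
    ⟨(hX.isGChart c hc).isOpen_image.inter (hX.isGChart d hd).isOpen_image, ⟨u, hu, hux⟩, hxd⟩
  obtain ⟨W, hW, hWV, -, hWγ⟩ := h.exists_subset_comp hX hc hu hux hV
  exact ⟨W, hW, hWV, hWγ.trans (h'.comp_subset hX hd hV inter_subset_right)⟩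

/-- The corner of `X` at `c.φ u` given by the face `F`. -/
def IsCorner (c : Chart X) (F : AddSubmonoid (Fin c.m → ℤ)) (u : XP c.P) (p : CornerSet X k) :
    Prop := c.φ u = p.1 ∧ Represents p.2 (c.stratum F)

theorem exists_isCorner (hX : IsGManifold X) (hc : c ∈ X.atlas) (hu : u ∈ c.U)
    (hF : IsFace F c.P) (hk : HasCodim F c.P k) (huF : supp u ≤ F) :
    ∃ p : CornerSet X k, IsCorner c F u p := by
  obtain ⟨γ, hγ⟩ := exists_represents hX hc hu hF hk huF
  exact ⟨⟨_, γ⟩, rfl, hγ⟩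

theorem IsCorner.unique (hX : IsGManifold X) (hc : c ∈ X.atlas) (hu : u ∈ c.U)
    {p q : CornerSet X k} (hp : IsCorner c F u p) (hq : IsCorner c F u q) : p = q := by
  obtain ⟨x, γ⟩ := p
  obtain ⟨y, γ'⟩ := q
  obtain ⟨rfl, h⟩ := hp
  obtain ⟨h0, h'⟩ := hq
  change c.φ u = y at h0
  subst h0
  rw [show γ = γ' from Represents.unique hX hc hu rfl h h']

end LocalCorners


/-! ### The corners of a manifold with g-corners -/

section Corners

variable {X : GSpace.{u}} {k : ℕ}

/-- The chart on `C_k(X)` with the given parametrization `φ`, determined by a chart `c` of `X` and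
a face `F` of its monoid. -/
abbrev cornerChart (c : Chart X) {F : AddSubmonoid (Fin c.m → ℤ)} (hF : IsFace F c.P)
    (φ : XP F → CornerSet X k) : Chart (CornerSet X k) := ⟨c.m, F, inclFace hF ⁻¹' c.U, φ⟩

theorem cornerChart_mem {c : Chart X} (hc : c ∈ X.atlas) {F : AddSubmonoid (Fin c.m → ℤ)}
    {hF : IsFace F c.P} (hk : HasCodim F c.P k) {φ : XP F → CornerSet X k}
    (hφ : ∀ y, inclFace hF y ∈ c.U → IsCorner c F (inclFace hF y) (φ y)) :
    cornerChart c hF φ ∈ cornerCharts X k :=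
  ⟨c, hc, F, hF, hk, φ, rfl, fun y hy => ⟨(hφ y hy).1.symm, (hφ y hy).2⟩⟩

theorem exists_of_mem_cornerCharts {e : Chart (CornerSet X k)} (he : e ∈ cornerCharts X k) :
    ∃ c ∈ X.atlas, ∃ (F : AddSubmonoid (Fin c.m → ℤ)) (hF : IsFace F c.P)
      (φ : XP F → CornerSet X k), HasCodim F c.P k ∧ e = cornerChart c hF φ ∧
        ∀ y, inclFace hF y ∈ c.U → IsCorner c F (inclFace hF y) (φ y) := by
  obtain ⟨c, hc, F, hF, hk, φ, rfl, h⟩ := he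
  exact ⟨c, hc, F, hF, φ, hk, rfl, fun y hy => ⟨(h y hy).1.symm, (h y hy).2⟩⟩

-- The point `p₀` only supplies values of the parametrization off its domain, as `C_k(X)` may be
-- empty.
open Classical in
theorem exists_cornerChart (hX : IsGManifold X) {c : Chart X} (hc : c ∈ X.atlas)
    {F : AddSubmonoid (Fin c.m → ℤ)} (hF : IsFace F c.P) (hk : HasCodim F c.P k)
    (p₀ : CornerSet X k) : ∃ φ : XP F → CornerSet X k, cornerChart c hF φ ∈ cornerCharts X k ∧
      ∀ y, inclFace hF y ∈ c.U → IsCorner c F (inclFace hF y) (φ y) := by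
  have key : ∀ y, ∃ p : CornerSet X k, inclFace hF y ∈ c.U → IsCorner c F (inclFace hF y) p := by
    intro y
    by_cases hy : inclFace hF y ∈ c.U
    · obtain ⟨p, hp⟩ := exists_isCorner hX hc hy hF hk (supp_inclFace_le hF y)
      exact ⟨p, fun _ => hp⟩
    · exact ⟨p₀, fun h => absurd h hy⟩
  choose φ hφ using key
  exact ⟨φ, cornerChart_mem hc hk hφ, hφ⟩

theorem IsCorner.supp_le (hX : IsGManifold X) {c : Chart X} (hc : c ∈ X.atlas)
    {F : AddSubmonoid (Fin c.m → ℤ)} {u : XP c.P} (hu : u ∈ c.U) {p : CornerSet X k}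
    (h : IsCorner c F u p) : supp u ≤ F := h.2.supp_le hX hc hu h.1

theorem exists_isCorner_of_mem_image (hX : IsGManifold X) {c : Chart X} (hc : c ∈ X.atlas)
    {p : CornerSet X k} (hp : p.1 ∈ c.image) : ∃ u ∈ c.U, ∃ F, IsCorner c F u p := by
  obtain ⟨u, hu, hup⟩ := hp
  obtain ⟨F, hF⟩ := p.2.exists_face hX hc hu hup
  exact ⟨u, hu, F, hup, hF⟩

/-- The strata of `F` and `G` agree on a neighbourhood of the base point, so there both charts name
the same corners. -/
theorem IsCorner.exists_nhd (hX : IsGManifold X) {c d : Chart X} (hc : c ∈ X.atlas)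
    (hd : d ∈ X.atlas) {F : AddSubmonoid (Fin c.m → ℤ)} {G : AddSubmonoid (Fin d.m → ℤ)}
    {u : XP c.P} (hu : u ∈ c.U) {w : XP d.P} (hw : w ∈ d.U) {p : CornerSet X k}
    (h : IsCorner c F u p) (h' : IsCorner d G w p) :
    ∃ N, IsOpen N ∧ u ∈ N ∧ N ⊆ c.U ∩ c.φ ⁻¹' d.image ∧ ∀ v ∈ N, ∀ q : CornerSet X k,
      IsCorner c F v q → IsCorner d G (d.inv (c.φ v)) q := by
  obtain ⟨W, hW, hWcd, hWF⟩ := h.2.exists_stratum_subset hX hc hu h.1 hd ⟨w, hw, h'.1⟩ h'.2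
  have gc := hX.isGChart c hc
  refine ⟨_, gc.isOpen_inter_preimage hW.1, ⟨hu, ?_⟩, fun v hv => ⟨hv.1, (hWcd hv.2).2⟩, ?_⟩
  · rw [mem_preimage, h.1]
    exact hW.2
  · rintro v ⟨hv, hvW⟩ ⟨x, γ⟩ ⟨hx, hγ⟩
    change c.φ v = x at hx
    subst hx
    exact ⟨d.φ_inv (hWcd hvW).2, hγ.mono ⟨hW.1, hvW⟩ hWF⟩

section Transition

variable {c d : Chart X} (hX : IsGManifold X) (hc : c ∈ X.atlas) (hd : d ∈ X.atlas)
  {F : AddSubmonoid (Fin c.m → ℤ)} {G : AddSubmonoid (Fin d.m → ℤ)} {hF : IsFace F c.P}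
  {hG : IsFace G d.P} {φ : XP F → CornerSet X k} {ψ : XP G → CornerSet X k}
  (hφ : ∀ y, inclFace hF y ∈ c.U → IsCorner c F (inclFace hF y) (φ y))
  (hψ : ∀ y, inclFace hG y ∈ d.U → IsCorner d G (inclFace hG y) (ψ y))
include hX hc hφ

theorem cornerChart_injOn : InjOn φ (inclFace hF ⁻¹' c.U) := by
  intro y hy z hz hyz
  have h1 := (hφ y hy).1
  rw [hyz, ← (hφ z hz).1] at h1
  exact inclFace_injective hF ((hX.isGChart c hc).injOn hy hz h1)

theorem IsCorner.eq_cornerChart {y : XP F} (hy : inclFace hF y ∈ c.U) {p : CornerSet X k}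
    (hp : IsCorner c F (inclFace hF y) p) : φ y = p := (hφ y hy).unique hX hc hy hp

include hψ

theorem cornerChart_transition {z : XP G} (hz : inclFace hG z ∈ d.U) {y : XP F}
    (hy : inclFace hF y ∈ c.U) (hyz : φ y = ψ z) :
    restr hF.le (c.inv (d.φ (inclFace hG z))) = y := by
  have h1 := (hφ y hy).1
  rw [hyz, ← (hψ z hz).1] at h1
  rw [← h1, (hX.isGChart c hc).inv_φ hy, restr_inclFace]

include hd

/-- Near a point of the overlap, `φ⁻¹ ∘ ψ` is the continuous map which includes into `X_{d.P}`,
applies the transition of `X` and restricts to `F`. This makes corner charts open maps for the final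
topology on `C_k(X)`. -/
theorem isOpen_preimage_image_cornerChart {O : Set (XP F)} (hO : IsOpen O)
    (hOU : O ⊆ inclFace hF ⁻¹' c.U) :
    IsOpen (inclFace hG ⁻¹' d.U ∩ ψ ⁻¹' (φ '' O)) := by
  refine isOpen_iff_mem_nhds.2 ?_
  rintro z ⟨hz, y, hy, hyz⟩
  obtain ⟨N, hN, hzN, hNU, hNc⟩ := (hψ z hz).exists_nhd hX hd hc hz (hOU hy)
    (hyz ▸ hφ y (hOU hy))
  have h1 : ContinuousAt (fun z => restr hF.le (c.inv (d.φ (inclFace hG z)))) z := by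
    refine (continuous_restr _).continuousAt.comp ?_
    have h2 : ContinuousAt (fun w => c.inv (d.φ w)) (inclFace hG z) :=
      ((hX.smoothTransition hd hc).1.mono hNU).continuousAt (hN.mem_nhds hzN)
    exact ContinuousAt.comp (f := inclFace hG) h2 (continuous_inclFace hG).continuousAt
  have h3 := cornerChart_transition hX hc hφ hψ hz (hOU hy) hyz
  have h4 := h1.preimage_mem_nhds (by rw [h3]; exact hO.mem_nhds hy)
  filter_upwards [h4, (hN.preimage (continuous_inclFace hG)).mem_nhds hzN] with z' hz'O hz'N
  have hz'U := hNU hz'N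
  refine ⟨hz'U.1, _, hz'O, ?_⟩
  have h5 := hNc _ hz'N _ (hψ z' hz'U.1)
  have h6 := c.inv_mem hz'U.2
  have h7 := inclFace_restr hF (h5.supp_le hX hc h6)
  rw [← h7] at h5 h6
  exact IsCorner.eq_cornerChart hX hc hφ h6 h5

theorem cornerChart_smoothTransition :
    SmoothTransition (cornerChart d hG ψ) (cornerChart c hF φ) := by
  have h1 : ∀ z ∈ inclFace hG ⁻¹' d.U ∩ ψ ⁻¹' (cornerChart c hF φ).image,
      inclFace hG z ∈ d.U ∩ d.φ ⁻¹' c.image := by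
    rintro z ⟨hz, y, hy, hyz⟩
    refine ⟨hz, inclFace hF y, hy, ?_⟩
    rw [(hψ z hz).1, ← hyz]
    exact (hφ y hy).1
  refine (((modelSmoothOn_restr hF.le univ).comp (hX.smoothTransition hd hc) (mapsTo_univ _ _)).comp
    (modelSmoothOn_inclFace hG _) h1).congr ?_
  rintro z ⟨hz, y, hy, hyz⟩
  have h2 := cornerChart_transition hX hc hφ hψ hz hy hyz
  change (cornerChart c hF φ).inv (ψ z) = restr hF.le (c.inv (d.φ (inclFace hG z)))
  rw [h2]
  change φ y = ψ z at hyz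
  rw [← hyz]
  exact (cornerChart_injOn hX hc hφ).leftInvOn_invFunOn hy

end Transition

theorem isOpen_cornerSet_iff {S : Set (CornerSet X k)} :
    IsOpen S ↔ ∀ d ∈ cornerCharts X k, IsOpen ((fun u : d.U => d.φ u) ⁻¹' S) := by
  simp only [isOpen_iSup_iff, isOpen_coinduced]

theorem isGChart_of_mem_cornerCharts (hX : IsGManifold X) {e : Chart (CornerSet X k)}
    (he : e ∈ cornerCharts X k) : IsGChart (X.dim - k) e := by
  obtain ⟨c, hc, F, hF, φ, hk, rfl, hφ⟩ := exists_of_mem_cornerCharts he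
  have gc := hX.isGChart c hc
  refine .of_isOpen_image (gc.weaklyToric.face hF) ?_ (gc.isOpen.preimage (continuous_inclFace hF))
    ?_ (cornerChart_injOn hX hc hφ) ?_
  · change rank F = _
    have := gc.rank_eq
    unfold HasCodim at hk
    omega
  · rw [continuousOn_iff_continuous_domRestrict, continuous_iff_coinduced_le]
    exact le_iSup₂_of_le _ (cornerChart_mem hc hk hφ) le_rfl
  · intro O hOU hO
    rw [isOpen_cornerSet_iff]
    intro d hd
    obtain ⟨d, hd', G, hG, ψ, hk', rfl, hψ⟩ := exists_of_mem_cornerCharts hd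
    have := isOpen_preimage_image_cornerChart hX hc hd' hφ hψ hO hOU
    have h2 := this.preimage (continuous_subtype_val (p := fun z => z ∈ inclFace hG ⁻¹' d.U))
    convert h2 using 1
    ext z
    exact ⟨fun h => ⟨z.2, h⟩, fun h => h.2⟩

theorem smoothTransition_of_mem_cornerCharts (hX : IsGManifold X) {e e' : Chart (CornerSet X k)}
    (he : e ∈ cornerCharts X k) (he' : e' ∈ cornerCharts X k) : SmoothTransition e e' := by
  obtain ⟨c, hc, F, hF, φ, hk, rfl, hφ⟩ := exists_of_mem_cornerCharts he
  obtain ⟨d, hd, G, hG, ψ, hk', rfl, hψ⟩ := exists_of_mem_cornerCharts he'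
  exact cornerChart_smoothTransition hX hd hc hψ hφ

theorem exists_mem_cornerCharts (hX : IsGManifold X) (p : CornerSet X k) {c : Chart X}
    (hc : c ∈ X.atlas) (hp : p.1 ∈ c.image) :
    ∃ (F : AddSubmonoid (Fin c.m → ℤ)) (hF : IsFace F c.P) (φ : XP F → CornerSet X k) (y : XP F),
      HasCodim F c.P k ∧ cornerChart c hF φ ∈ cornerCharts X k ∧
      (∀ y, inclFace hF y ∈ c.U → IsCorner c F (inclFace hF y) (φ y)) ∧
      inclFace hF y ∈ c.U ∧ φ y = p := by
  obtain ⟨u, hu, F, h⟩ := exists_isCorner_of_mem_image hX hc hp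
  obtain ⟨φ, he, hφ⟩ := exists_cornerChart hX hc h.2.isFace (h.2.codim hX hc) p
  have h1 := inclFace_restr h.2.isFace (h.supp_le hX hc hu)
  refine ⟨F, h.2.isFace, φ, restr h.2.isFace.le u, h.2.codim hX hc, he, hφ, ?_, ?_⟩
  · rwa [h1]
  · exact IsCorner.eq_cornerChart hX hc hφ (by rwa [h1]) (by rwa [h1])

theorem continuous_cornerSet_fst (hX : IsGManifold X) :
    Continuous (fun p : CornerSet X k => p.1) := by
  refine continuous_iSup_dom.2 fun e => continuous_iSup_dom.2 fun he => continuous_coinduced_dom.2 ?_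
  obtain ⟨c, hc, F, hF, φ, hk, rfl, hφ⟩ := exists_of_mem_cornerCharts he
  have h1 : ContinuousOn (fun y => (φ y).1) (inclFace hF ⁻¹' c.U) := (((hX.isGChart c hc).continuousOn.comp (continuous_inclFace hF).continuousOn
    fun y hy => hy).congr fun y hy => (hφ y hy).1.symm)
  exact continuousOn_iff_continuous_domRestrict.1 h1

/-- Points over different points of `X` are separated in `X`. Two corners at the same `x` are given
by different faces of one chart, and the images of the corner charts of different faces are
disjoint, since a corner determines its face. -/
theorem t2Space_cornerSet (hX : IsGManifold X) : T2Space (CornerSet X k) := by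
  refine ⟨fun p q hpq => ?_⟩
  have := hX.t2
  by_cases h : p.1 = q.1
  · obtain ⟨x, γ⟩ := p
    obtain ⟨y, γ'⟩ := q
    change x = y at h
    subst h
    obtain ⟨c, hc, hx⟩ := hX.cover x
    obtain ⟨F, hF, φ, y, hk, he, hφ, hy, hyp⟩ := exists_mem_cornerCharts hX ⟨x, γ⟩ hc hx
    obtain ⟨G, hG, ψ, z, hk', he', hψ, hz, hzp⟩ := exists_mem_cornerCharts hX ⟨x, γ'⟩ hc hx
    refine ⟨_, _, (isGChart_of_mem_cornerCharts hX he).isOpen_image,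
      (isGChart_of_mem_cornerCharts hX he').isOpen_image, ⟨y, hy, hyp⟩, ⟨z, hz, hzp⟩, ?_⟩
    rw [Set.disjoint_left]
    rintro r ⟨y', hy', rfl⟩ ⟨z', hz', hyz⟩
    have h1 := hφ y' hy'
    have h2 := hψ z' hz'
    change ψ z' = φ y' at hyz
    rw [hyz] at h2
    have hFG := h1.2.face_unique hX hc hy' h1.1 h2.2
    subst hFG
    have h3 := hφ y hy
    have h4 := hψ z hz
    have h5 : inclFace hF y = inclFace hG z := by
      refine (hX.isGChart c hc).injOn hy hz ?_
      rw [h3.1, h4.1, hyp, hzp]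
    rw [h5, hyp] at h3
    rw [hzp] at h4
    exact hpq (h3.unique hX hc hz h4)
  · obtain ⟨U, V, hU, hV, hpU, hqV, hUV⟩ := t2_separation h
    exact ⟨_, _, hU.preimage (continuous_cornerSet_fst hX),
      hV.preimage (continuous_cornerSet_fst hX), hpU, hqV, hUV.preimage _⟩

theorem IsGChart.secondCountableTopology {Z : Type u} [TopologicalSpace Z] {n : ℕ} {c : Chart Z}
    (h : IsGChart n c) : SecondCountableTopology c.image := by
  have h1 : c.image = range fun u : c.U => c.φ u := by
    rw [Chart.image, image_eq_range]
  rw [h1]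
  exact h.isOpenEmbedding.isEmbedding.toHomeomorph.symm.secondCountableTopology

/-- Countably many charts cover `X`, and each of their monoids has finitely many faces, so countably
many corner charts suffice. -/
theorem secondCountableTopology_cornerSet (hX : IsGManifold X) :
    SecondCountableTopology (CornerSet X k) := by
  rcases isEmpty_or_nonempty (CornerSet X k) with h | ⟨⟨p₀⟩⟩
  · infer_instance
  have := hX.secondCountable
  obtain ⟨T, hT, hTU⟩ := TopologicalSpace.isOpen_iUnion_countable
    (fun c : X.atlas => c.1.image) fun c => (hX.isGChart c c.2).isOpen_image
  have := hT.to_subtype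
  let I := Σ c : T, {F : AddSubmonoid (Fin c.1.1.m → ℤ) // IsFace F c.1.1.P ∧ HasCodim F c.1.1.P k}
  have hI : ∀ c : T, Countable
      {F : AddSubmonoid (Fin c.1.1.m → ℤ) // IsFace F c.1.1.P ∧ HasCodim F c.1.1.P k} := fun c =>
    (((finite_faces (hX.isGChart c.1 c.1.2).weaklyToric.fg).subset
      fun F (hF : IsFace F c.1.1.P ∧ HasCodim F c.1.1.P k) => hF.1).countable).to_subtype
  have : Countable I := inferInstance
  have hex := fun i : I => exists_cornerChart hX i.1.1.2 i.2.2.1 i.2.2.2 p₀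
  choose φ he hφ using hex
  have hg := fun i : I => isGChart_of_mem_cornerCharts hX (he i)
  have := fun i : I => (hg i).secondCountableTopology
  refine TopologicalSpace.secondCountableTopology_of_countable_cover
    (U := fun i : I => (cornerChart i.1.1.1 i.2.2.1 (φ i)).image)
    (fun i => (hg i).isOpen_image) (eq_univ_of_forall fun p => ?_)
  have hp : p.1 ∈ ⋃ c ∈ T, c.1.image := by
    rw [hTU, mem_iUnion]
    obtain ⟨c, hc, hx⟩ := hX.cover p.1
    exact ⟨⟨c, hc⟩, hx⟩
  obtain ⟨c, hcT, hpc⟩ := mem_iUnion₂.1 hp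
  obtain ⟨F, hF, ψ, y, hk, -, hψ, hy, rfl⟩ := exists_mem_cornerCharts hX p c.2 hpc
  rw [mem_iUnion]
  exact ⟨⟨⟨c, hcT⟩, ⟨F, hF, hk⟩⟩, y, hy,
    IsCorner.eq_cornerChart hX c.2 (hφ ⟨⟨c, hcT⟩, ⟨F, hF, hk⟩⟩) hy (hψ y hy)⟩

theorem cornerCharts_subset_atlas (hX : IsGManifold X) :
    cornerCharts X k ⊆ (corners X k).atlas :=
  subset_maximalAtlas (fun _ he => isGChart_of_mem_cornerCharts hX he) fun _ he _ he' =>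
    ⟨smoothTransition_of_mem_cornerCharts hX he he', smoothTransition_of_mem_cornerCharts hX he' he⟩

theorem isGManifold_corners (hX : IsGManifold X) (k : ℕ) : IsGManifold (corners X k) := by
  refine isGManifold_of_atlas (X := corners X k) (A := cornerCharts X k) (t2Space_cornerSet hX)
    (secondCountableTopology_cornerSet hX) (fun _ he => isGChart_of_mem_cornerCharts hX he)
    (fun _ he _ he' => smoothTransition_of_mem_cornerCharts hX he he') (fun p => ?_) rfl
  obtain ⟨c, hc, hx⟩ := hX.cover (Sigma.fst (β := LocalCorner X k) p)
  obtain ⟨F, hF, φ, y, hk, he, hφ, hy, hyp⟩ := exists_mem_cornerCharts hX p hc hx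
  exact ⟨_, he, y, hy, hyp⟩

theorem isGManifold_bd (hX : IsGManifold X) : ∀ k, IsGManifold (bd X k)
  | 0 => hX
  | k + 1 => isGManifold_corners (isGManifold_bd hX k) 1

theorem dim_bd (X : GSpace.{u}) : ∀ k, (bd X k).dim = X.dim - k
  | 0 => rfl
  | k + 1 => by
    change (bd X k).dim - 1 = _
    rw [dim_bd X k]
    omega

end Corners


/-! ### Points of iterated boundaries and flags of faces -/

/-- `F 0, …, F k` are faces of `P`, each of codimension one in the previous one. -/
structure IsFlag {m : ℕ} (P : AddSubmonoid (Fin m → ℤ)) (F : ℕ → AddSubmonoid (Fin m → ℤ))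
    (k : ℕ) : Prop where
  zero : F 0 = P
  face : ∀ i < k, IsFace (F (i + 1)) (F i)
  codim : ∀ i < k, HasCodim (F (i + 1)) (F i) 1

namespace IsFlag

variable {m k : ℕ} {P : AddSubmonoid (Fin m → ℤ)} {F : ℕ → AddSubmonoid (Fin m → ℤ)}

theorem mono {l : ℕ} (h : IsFlag P F k) (hl : l ≤ k) : IsFlag P F l :=
  ⟨h.zero, fun i hi => h.face i (hi.trans_le hl), fun i hi => h.codim i (hi.trans_le hl)⟩

theorem isFace (h : IsFlag P F k) : IsFace (F k) P := by
  induction k with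
  | zero => rw [h.zero]; exact IsFace.refl P
  | succ k ih => exact (h.face k k.lt_succ_self).trans (ih (h.mono k.le_succ))

theorem hasCodim (h : IsFlag P F k) : HasCodim (F k) P k := by
  induction k with
  | zero => rw [h.zero]; exact Nat.add_zero _
  | succ k ih =>
    have h1 := h.codim k k.lt_succ_self
    have h2 := ih (h.mono k.le_succ)
    unfold HasCodim at *
    omega

end IsFlag

section Flags

variable {X : GSpace.{u}}

/-- The point `y` of `∂^k X` lies over `c.φ u`, and is given in the chart `c` by the flag
`F 0, …, F k`. -/
def IsFlagPt (c : Chart X) (F : ℕ → AddSubmonoid (Fin c.m → ℤ)) :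
    (k : ℕ) → XP c.P → bd X k → Prop
  | 0, u, y => c.φ u = y
  | k + 1, u, y => IsFlagPt c F k u (bdProj (bd X k) y) ∧
      Represents (X := bd X k) (k := 1) (Sigma.snd (β := LocalCorner (bd X k) 1) y)
        {z | ∃ v ∈ c.U, supp v = F (k + 1) ∧ IsFlagPt c F k v z}

/-- The chart on `∂^k X` with the given parametrization `φ`, determined by a chart of `X` and a
flag of faces. -/
abbrev flagChart (c : Chart X) {F : ℕ → AddSubmonoid (Fin c.m → ℤ)} {k : ℕ}
    (hF : IsFlag c.P F k) (φ : XP (F k) → bd X k) : Chart (bd X k) :=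
  ⟨c.m, F k, inclFace hF.isFace ⁻¹' c.U, φ⟩

theorem isFlagPt_congr {c : Chart X} {F F' : ℕ → AddSubmonoid (Fin c.m → ℤ)} {k : ℕ}
    {u : XP c.P} {y : bd X k} (hF : ∀ i ≤ k, F' i = F i) :
    IsFlagPt c F' k u y ↔ IsFlagPt c F k u y := by
  induction k generalizing u with
  | zero => exact Iff.rfl
  | succ k ih =>
    have ih' : ∀ {u : XP c.P} {y : bd X k}, IsFlagPt c F' k u y ↔ IsFlagPt c F k u y :=
      ih fun i hi => hF i (by omega)
    simp only [IsFlagPt, ih', hF (k + 1) le_rfl]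

theorem IsFlagPt.congr {c : Chart X} {F F' : ℕ → AddSubmonoid (Fin c.m → ℤ)} {k : ℕ}
    {u : XP c.P} {y : bd X k} (h : IsFlagPt c F k u y) (hF : ∀ i ≤ k, F' i = F i) :
    IsFlagPt c F' k u y := (isFlagPt_congr hF).2 h

theorem IsFlagPt.proj {c : Chart X} {F : ℕ → AddSubmonoid (Fin c.m → ℤ)} {k : ℕ}
    {u : XP c.P} {y : bd X k} (h : IsFlagPt c F k u y) : c.φ u = bdProjIter X k y := by
  induction k with
  | zero => exact h
  | succ k ih => exact ih h.1

variable {c : Chart X} {F F' : ℕ → AddSubmonoid (Fin c.m → ℤ)} {k : ℕ}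

/-- The chart of `∂^k X` parametrizes the points given by the flag. -/
def Parametrizes (c : Chart X) {F : ℕ → AddSubmonoid (Fin c.m → ℤ)} {k : ℕ}
    (hF : IsFlag c.P F k) (φ : XP (F k) → bd X k) : Prop :=
  flagChart c hF φ ∈ (bd X k).atlas ∧
    ∀ v, inclFace hF.isFace v ∈ c.U → IsFlagPt c F k (inclFace hF.isFace v) (φ v)

/-- Uniqueness of flag points is a hypothesis here, because the lemma is needed inside the induction
which establishes that uniqueness. -/
theorem Parametrizes.stratum_eq {hF : IsFlag c.P F k} {φ : XP (F k) → bd X k}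
    (hφ : Parametrizes c hF φ)
    (hu : ∀ u ∈ c.U, ∀ y y' : bd X k, IsFlagPt c F k u y → IsFlagPt c F k u y' → y = y')
    {G : AddSubmonoid (Fin c.m → ℤ)} (hG : G ≤ F k) :
    (flagChart c hF φ).stratum G = {z | ∃ v ∈ c.U, supp v = G ∧ IsFlagPt c F k v z} := by
  ext z
  constructor
  · rintro ⟨w, ⟨hw, hwU⟩, rfl⟩
    exact ⟨_, hwU, (supp_inclFace _ w).trans hw, hφ.2 w hwU⟩
  · rintro ⟨v, hv, hvG, hz⟩
    have h1 := inclFace_restr hF.isFace (hvG.le.trans hG)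
    refine ⟨restr hF.isFace.le v, ⟨?_, ?_⟩, ?_⟩
    · change supp _ = G
      rw [← supp_inclFace hF.isFace, h1, hvG]
    · change inclFace _ _ ∈ c.U
      rwa [h1]
    · refine hu v hv _ _ ?_ hz
      have := hφ.2 (restr hF.isFace.le v) (by rwa [h1])
      rwa [h1] at this

theorem exists_parametrizes_zero {m : ℕ} {P : AddSubmonoid (Fin m → ℤ)} {U : Set (XP P)}
    {φ : XP P → X} (hc : (⟨m, P, U, φ⟩ : Chart X) ∈ X.atlas) {F : ℕ → AddSubmonoid (Fin m → ℤ)}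
    (hF : IsFlag P F 0) : ∃ ψ, Parametrizes (⟨m, P, U, φ⟩ : Chart X) hF ψ := by
  obtain rfl := hF.zero
  refine ⟨φ, ?_, fun v _ => ?_⟩
  · have : inclFace hF.isFace ⁻¹' U = U := by
      ext v
      rw [mem_preimage, inclFace_refl]
    change (⟨m, F 0, inclFace hF.isFace ⁻¹' U, φ⟩ : Chart X) ∈ X.atlas
    rw [this]
    exact hc
  · change φ _ = φ _
    rw [inclFace_refl]

/-- The three statements need each other and are proved by one induction. The point of `∂^k X` in
the first is required since that space may be empty, in which case no parametrization exists. -/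
theorem flag_aux (hX : IsGManifold X) (hc : c ∈ X.atlas) (k : ℕ) (hF : IsFlag c.P F k) :
    (∀ _ : bd X k, ∃ φ, Parametrizes c hF φ) ∧
    (∀ u ∈ c.U, ∀ y : bd X k, IsFlagPt c F k u y → supp u ≤ F k) ∧
    (∀ u ∈ c.U, ∀ y y' : bd X k, IsFlagPt c F k u y → IsFlagPt c F k u y' → y = y') := by
  induction k with
  | zero =>
    refine ⟨fun _ => ?_, fun u _ y _ => ?_, fun u _ y y' h h' => h.symm.trans h'⟩
    · exact exists_parametrizes_zero hc hF
    · rw [hF.zero]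
      exact GCorners.supp_le u
  | succ k ih =>
    have hFk := hF.mono k.le_succ
    obtain ⟨ih1, ih2, ih3⟩ := ih hFk
    have hY := isGManifold_bd hX k
    have hface := hF.face k k.lt_succ_self
    have hcod := hF.codim k k.lt_succ_self
    -- Seen in the flag chart on `∂^k X`, a flag point of `∂^{k+1} X` is the boundary point given by
    -- the face `F (k + 1)` of `F k`. The results on corners then apply to the manifold `∂^k X`.
    have key : ∀ y : bd X (k + 1), ∃ φ : XP (F k) → bd X k, Parametrizes c hFk φ ∧
        ∀ u ∈ c.U, ∀ z : bd X (k + 1), supp u ≤ F k →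
          (IsFlagPt c F (k + 1) u z ↔ IsCorner (X := bd X k) (k := 1) (flagChart c hFk φ)
            (F (k + 1)) (restr hFk.isFace.le u) z) := by
      intro y
      obtain ⟨φ, hφ⟩ := ih1 (bdProj (bd X k) y)
      refine ⟨φ, hφ, fun u hu z hz => ?_⟩
      have h1 := inclFace_restr hFk.isFace hz
      have h2 := hφ.2 (restr hFk.isFace.le u) (by rwa [h1])
      rw [h1] at h2
      refine and_congr ⟨fun h => ih3 u hu _ _ h2 h, fun h => ?_⟩ ?_
      · have h' : φ (restr hFk.isFace.le u) = bdProj (bd X k) z := h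
        rwa [← h']
      · rw [hφ.stratum_eq ih3 hface.le]
    refine ⟨fun y => ?_, fun u hu y h => ?_, fun u hu y y' h h' => ?_⟩
    · obtain ⟨φ, hφ, hkey⟩ := key y
      obtain ⟨ψ, hψ, hψy⟩ := exists_cornerChart hY hφ.1 hface hcod y
      have hpre : inclFace hface ⁻¹' (inclFace hFk.isFace ⁻¹' c.U) =
          inclFace hF.isFace ⁻¹' c.U := by
        ext v
        rw [mem_preimage, mem_preimage, inclFace_inclFace]
        rfl
      refine ⟨ψ, ?_, fun v hv => ?_⟩
      · have h1 := cornerCharts_subset_atlas hY hψ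
        change (⟨c.m, F (k + 1), inclFace hface ⁻¹' (inclFace hFk.isFace ⁻¹' c.U), ψ⟩ :
          Chart (corners (bd X k) 1)) ∈ (corners (bd X k) 1).atlas at h1
        rw [hpre] at h1
        exact h1
      · have hle : supp (inclFace hF.isFace v) ≤ F k := (supp_inclFace_le _ v).trans hface.le
        refine (hkey _ hv _ hle).2 ?_
        have h2 : restr hFk.isFace.le (inclFace hF.isFace v) = inclFace hface v := by
          rw [← inclFace_inclFace hFk.isFace hface, restr_inclFace]
        rw [h2]
        refine hψy v ?_
        rw [← mem_preimage, hpre]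
        exact hv
    · obtain ⟨φ, hφ, hkey⟩ := key y
      have hle := ih2 u hu _ h.1
      have h1 := (hkey u hu y hle).1 h
      have h2 := inclFace_restr hFk.isFace hle
      have h3 := h1.supp_le hY hφ.1 (by change inclFace _ _ ∈ c.U; rwa [h2])
      rwa [← supp_inclFace hFk.isFace, h2] at h3
    · obtain ⟨φ, hφ, hkey⟩ := key y
      have hle := ih2 u hu _ h.1
      have h2 := inclFace_restr hFk.isFace hle
      exact ((hkey u hu y hle).1 h).unique hY hφ.1 (by change inclFace _ _ ∈ c.U; rwa [h2])
        ((hkey u hu y' hle).1 h')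

theorem exists_parametrizes (hX : IsGManifold X) (hc : c ∈ X.atlas) (hF : IsFlag c.P F k)
    (y : bd X k) : ∃ φ, Parametrizes c hF φ := (flag_aux hX hc k hF).1 y

theorem IsFlagPt.supp_le (hX : IsGManifold X) (hc : c ∈ X.atlas) (hF : IsFlag c.P F k)
    {u : XP c.P} (hu : u ∈ c.U) {y : bd X k} (h : IsFlagPt c F k u y) : supp u ≤ F k :=
  (flag_aux hX hc k hF).2.1 u hu y h

theorem IsFlagPt.unique (hX : IsGManifold X) (hc : c ∈ X.atlas) (hF : IsFlag c.P F k)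
    {u : XP c.P} (hu : u ∈ c.U) {y y' : bd X k} (h : IsFlagPt c F k u y)
    (h' : IsFlagPt c F k u y') : y = y' :=
  (flag_aux hX hc k hF).2.2 u hu y y' h h'

theorem Parametrizes.stratum_eq' (hX : IsGManifold X) (hc : c ∈ X.atlas) {hF : IsFlag c.P F k}
    {φ : XP (F k) → bd X k} (hφ : Parametrizes c hF φ) {G : AddSubmonoid (Fin c.m → ℤ)}
    (hG : G ≤ F k) :
    (flagChart c hF φ).stratum G = {z | ∃ v ∈ c.U, supp v = G ∧ IsFlagPt c F k v z} :=
  hφ.stratum_eq (flag_aux hX hc k hF).2.2 hG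

theorem Parametrizes.eq_of_isFlagPt (hX : IsGManifold X) (hc : c ∈ X.atlas)
    {hF : IsFlag c.P F k} {φ : XP (F k) → bd X k} (hφ : Parametrizes c hF φ) {u : XP c.P}
    (hu : u ∈ c.U) {y : bd X k} (hy : IsFlagPt c F k u y) :
    restr hF.isFace.le u ∈ (flagChart c hF φ).U ∧ φ (restr hF.isFace.le u) = y ∧
      inclFace hF.isFace (restr hF.isFace.le u) = u := by
  have h1 := inclFace_restr hF.isFace (hy.supp_le hX hc hF hu)
  have h2 : inclFace hF.isFace (restr hF.isFace.le u) ∈ c.U := by rwa [h1]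
  refine ⟨h2, ?_, h1⟩
  have h3 := hφ.2 _ h2
  rw [h1] at h3
  exact h3.unique hX hc hF hu hy

/-- In the chart given by a flag, points of `∂^{k+1} X` are corners given by the next face. -/
theorem isFlagPt_succ_iff (hX : IsGManifold X) (hc : c ∈ X.atlas) (hF : IsFlag c.P F k)
    {φ : XP (F k) → bd X k} (hφ : Parametrizes c hF φ) (hle : F (k + 1) ≤ F k) {u : XP c.P}
    (hu : u ∈ c.U) (huF : supp u ≤ F k) {y : bd X (k + 1)} :
    IsFlagPt c F (k + 1) u y ↔ IsCorner (X := bd X k) (k := 1) (flagChart c hF φ)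
      (F (k + 1)) (restr hF.isFace.le u) y := by
  have h1 := inclFace_restr hF.isFace huF
  have h2 := hφ.2 (restr hF.isFace.le u) (by rwa [h1])
  rw [h1] at h2
  refine and_congr ⟨fun h => h2.unique hX hc hF hu h, fun h => ?_⟩ ?_
  · have h' : φ (restr hF.isFace.le u) = bdProj (bd X k) y := h
    rwa [← h']
  · rw [hφ.stratum_eq' hX hc hle]

theorem exists_isFlagPt (hX : IsGManifold X) (hc : c ∈ X.atlas) (hF : IsFlag c.P F k)
    {u : XP c.P} (hu : u ∈ c.U) (huF : supp u ≤ F k) : ∃ y : bd X k, IsFlagPt c F k u y := by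
  induction k with
  | zero => exact ⟨c.φ u, rfl⟩
  | succ k ih =>
    have hFk := hF.mono k.le_succ
    have hface := hF.face k k.lt_succ_self
    have hle := huF.trans hface.le
    obtain ⟨y, hy⟩ := ih hFk hle
    obtain ⟨φ, hφ⟩ := exists_parametrizes hX hc hFk y
    have h2 := inclFace_restr hFk.isFace hle
    obtain ⟨p, hp⟩ := exists_isCorner (X := bd X k) (k := 1)
      (isGManifold_bd hX k) hφ.1 (u := restr hFk.isFace.le u)
      (by change inclFace _ _ ∈ c.U; rwa [h2]) hface (hF.codim k k.lt_succ_self)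
      (by rwa [← supp_inclFace hFk.isFace, h2])
    exact ⟨p, (isFlagPt_succ_iff hX hc hFk hφ hface.le hu hle).2 hp⟩

/-- Inductively, the last local boundary component of `y` is given by a facet of `F k` in the flag
chart, and this facet is appended to the flag. -/
theorem exists_flag_of_proj_eq (hX : IsGManifold X) (hc : c ∈ X.atlas) {u : XP c.P}
    (hu : u ∈ c.U) (y : bd X k) (hy : c.φ u = bdProjIter X k y) :
    ∃ F : ℕ → AddSubmonoid (Fin c.m → ℤ), IsFlag c.P F k ∧ IsFlagPt c F k u y := by
  induction k with
  | zero => exact ⟨fun _ => c.P, ⟨rfl, by simp, by simp⟩, hy⟩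
  | succ k ih =>
    obtain ⟨F, hF, hFy⟩ := ih (bdProj (bd X k) y) hy
    have hY := isGManifold_bd hX k
    obtain ⟨φ, hφ⟩ := exists_parametrizes hX hc hF (bdProj (bd X k) y)
    obtain ⟨h1, h2, h3⟩ := hφ.eq_of_isFlagPt hX hc hu hFy
    obtain ⟨G, hG⟩ := LocalCorner.exists_face hY hφ.1 h1 h2
      (Sigma.snd (β := LocalCorner (bd X k) 1) y)
    have hGF : IsFace G (F k) := hG.isFace
    have hGk : HasCodim G (F k) 1 := hG.codim hY hφ.1
    have hlt : ∀ i ≤ k, Function.update F (k + 1) G i = F i := fun i hi =>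
      Function.update_of_ne (by omega) _ _
    refine ⟨Function.update F (k + 1) G, ?_, ?_⟩
    · refine ⟨(hlt 0 k.zero_le).trans hF.zero, fun i hi => ?_, fun i hi => ?_⟩
      · rcases (Nat.lt_succ_iff.1 hi).eq_or_lt with rfl | hi
        · rw [Function.update_self, hlt i le_rfl]; exact hGF
        · rw [hlt i hi.le, hlt (i + 1) hi]; exact hF.face i hi
      · rcases (Nat.lt_succ_iff.1 hi).eq_or_lt with rfl | hi
        · rw [Function.update_self, hlt i le_rfl]; exact hGk
        · rw [hlt i hi.le, hlt (i + 1) hi]; exact hF.codim i hi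
    · refine ⟨hFy.congr hlt, ?_⟩
      rw [hφ.stratum_eq' hX hc hGF.le] at hG
      refine Represents.mono (X := bd X k) hG (W := univ) ⟨isOpen_univ, mem_univ _⟩ ?_
      rintro z ⟨-, v, hv, hvG, hz⟩
      exact ⟨v, hv, by rw [Function.update_self, hvG], hz.congr hlt⟩

theorem IsFlagPt.flag_unique (hX : IsGManifold X) (hc : c ∈ X.atlas) (hF : IsFlag c.P F k)
    (hF' : IsFlag c.P F' k) {u : XP c.P} (hu : u ∈ c.U) {y : bd X k}
    (h : IsFlagPt c F k u y) (h' : IsFlagPt c F' k u y) : ∀ i ≤ k, F i = F' i := by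
  induction k with
  | zero =>
    intro i hi
    rw [Nat.le_zero.1 hi, hF.zero, hF'.zero]
  | succ k ih =>
    have hFk := hF.mono k.le_succ
    have hY := isGManifold_bd hX k
    have ih' := ih hFk (hF'.mono k.le_succ) h.1 h'.1
    intro i hi
    rcases hi.eq_or_lt with rfl | hi
    · obtain ⟨φ, hφ⟩ := exists_parametrizes hX hc hFk (bdProj (bd X k) y)
      obtain ⟨h1, h2, h3⟩ := hφ.eq_of_isFlagPt hX hc hu h.1
      have h4 := h.2
      have h5 := h'.2
      rw [← hφ.stratum_eq' hX hc (hF.face k k.lt_succ_self).le] at h4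
      have h6 : {z | ∃ v ∈ c.U, supp v = F' (k + 1) ∧ IsFlagPt c F' k v z} =
          {z | ∃ v ∈ c.U, supp v = F' (k + 1) ∧ IsFlagPt c F k v z} := by
        ext z
        exact exists_congr fun v => and_congr_right fun _ => and_congr_right fun _ =>
          ⟨fun h => h.congr ih', fun h => h.congr fun i hi => (ih' i hi).symm⟩
      rw [h6, ← hφ.stratum_eq' hX hc
        ((hF'.face k k.lt_succ_self).le.trans (ih' k le_rfl).ge)] at h5
      exact Represents.face_unique (X := bd X k) hY hφ.1 h1 h2 h4 h5
    · exact ih' i (by omega)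

end Flags


/-! ### Incidence of local corner components in charts -/

section Incidence

variable {X : GSpace.{u}} {k : ℕ} {x : X} {c : Chart X} {F G : AddSubmonoid (Fin c.m → ℤ)}
  {u : XP c.P}

/-- The condition `supp w ≤ F` is closed and holds on the stratum containing the component. -/
theorem Represents.supp_le_of_mem_closure (hX : IsGManifold X) (hc : c ∈ X.atlas)
    {γ : LocalCorner X k x} (h : Represents γ (c.stratum F)) {V : Set X} (hV : IsOpenNhd V x)
    (hVc : V ⊆ c.image) {w : XP c.P} (hw : w ∈ c.U) (hwγ : c.φ w ∈ closure (γ.comp V)) :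
    supp w ≤ F := by
  by_contra hcon
  have gc := hX.isGChart c hc
  have hO : IsOpen (c.φ '' ({v | ¬ supp v ≤ F} ∩ c.U)) := gc.isOpen_image_of_subset
    ((isClosed_supp_le F).isOpen_compl.inter gc.isOpen) inter_subset_right
  obtain ⟨_, ⟨v, ⟨hvF, hv⟩, rfl⟩, hvγ⟩ := mem_closure_iff.1 hwγ _ hO ⟨w, ⟨hcon, hw⟩, rfl⟩
  exact hvF ((mem_stratum_iff hX hc hv).1 (h.comp_subset hX hc hV hVc hvγ)).le

theorem Represents.exists_mem_closure (hX : IsGManifold X) (hc : c ∈ X.atlas) (hu : u ∈ c.U)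
    (hux : c.φ u = x) {γ : LocalCorner X k x} (h : Represents γ (c.stratum F)) {V : Set X}
    (hV : IsOpenNhd V x) : ∃ W, IsOpenNhd W x ∧ W ⊆ V ∧ W ⊆ c.image ∧
      ∀ w ∈ c.U, c.φ w ∈ W → supp w ≤ F → c.φ w ∈ closure (γ.comp V) := by
  obtain ⟨W, hW, hWV, hWc, hWγ⟩ := h.exists_subset_comp hX hc hu hux hV
  refine ⟨W, hW, hWV, hWc, fun w hw hwW hwF => mem_closure_iff.2 fun O hO hwO => ?_⟩
  obtain ⟨z, hz, hzF⟩ := nonempty_inter_stratum hX hc hw h.isFace hwF (W := O ∩ W)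
    ⟨hO.inter hW.1, hwO, hwW⟩
  exact ⟨z, hz.1, hWγ ⟨hz.2, hzF⟩⟩

/-- Forward, closures do not raise supports above `F`. Conversely, the inclusion is clear near `x`,
but `γ.comp V` may extend far away when `V` is not a box; connectedness propagates the inclusion
over all of it. -/
theorem inClosure_iff (hX : IsGManifold X) (hc : c ∈ X.atlas) (hu : u ∈ c.U)
    (hux : c.φ u = x) {γ : LocalCorner X k x} (hγ : Represents γ (c.stratum G))
    {β : LocalCorner X 1 x} (hβ : Represents β (c.stratum F)) : InClosure γ β ↔ G ≤ F := by
  have gc := hX.isGChart c hc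
  have hcx : IsOpenNhd c.image x := hux ▸ isOpenNhd_image hX hc hu
  constructor
  · rintro ⟨V₀, hV₀, h⟩
    have hV : IsOpenNhd (V₀ ∩ c.image) x := ⟨hV₀.1.inter hcx.1, hV₀.2, hcx.2⟩
    obtain ⟨z, hz⟩ := γ.nonempty hV
    obtain ⟨v, ⟨hvG, hv⟩, rfl⟩ := hγ.comp_subset hX hc hV inter_subset_right hz
    rw [← show supp v = G from hvG]
    exact hβ.supp_le_of_mem_closure hX hc hV inter_subset_right hv
      (h _ inter_subset_left hV hz)
  · intro hGF
    refine ⟨c.image, hcx, fun V hVc hV => ?_⟩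
    have hγG := hγ.comp_subset hX hc hV hVc
    by_contra hcon
    obtain ⟨z₁, hz₁, hz₁'⟩ := not_subset.1 hcon
    -- The union of `I` and the complement of the closure of `β.comp V` are open and cover `γ.comp
    -- V`. By definition of `I` they have no common point there, and the first one is met near `x`.
    let I := {W : Set X | IsOpen W ∧ ∀ w ∈ c.U, c.φ w ∈ W → supp w ≤ F →
      c.φ w ∈ closure (β.comp V)}
    obtain ⟨y, hy, hyO, hyZ⟩ := γ.isPreconnected hV (⋃₀ I) (closure (β.comp V))ᶜ
      (isOpen_sUnion fun W hW => hW.1) isClosed_closure.isOpen_compl (by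
        intro z hz
        by_cases hzβ : z ∈ closure (β.comp V)
        · left
          obtain ⟨v, ⟨hvG, hv⟩, rfl⟩ := hγG hz
          obtain ⟨W, hW, hWV, hWc, hWF⟩ := exists_box_image hX hc hv (V := V)
            ⟨hV.1, (γ.comp_subset hV hz).1⟩
          obtain ⟨z', hz'W, hz'⟩ := mem_closure_iff.1 hzβ W hW.1 hW.2
          have hsub := β.subset_comp hV (hWF F) (fun y hy => ⟨hWV hy.1,
            stratum_subset_depthStratum hX hc (hβ.codim hX hc) hy.2⟩)
            ⟨z', ⟨hz'W, hβ.comp_subset hX hc hV hVc hz'⟩, hz'⟩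
          refine ⟨W, ⟨hW.1, fun w hw hwW hwF => mem_closure_iff.2 fun O hO hwO => ?_⟩, hW.2⟩
          obtain ⟨z, hz, hzF⟩ := nonempty_inter_stratum hX hc hw hβ.isFace hwF (W := O ∩ W)
            ⟨hO.inter hW.1, hwO, hwW⟩
          exact ⟨z, hz.1, hsub ⟨hz.2, hzF⟩⟩
        · exact Or.inr hzβ)
      (by
        obtain ⟨W, hW, hWV, hWc, hWβ⟩ := hβ.exists_mem_closure hX hc hu hux hV
        obtain ⟨z, hzW, hz⟩ := γ.nonempty_inter hV hW
        exact ⟨z, hz, W, ⟨hW.1, hWβ⟩, hzW⟩)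
      ⟨z₁, hz₁, hz₁'⟩
    obtain ⟨v, ⟨hvG, hv⟩, rfl⟩ := hγG hy
    obtain ⟨W, hW, hyW⟩ := hyO
    exact hyZ (hW.2 v hv hyW ((show supp v = G from hvG).le.trans hGF))

/-- Points of `V` in both closures have support in `F ⊓ G`, and points with support exactly `F ⊓ G`
occur arbitrarily near `x`; the least depth is therefore the codimension of `F ⊓ G`. -/
theorem meetInCodim_iff (hX : IsGManifold X) (hc : c ∈ X.atlas) (hu : u ∈ c.U)
    (hux : c.φ u = x) {β₁ β₂ : LocalCorner X 1 x} (h₁ : Represents β₁ (c.stratum F))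
    (h₂ : Represents β₂ (c.stratum G)) {n : ℕ} :
    MeetInCodim β₁ β₂ n ↔ HasCodim (F ⊓ G) c.P n := by
  subst hux
  have hcx := isOpenNhd_image hX hc hu
  have key : ∀ n, HasCodim (F ⊓ G) c.P n → ∀ V ⊆ c.image, IsOpenNhd V (c.φ u) →
      IsLeast {d | (V ∩ depthStratum X d ∩ closure (β₁.comp V) ∩
        closure (β₂.comp V)).Nonempty} n := by
    intro n hn V hVc hV
    constructor
    · obtain ⟨W₁, hW₁, hW₁V, -, h₁'⟩ := h₁.exists_mem_closure hX hc hu rfl hV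
      obtain ⟨W₂, hW₂, -, -, h₂'⟩ := h₂.exists_mem_closure hX hc hu rfl hV
      obtain ⟨z, hz, v, ⟨hvF, hv⟩, rfl⟩ := nonempty_inter_stratum hX hc hu
        (h₁.isFace.inf h₂.isFace) (le_inf (h₁.supp_le hX hc hu rfl) (h₂.supp_le hX hc hu rfl))
        (W := W₁ ∩ W₂) ⟨hW₁.1.inter hW₂.1, hW₁.2, hW₂.2⟩
      have hvF' : supp v = F ⊓ G := hvF
      exact ⟨c.φ v, ⟨⟨hW₁V hz.1, (mem_depthStratum_iff hX hc hv).2 (by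
        rw [HasDepth, hvF']; exact hn)⟩, h₁' v hv hz.1 (hvF'.le.trans inf_le_left)⟩,
        h₂' v hv hz.2 (hvF'.le.trans inf_le_right)⟩
    · rintro d ⟨z, ⟨⟨hzV, hzd⟩, hz₁⟩, hz₂⟩
      obtain ⟨v, hv, rfl⟩ := hVc hzV
      have a1 := h₁.supp_le_of_mem_closure hX hc hV hVc hv hz₁
      have a2 := h₂.supp_le_of_mem_closure hX hc hV hVc hv hz₂
      have a3 := (mem_depthStratum_iff hX hc hv).1 hzd
      have a4 := rank_mono (le_inf a1 a2)
      unfold HasDepth at a3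
      unfold HasCodim at *
      omega
  constructor
  · rintro ⟨V₀, hV₀, h⟩
    obtain ⟨n', hn'⟩ : ∃ n', HasCodim (F ⊓ G) c.P n' :=
      ⟨_, Nat.add_sub_cancel' (rank_mono (inf_le_left.trans h₁.isFace.le))⟩
    have hV : IsOpenNhd (V₀ ∩ c.image) (c.φ u) := ⟨hV₀.1.inter hcx.1, hV₀.2, hcx.2⟩
    rw [(h _ inter_subset_left hV).unique (key n' hn' _ inter_subset_right hV)]
    exact hn'
  · exact fun h => ⟨c.image, hcx, key n h⟩

/-- Lying in a closure means inclusion of faces, and `IsFace.eq_or_eq` leaves no third facet above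
`G`. -/
theorem setOf_inClosure_eq (hX : IsGManifold X) (hc : c ∈ X.atlas) (hu : u ∈ c.U)
    {γ : LocalCorner X 2 (c.φ u)} (hγ : Represents γ (c.stratum G)) {β₁ β₂ : LocalCorner X 1 (c.φ u)}
    {F₁ F₂ : AddSubmonoid (Fin c.m → ℤ)} (h₁ : Represents β₁ (c.stratum F₁))
    (h₂ : Represents β₂ (c.stratum F₂)) (hne : F₁ ≠ F₂) (hG₁ : G ≤ F₁) (hG₂ : G ≤ F₂) :
    {β | InClosure γ β} = {β₁, β₂} := by
  ext β
  obtain ⟨F, hF⟩ := β.exists_face hX hc hu rfl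
  rw [mem_ofPred_eq, inClosure_iff hX hc hu rfl hγ hF]
  constructor
  · intro hle
    rcases hγ.isFace.eq_or_eq h₁.isFace h₂.isFace hF.isFace (hγ.codim hX hc) (h₁.codim hX hc)
      (h₂.codim hX hc) (hF.codim hX hc) hG₁ hG₂ hle hne with rfl | rfl
    · exact Or.inl (hF.unique hX hc hu rfl h₁)
    · exact Or.inr (hF.unique hX hc hu rfl h₂)
  · rintro (rfl | rfl)
    · rwa [hF.face_unique hX hc hu rfl h₁]
    · rwa [hF.face_unique hX hc hu rfl h₂]

/-- The description of `C_2(X)` by pairs of local boundary components. -/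
theorem bijOn_boundingSet (hX : IsGManifold X) : BijOn (boundingSet X) univ
    {q | ∃ β₁ β₂ : LocalCorner X 1 q.1, β₁ ≠ β₂ ∧ MeetInCodim β₁ β₂ 2 ∧ q.2 = {β₁, β₂}} := by
  have hex : ∀ {c : Chart X} (_ : c ∈ X.atlas) {u : XP c.P} (_ : u ∈ c.U)
      (γ : LocalCorner X 2 (c.φ u)) {G : AddSubmonoid (Fin c.m → ℤ)}
      (_ : Represents γ (c.stratum G)), ∃ (F₁ F₂ : AddSubmonoid (Fin c.m → ℤ))
        (β₁ β₂ : LocalCorner X 1 (c.φ u)), Represents β₁ (c.stratum F₁) ∧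
        Represents β₂ (c.stratum F₂) ∧ F₁ ≠ F₂ ∧ F₁ ⊓ F₂ = G := by
    intro c hc u hu γ G hγ
    obtain ⟨F₁, F₂, hF₁, hF₂, hk₁, hk₂, hne, hinf⟩ :=
      hγ.isFace.exists_pair (hX.isGChart c hc).weaklyToric.fg (hγ.codim hX hc)
    have hle := hγ.supp_le hX hc hu rfl
    obtain ⟨β₁, h₁⟩ := exists_represents hX hc hu hF₁ hk₁
      (hle.trans (by rw [← hinf]; exact inf_le_left))
    obtain ⟨β₂, h₂⟩ := exists_represents hX hc hu hF₂ hk₂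
      (hle.trans (by rw [← hinf]; exact inf_le_right))
    exact ⟨F₁, F₂, β₁, β₂, h₁, h₂, hne, hinf⟩
  refine ⟨?_, ?_, ?_⟩
  · rintro ⟨x, γ⟩ -
    obtain ⟨c, hc, u, hu, rfl⟩ := hX.cover x
    obtain ⟨G, hγ⟩ := γ.exists_face hX hc hu rfl
    have hk := hγ.codim hX hc
    obtain ⟨F₁, F₂, β₁, β₂, h₁, h₂, hne, hinf⟩ := hex hc hu γ hγ
    refine ⟨β₁, β₂, ?_, ?_, setOf_inClosure_eq hX hc hu hγ h₁ h₂ hne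
        (hinf ▸ inf_le_left) (hinf ▸ inf_le_right)⟩
    · rintro rfl
      exact hne (h₁.face_unique hX hc hu rfl h₂)
    · exact (meetInCodim_iff hX hc hu rfl h₁ h₂).2 (hinf.symm ▸ hk)
  · rintro ⟨x, γ⟩ - ⟨x', γ'⟩ - heq
    have hx : x = x' := congrArg Sigma.fst heq
    subst hx
    have hs : {β | InClosure γ β} = {β | InClosure γ' β} := eq_of_heq (Sigma.mk.inj heq).2
    obtain ⟨c, hc, u, hu, rfl⟩ := hX.cover x
    obtain ⟨G, hγ⟩ := γ.exists_face hX hc hu rfl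
    obtain ⟨G', hγ'⟩ := γ'.exists_face hX hc hu rfl
    obtain ⟨F₁, F₂, β₁, β₂, h₁, h₂, hne, hinf⟩ := hex hc hu γ hγ
    have hs' := setOf_inClosure_eq hX hc hu hγ h₁ h₂ hne (hinf ▸ inf_le_left)
      (hinf ▸ inf_le_right)
    have m1 : InClosure γ' β₁ := by
      have : β₁ ∈ {β | InClosure γ' β} := by rw [← hs, hs']; exact Or.inl rfl
      exact this
    have m2 : InClosure γ' β₂ := by
      have : β₂ ∈ {β | InClosure γ' β} := by rw [← hs, hs']; exact Or.inr rfl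
      exact this
    have l1 := (inClosure_iff hX hc hu rfl hγ' h₁).1 m1
    have l2 := (inClosure_iff hX hc hu rfl hγ' h₂).1 m2
    have hGG : G' = G := hγ'.isFace.eq_of_codim hγ.isFace (hinf ▸ le_inf l1 l2)
      (hγ'.codim hX hc) (hγ.codim hX hc)
    subst hGG
    rw [hγ.unique hX hc hu rfl hγ']
  · rintro ⟨x, B⟩ ⟨β₁, β₂, hne, hmeet, hB⟩
    change LocalCorner X 1 x at β₁ β₂
    change B = {β₁, β₂} at hB
    subst hB
    obtain ⟨c, hc, u, hu, rfl⟩ := hX.cover x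
    obtain ⟨F₁, h₁⟩ := β₁.exists_face hX hc hu rfl
    obtain ⟨F₂, h₂⟩ := β₂.exists_face hX hc hu rfl
    have hk := (meetInCodim_iff hX hc hu rfl h₁ h₂).1 hmeet
    obtain ⟨γ, hγ⟩ := exists_represents hX hc hu (h₁.isFace.inf h₂.isFace) hk
      (le_inf (h₁.supp_le hX hc hu rfl) (h₂.supp_le hX hc hu rfl))
    refine ⟨⟨_, γ⟩, mem_univ _, ?_⟩
    have := setOf_inClosure_eq hX hc hu hγ h₁ h₂
      (fun h => hne (h₁.unique hX hc hu rfl (h ▸ h₂))) inf_le_left inf_le_right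
    change (⟨c.φ u, {β | InClosure γ β}⟩ : Σ x : X, Set (LocalCorner X 1 x)) = _
    rw [this]

end Incidence

/-! ### The description of `∂²X` and the exchange of local boundary components -/

section SecondBoundary

variable {X : GSpace.{u}}

theorem isFlagPt_one_iff {c : Chart X} {F : ℕ → AddSubmonoid (Fin c.m → ℤ)} {u : XP c.P}
    {y : CornerSet X 1} : IsFlagPt c F 1 u y ↔ IsCorner c (F 1) u y := by
  have h1 : {z : X | ∃ v ∈ c.U, supp v = F 1 ∧ IsFlagPt c F 0 v z} ⊆ c.stratum (F 1) := by
    rintro z ⟨v, hv, hvF, rfl⟩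
    exact ⟨v, ⟨hvF, hv⟩, rfl⟩
  have h2 : c.stratum (F 1) ⊆ {z : X | ∃ v ∈ c.U, supp v = F 1 ∧ IsFlagPt c F 0 v z} := by
    rintro z ⟨v, ⟨hvF, hv⟩, rfl⟩
    exact ⟨v, hv, hvF, rfl⟩
  exact and_congr Iff.rfl ⟨fun h V hV => closure_mono (inter_subset_inter_right _ h1) (h V hV),
    fun h V hV => closure_mono (inter_subset_inter_right _ h2) (h V hV)⟩

/-- The component `β₁` is given by `F 1`, and `β'` by the face `F 2` of `F 1`. Its image in `X` lies
near `x` in the stratum of `F 2`, so the closure condition on `β₂` becomes `F 2 ≤ K₂`. -/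
theorem describes_iff (hX : IsGManifold X) {c : Chart X} (hc : c ∈ X.atlas)
    {F : ℕ → AddSubmonoid (Fin c.m → ℤ)} (hF : IsFlag c.P F 2) {u : XP c.P} (hu : u ∈ c.U)
    {y : CornerSet (boundary X) 1} (hy : IsFlagPt (X := X) c F 2 u y)
    {β₁ β₂ : LocalCorner X 1 (c.φ u)} {K₁ K₂ : AddSubmonoid (Fin c.m → ℤ)}
    (h₁ : Represents β₁ (c.stratum K₁)) (h₂ : Represents β₂ (c.stratum K₂)) :
    Describes (X := X) y ⟨c.φ u, (β₁, β₂)⟩ ↔ K₁ = F 1 ∧ K₂ ≠ F 1 ∧ F 2 ≤ K₂ := by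
  have hY := isGManifold_bd hX 1
  have hF1 := hF.mono (l := 1) (by omega)
  obtain ⟨p, β'⟩ := y
  have hp : IsCorner c (F 1) u p := isFlagPt_one_iff.1 hy.1
  obtain ⟨φ, hφ⟩ := exists_parametrizes hX hc hF1 p
  obtain ⟨e1, e2, e3⟩ := hφ.eq_of_isFlagPt hX hc hu hy.1
  have hβ' := hy.2
  rw [← hφ.stratum_eq' hX hc (hF.face 1 (by omega)).le] at hβ'
  constructor
  · rintro ⟨x, b₁, b₂, b', hyb, ht, hne, hV⟩
    have hx : c.φ u = x := congrArg Sigma.fst ht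
    subst hx
    have ht' : (β₁, β₂) = (b₁, b₂) := eq_of_heq (Sigma.mk.inj ht).2
    obtain ⟨rfl, rfl⟩ := Prod.mk.inj ht'
    have hp' : p = ⟨c.φ u, β₁⟩ := congrArg Sigma.fst hyb
    subst hp'
    have hb' : β' = b' := eq_of_heq (Sigma.mk.inj hyb).2
    subst hb'
    have hK₁ := h₁.face_unique hX hc hu rfl hp.2
    refine ⟨hK₁, ?_, ?_⟩
    · intro h
      subst h
      exact hne (h₂.unique hX hc hu rfl hp.2)
    · have hcx := isOpenNhd_image hX hc hu
      obtain ⟨V₀, hV₀, hsub⟩ := hV c.image hcx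
      obtain ⟨z, -, hz, v, hv, hvF, hzv⟩ := mem_closure_iff.1 (hy.2 V₀ hV₀) univ isOpen_univ
        (mem_univ _)
      have h3 := hsub V₀ subset_rfl hV₀ ⟨z, hz, rfl⟩
      have h4 : c.φ v = bdProj X z := hzv.proj
      rw [← h4] at h3
      rw [← hvF]
      exact h₂.supp_le_of_mem_closure hX hc hcx subset_rfl hv h3
  · rintro ⟨rfl, hne, hle⟩
    have hp' : p = ⟨c.φ u, β₁⟩ := hp.unique hX hc hu ⟨rfl, h₁⟩
    subst hp'
    refine ⟨c.φ u, β₁, β₂, β', rfl, rfl, ?_, fun V hV => ?_⟩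
    · rintro rfl
      exact hne (h₂.face_unique hX hc hu rfl h₁)
    · obtain ⟨W, hW, hWV, hWc, hWβ⟩ := h₂.exists_mem_closure hX hc hu rfl hV
      have he := (hY.isGChart _ hφ.1).isOpen_image
      refine ⟨(flagChart c hF1 φ).image ∩ bdProj X ⁻¹' W,
        ⟨he.inter (hW.1.preimage (continuous_cornerSet_fst hX)), ⟨_, e1, e2⟩, hW.2⟩,
        fun V' hV'V hV' => ?_⟩
      rintro _ ⟨z, hz, rfl⟩
      obtain ⟨w, ⟨hwF, hw⟩, rfl⟩ := Represents.comp_subset (X := bd X 1) hY hφ.1 hβ' hV'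
        (hV'V.trans inter_subset_left) hz
      have h3 := (hφ.2 w hw).proj
      have h4 := (hV'V (LocalCorner.comp_subset (X := bd X 1) _ hV' hz).1).2
      change bdProj X (φ w) ∈ W at h4
      change c.φ _ = bdProj X (φ w) at h3
      change bdProj X (φ w) ∈ _
      rw [← h3] at h4 ⊢
      refine hWβ _ hw h4 ?_
      rw [supp_inclFace, show supp w = F 2 from hwF]
      exact hle

theorem Describes.proj {y : CornerSet (boundary X) 1} {t : Triple X} (h : Describes (X := X) y t) :
    bdProjIter X 2 y = t.1 := by
  obtain ⟨x, b₁, b₂, b', rfl, rfl, -, -⟩ := h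
  rfl

/-- The other face of codimension one containing the last face of a flag of length two. -/
theorem IsFlag.exists_other {m : ℕ} {P : AddSubmonoid (Fin m → ℤ)} (hP : P.FG)
    {F : ℕ → AddSubmonoid (Fin m → ℤ)} (hF : IsFlag P F 2) :
    ∃ K, IsFace K P ∧ HasCodim K P 1 ∧ F 2 ≤ K ∧ K ≠ F 1 := by
  obtain ⟨F₁, F₂, h₁, h₂, hk₁, hk₂, hne, hinf⟩ := hF.isFace.exists_pair hP hF.hasCodim
  by_cases h : F₁ = F 1
  · exact ⟨F₂, h₂, hk₂, hinf ▸ inf_le_right, fun h' => hne (h.trans h'.symm)⟩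
  · exact ⟨F₁, h₁, hk₁, hinf ▸ inf_le_left, h⟩

theorem exists_describes (hX : IsGManifold X) (y : CornerSet (boundary X) 1) :
    ∃ t : Triple X, ∀ t', Describes (X := X) y t' ↔ t' = t := by
  obtain ⟨c, hc, u, hu, hux⟩ := hX.cover (bdProjIter X 2 y)
  obtain ⟨F, hF, hy⟩ := exists_flag_of_proj_eq hX hc (k := 2) hu y hux
  have hle := hy.supp_le hX hc hF hu
  have hF1 := hF.mono (l := 1) (by omega)
  obtain ⟨K, hK, hKk, hFK, hne⟩ := hF.exists_other (hX.isGChart c hc).weaklyToric.fg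
  obtain ⟨β₁, h₁⟩ := exists_represents hX hc hu hF1.isFace hF1.hasCodim
    (hle.trans (hF.face 1 (by omega)).le)
  obtain ⟨β₂, h₂⟩ := exists_represents hX hc hu hK hKk (hle.trans hFK)
  refine ⟨⟨c.φ u, (β₁, β₂)⟩, fun t' => ⟨fun h => ?_, ?_⟩⟩
  · have hx : c.φ u = t'.1 := hux.trans h.proj
    obtain ⟨x, b₁, b₂⟩ := t'
    change c.φ u = x at hx
    subst hx
    obtain ⟨K₁, hb₁⟩ := b₁.exists_face hX hc hu rfl
    obtain ⟨K₂, hb₂⟩ := b₂.exists_face hX hc hu rfl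
    obtain ⟨rfl, hne', hle'⟩ := (describes_iff hX hc hF hu hy hb₁ hb₂).1 h
    have : K₂ = K := by
      rcases hF.isFace.eq_or_eq hF1.isFace hK hb₂.isFace hF.hasCodim hF1.hasCodim hKk
        (hb₂.codim hX hc) (hF.face 1 (by omega)).le hFK hle' hne.symm with h | h
      · exact absurd h hne'
      · exact h
    subst this
    rw [h₁.unique hX hc hu rfl hb₁, h₂.unique hX hc hu rfl hb₂]
  · rintro rfl
    exact (describes_iff hX hc hF hu hy h₁ h₂).2 ⟨rfl, hne, hFK⟩

theorem isFlag_two {m : ℕ} {P K₁ K₂ : AddSubmonoid (Fin m → ℤ)} (h₁ : IsFace K₁ P)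
    (h₂ : IsFace K₂ P) (hk₁ : HasCodim K₁ P 1) (hk : HasCodim (K₁ ⊓ K₂) P 2) :
    IsFlag P (fun i => if i = 0 then P else if i = 1 then K₁ else K₁ ⊓ K₂) 2 := by
  refine ⟨rfl, fun i hi => ?_, fun i hi => ?_⟩
  · interval_cases i
    · exact h₁
    · exact (h₁.inf h₂).of_le inf_le_left h₁.le
  · interval_cases i
    · exact hk₁
    · change HasCodim (K₁ ⊓ K₂) K₁ 1
      unfold HasCodim at *
      omega

/-- From facets `K₁, K₂` with intersection of codimension two the flag is recovered as `F 1 = K₁`,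
`F 2 = K₁ ⊓ K₂`. This gives injectivity and surjectivity. -/
theorem exists_theta (hX : IsGManifold X) : ∃ Θ : bd X 2 → Triple X,
    (∀ y t, Describes (X := X) y t ↔ t = Θ y) ∧
      BijOn Θ univ {t | t.2.1 ≠ t.2.2 ∧ MeetInCodim t.2.1 t.2.2 2} := by
  choose Θ hΘ using exists_describes hX
  refine ⟨Θ, hΘ, ?_, ?_, ?_⟩
  · intro y _
    have hd := (hΘ y (Θ y)).2 rfl
    obtain ⟨c, hc, u, hu, hux⟩ := hX.cover (bdProjIter X 2 y)
    obtain ⟨F, hF, hy⟩ := exists_flag_of_proj_eq hX hc (k := 2) hu y hux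
    have hx : c.φ u = (Θ y).1 := hux.trans hd.proj
    generalize Θ y = t at hd hx ⊢
    obtain ⟨x, b₁, b₂⟩ := t
    change c.φ u = x at hx
    subst hx
    have hF1 := hF.mono (l := 1) (by omega)
    obtain ⟨K₁, hb₁⟩ := b₁.exists_face hX hc hu rfl
    obtain ⟨K₂, hb₂⟩ := b₂.exists_face hX hc hu rfl
    obtain ⟨rfl, hne', hle'⟩ := (describes_iff hX hc hF hu hy hb₁ hb₂).1 hd
    refine ⟨?_, (meetInCodim_iff hX hc hu rfl hb₁ hb₂).2 ?_⟩
    · rintro (h : b₁ = b₂)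
      subst h
      exact hne' (hb₂.face_unique hX hc hu rfl hb₁)
    · rw [hF.isFace.inf_eq hF1.isFace hb₂.isFace hF.hasCodim hF1.hasCodim (hb₂.codim hX hc)
        (hF.face 1 (by omega)).le hle' hne'.symm]
      exact hF.hasCodim
  · intro y _ y' _ heq
    have hd := (hΘ y (Θ y)).2 rfl
    have hd' := (hΘ y' (Θ y)).2 heq
    obtain ⟨c, hc, u, hu, hux⟩ := hX.cover (bdProjIter X 2 y)
    have hx : c.φ u = (Θ y).1 := hux.trans hd.proj
    obtain ⟨F, hF, hy⟩ := exists_flag_of_proj_eq hX hc (k := 2) hu y hux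
    obtain ⟨F', hF', hy'⟩ := exists_flag_of_proj_eq hX hc (k := 2) hu y' (hx.trans hd'.proj.symm)
    generalize Θ y = t at hd hd' hx
    obtain ⟨x, b₁, b₂⟩ := t
    change c.φ u = x at hx
    subst hx
    obtain ⟨K₁, hb₁⟩ := b₁.exists_face hX hc hu rfl
    obtain ⟨K₂, hb₂⟩ := b₂.exists_face hX hc hu rfl
    obtain ⟨e1, n1, l1⟩ := (describes_iff hX hc hF hu hy hb₁ hb₂).1 hd
    obtain ⟨e2, n2, l2⟩ := (describes_iff hX hc hF' hu hy' hb₁ hb₂).1 hd'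
    have hinf : ∀ F : ℕ → AddSubmonoid (Fin c.m → ℤ), IsFlag c.P F 2 → K₂ ≠ F 1 → F 2 ≤ K₂ →
        F 1 ⊓ K₂ = F 2 := fun F hF hne hle =>
      have hF1 := hF.mono (l := 1) (by omega)
      hF.isFace.inf_eq hF1.isFace hb₂.isFace hF.hasCodim hF1.hasCodim (hb₂.codim hX hc)
        (hF.face 1 (by omega)).le hle hne.symm
    have h2 : F 2 = F' 2 := by rw [← hinf F hF n1 l1, ← hinf F' hF' n2 l2, ← e1, ← e2]
    refine hy.unique hX hc hF hu (hy'.congr fun i hi => ?_)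
    interval_cases i
    · rw [hF.zero, hF'.zero]
    · rw [← e1, ← e2]
    · exact h2
  · rintro ⟨x, b₁, b₂⟩ ⟨hne, hmeet⟩
    change b₁ ≠ b₂ at hne
    change MeetInCodim b₁ b₂ 2 at hmeet
    obtain ⟨c, hc, u, hu, rfl⟩ := hX.cover x
    obtain ⟨K₁, h₁⟩ := b₁.exists_face hX hc hu rfl
    obtain ⟨K₂, h₂⟩ := b₂.exists_face hX hc hu rfl
    have hk := (meetInCodim_iff hX hc hu rfl h₁ h₂).1 hmeet
    have hF := isFlag_two h₁.isFace h₂.isFace (h₁.codim hX hc) hk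
    obtain ⟨y, hy⟩ := exists_isFlagPt hX hc hF hu
      (le_inf (h₁.supp_le hX hc hu rfl) (h₂.supp_le hX hc hu rfl))
    refine ⟨y, mem_univ _, ((hΘ y _).1 ?_).symm⟩
    refine (describes_iff hX hc hF hu hy h₁ h₂).2 ⟨rfl, fun h => hne ?_, inf_le_right⟩
    have h' : K₂ = K₁ := h
    subst h'
    exact h₁.unique hX hc hu rfl h₂

/-- The exchange of the two local boundary components, and its description in charts. -/
theorem exists_swap (hX : IsGManifold X) : ∃ s : Equiv.Perm (bd X 2),
    (∀ σ : bd X 2 → bd X 2, IsSwap X σ ↔ σ = s) ∧ (∀ y, s (s y) = y) ∧ (∀ y, s y ≠ y) ∧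
    ∀ c ∈ X.atlas, ∀ F F' : ℕ → AddSubmonoid (Fin c.m → ℤ), IsFlag c.P F 2 → IsFlag c.P F' 2 →
      F' 1 ≠ F 1 → F' 2 = F 2 → ∀ u ∈ c.U, ∀ y : bd X 2, IsFlagPt c F 2 u y →
        IsFlagPt c F' 2 u (s y) := by
  obtain ⟨Θ, hΘ, hmaps, hinj, hsurj⟩ := exists_theta hX
  have hinj' : Function.Injective Θ := fun y z h => hinj (mem_univ y) (mem_univ z) h
  -- Meeting in codimension two is symmetric, so interchanging the components preserves the range of
  -- `Θ`, and the exchange is obtained by transport along this bijection.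
  let sw : Triple X → Triple X := fun t => ⟨t.1, (t.2.2, t.2.1)⟩
  have hsw : ∀ y, ∃ z, Θ z = sw (Θ y) := by
    intro y
    obtain ⟨hne, V₀, hV₀, h⟩ := hmaps (mem_univ y)
    obtain ⟨z, -, hz⟩ := hsurj (show sw (Θ y) ∈ _ from ⟨hne.symm, V₀, hV₀, fun V hV hV' => by
      have h' := h V hV hV'
      have e : ∀ d, V ∩ depthStratum X d ∩ closure ((Θ y).2.1.comp V) ∩
          closure ((Θ y).2.2.comp V) = V ∩ depthStratum X d ∩ closure ((Θ y).2.2.comp V) ∩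
          closure ((Θ y).2.1.comp V) := fun d => inter_right_comm _ _ _
      simp only [e] at h'
      exact h'⟩)
    exact ⟨z, hz⟩
  choose s hs using hsw
  have hss : ∀ y, s (s y) = y := fun y => hinj' (by rw [hs, hs])
  have hiff : ∀ σ : bd X 2 → bd X 2, IsSwap X σ ↔ σ = s := by
    intro σ
    constructor
    · intro h
      funext y
      refine hinj' ?_
      rw [hs]
      exact ((hΘ _ _).1 (h y (Θ y).1 (Θ y).2.1 (Θ y).2.2 ((hΘ y _).2 rfl))).symm
    · rintro rfl y x β₁ β₂ h
      refine (hΘ _ _).2 ?_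
      exact ((hs y).trans (congrArg sw ((hΘ y _).1 h).symm)).symm
  refine ⟨⟨s, s, hss, hss⟩, hiff, hss, fun y hy => ?_, ?_⟩
  · have h1 := (hmaps (mem_univ y)).1
    have h2 := hs y
    rw [show s y = y from hy] at h2
    generalize Θ y = t at h1 h2
    obtain ⟨x, b₁, b₂⟩ := t
    have h3 : (b₁, b₂) = (b₂, b₁) := eq_of_heq (Sigma.mk.inj h2).2
    exact h1 (Prod.mk.inj h3).1
  · intro c hc F F' hF hF' h1 h2 u hu y hy
    have hle := hy.supp_le hX hc hF hu
    have hF1 := hF.mono (l := 1) (by omega)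
    have hF1' := hF'.mono (l := 1) (by omega)
    have l1 := (hF.face 1 (by omega)).le
    have l1' : F 2 ≤ F' 1 := h2 ▸ (hF'.face 1 (by omega)).le
    obtain ⟨y', hy'⟩ := exists_isFlagPt hX hc hF' hu (h2 ▸ hle)
    obtain ⟨β₁, r₁⟩ := exists_represents hX hc hu hF1.isFace hF1.hasCodim (hle.trans l1)
    obtain ⟨β₂, r₂⟩ := exists_represents hX hc hu hF1'.isFace hF1'.hasCodim (hle.trans l1')
    have d1 := (describes_iff hX hc hF hu hy r₁ r₂).2 ⟨rfl, h1, l1'⟩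
    have d2 := (describes_iff hX hc hF' hu hy' r₂ r₁).2 ⟨rfl, h1.symm, h2 ▸ l1⟩
    have : s y = y' := by
      refine hinj' ?_
      exact (hs y).trans ((congrArg sw ((hΘ y _).1 d1).symm).trans ((hΘ y' _).1 d2))
    change IsFlagPt c F' 2 u (s y)
    rwa [this]

end SecondBoundary


/-! ### Local isomorphisms -/

section LocallyIso

variable {X : GSpace.{u}} {Y : GSpace.{v}}

/-- Near every point, `f` is the identity map in suitable charts. -/
def LocallyIso (f : X → Y) : Prop :=
  ∀ x, ∃ (m : ℕ) (P : AddSubmonoid (Fin m → ℤ)) (D : Set (XP P)) (φ : XP P → X) (φ' : XP P → Y),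
    (⟨m, P, D, φ⟩ : Chart X) ∈ X.atlas ∧ (⟨m, P, D, φ'⟩ : Chart Y) ∈ Y.atlas ∧
      (∃ u ∈ D, φ u = x) ∧ ∀ v ∈ D, f (φ v) = φ' v

namespace LocallyIso

variable {f : X → Y}

theorem smooth (hX : IsGManifold X) (hY : IsGManifold Y) (hf : LocallyIso f) : Smooth f :=
  smoothOn_of_charts hX hY fun x _ => by
    obtain ⟨m, P, D, φ, φ', hc, hd, hx, h⟩ := hf x
    exact ⟨m, P, D, D, φ, φ', hc, hd, hx, fun v hv => ⟨hv, h v hv⟩⟩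

theorem continuous (hX : IsGManifold X) (hY : IsGManifold Y) (hf : LocallyIso f) :
    Continuous f := continuousOn_univ.1 (hf.smooth hX hY).1

theorem symm {e : X ≃ Y} (he : LocallyIso e) : LocallyIso e.symm := by
  intro y
  obtain ⟨m, P, D, φ, φ', hc, hd, ⟨u, hu, hx⟩, h⟩ := he (e.symm y)
  refine ⟨m, P, D, φ', φ, hd, hc, ⟨u, hu, ?_⟩, fun v hv => ?_⟩
  · rw [← h u hu, hx, e.apply_symm_apply]
  · rw [← h v hv, e.symm_apply_apply]

theorem isDiffeo (hX : IsGManifold X) (hY : IsGManifold Y) {e : X ≃ Y} (he : LocallyIso e) :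
    IsDiffeo e := ⟨he.smooth hX hY, he.symm.smooth hY hX⟩

theorem exists_subset (hX : IsGManifold X) (hY : IsGManifold Y) (hf : LocallyIso f) {x : X}
    {V : Set X} (hV : IsOpenNhd V x) : ∃ (m : ℕ) (P : AddSubmonoid (Fin m → ℤ)) (D : Set (XP P))
      (φ : XP P → X) (φ' : XP P → Y), (⟨m, P, D, φ⟩ : Chart X) ∈ X.atlas ∧
        (⟨m, P, D, φ'⟩ : Chart Y) ∈ Y.atlas ∧ (∃ u ∈ D, φ u = x) ∧ (∀ v ∈ D, f (φ v) = φ' v) ∧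
          ∀ v ∈ D, φ v ∈ V := by
  obtain ⟨m, P, D, φ, φ', hc, hd, ⟨u, hu, rfl⟩, h⟩ := hf x
  have hO := (hX.isGChart _ hc).isOpen_inter_preimage hV.1
  exact ⟨m, P, D ∩ φ ⁻¹' V, φ, φ', hX.restrict_mem hc hO inter_subset_left fun _ _ => rfl,
    hY.restrict_mem hd hO inter_subset_left fun _ _ => rfl, ⟨u, ⟨hu, hV.2⟩, rfl⟩,
    fun v hv => h v hv.1, fun v hv => hv.2⟩

theorem isEtale (hX : IsGManifold X) (hY : IsGManifold Y) (hf : LocallyIso f) : IsEtale f := by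
  intro x
  obtain ⟨m, P, D, φ, φ', hc, hd, ⟨u, hu, rfl⟩, h⟩ := hf x
  have gc := hX.isGChart _ hc
  have gd := hY.isGChart _ hd
  have him : f '' (φ '' D) = φ' '' D := by
    rw [image_image]
    exact image_congr h
  have hg : ∀ v ∈ D, φ (Chart.inv (⟨m, P, D, φ'⟩ : Chart Y) (φ' v)) = φ v := fun v hv =>
    congrArg φ (gd.inv_φ hv)
  refine ⟨φ '' D, gc.isOpen_image, ⟨u, hu, rfl⟩, him ▸ gd.isOpen_image,
    smoothOn_of_charts hX hY ?_, fun y => φ (Chart.inv (⟨m, P, D, φ'⟩ : Chart Y) y), ?_,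
    smoothOn_of_charts hY hX ?_⟩
  · rintro _ ⟨v, hv, rfl⟩
    exact ⟨m, P, D, D, φ, φ', hc, hd, ⟨v, hv, rfl⟩, fun v hv => ⟨hv, h v hv⟩⟩
  · rintro _ ⟨v, hv, rfl⟩
    rw [h v hv]
    exact hg v hv
  · rw [him]
    rintro _ ⟨v, hv, rfl⟩
    exact ⟨m, P, D, D, φ', φ, hd, hc, ⟨v, hv, rfl⟩, fun v hv => ⟨hv, hg v hv⟩⟩

theorem mem_depthStratum_iff (hX : IsGManifold X) (hY : IsGManifold Y) (hf : LocallyIso f)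
    {k : ℕ} {x : X} : f x ∈ depthStratum Y k ↔ x ∈ depthStratum X k := by
  obtain ⟨m, P, D, φ, φ', hc, hd, ⟨u, hu, rfl⟩, h⟩ := hf x
  rw [h u hu]
  exact (GCorners.mem_depthStratum_iff hY hd hu).trans
    (GCorners.mem_depthStratum_iff hX hc hu).symm

end LocallyIso

end LocallyIso

/-! ### Quotients by free involutions -/

section Quotient

variable {Y : GSpace.{u}} {s : Equiv.Perm Y} {r : Setoid Y}

/-- The charts on the quotient which are induced by charts on `Y`. -/
def quotientCharts (Y : GSpace.{u}) (r : Setoid Y) : Set (Chart (quotient Y r)) :=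
  {d | ∃ c ∈ Y.atlas, InjOn (fun x => Quotient.mk r (c.φ x)) c.U ∧
      d = ⟨c.m, c.P, c.U, fun x => Quotient.mk r (c.φ x)⟩}

/-- The saturation of `O` is `O ∪ s⁻¹ O`. -/
theorem isOpenMap_quotientMk (hs : Continuous s) (hr : ∀ y z, r y z ↔ z = y ∨ z = s y)
    {O : Set Y} (hO : IsOpen O) : IsOpen (quotientMk Y r '' O) := by
  refine isQuotientMap_quot_mk.isOpen_preimage.1 ?_
  convert hO.union (hO.preimage hs) using 1
  ext y
  constructor
  · rintro ⟨z, hz, hzy⟩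
    rcases (hr y z).1 (r.symm (Quotient.exact hzy)) with rfl | rfl
    · exact Or.inl hz
    · exact Or.inr hz
  · rintro (hy | hy)
    · exact ⟨y, hy, rfl⟩
    · exact ⟨s y, hy, Quotient.sound (r.symm ((hr y (s y)).2 (Or.inr rfl)))⟩

theorem continuous_quotientMk : Continuous (quotientMk Y r) := continuous_quot_mk

variable (hY : IsGManifold Y) (hsm : Smooth (s : Y → Y))
  (hne : ∀ y, s y ≠ y) (hr : ∀ y z, r y z ↔ z = y ∨ z = s y)
include hY hsm hr

theorem isGChart_of_mem_quotientCharts {d : Chart (quotient Y r)} (hd : d ∈ quotientCharts Y r) :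
    IsGChart (quotient Y r).dim d := by
  obtain ⟨c, hc, hi, rfl⟩ := hd
  have gc := hY.isGChart c hc
  refine .of_isOpen_image gc.weaklyToric gc.rank_eq gc.isOpen
    (continuous_quotientMk.comp_continuousOn gc.continuousOn) hi fun O hO hO' => ?_
  have := isOpenMap_quotientMk (continuousOn_univ.1 hsm.1) hr (gc.isOpen_image_of_subset hO' hO)
  rwa [image_image] at this

/-- Locally a transition map of the quotient is either one of `Y` or the expression of `s` in two
charts of `Y`. -/
theorem smoothTransition_of_mem_quotientCharts {d d' : Chart (quotient Y r)}
    (hd : d ∈ quotientCharts Y r) (hd' : d' ∈ quotientCharts Y r) : SmoothTransition d d' := by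
  have gd' := isGChart_of_mem_quotientCharts hY hsm hr hd'
  obtain ⟨c, hc, hi, rfl⟩ := hd
  obtain ⟨c', hc', hi', rfl⟩ := hd'
  have gc := hY.isGChart c hc
  have gc' := hY.isGChart c' hc'
  refine ModelSmoothOn.of_locally fun u hu => ?_
  obtain ⟨hu, w, hw, hwu⟩ := hu
  change Quotient.mk r (c'.φ w) = Quotient.mk r (c.φ u) at hwu
  have hinv : ∀ v, ∀ w ∈ c'.U, r (c.φ v) (c'.φ w) →
      Chart.inv (⟨c'.m, c'.P, c'.U, fun x => Quotient.mk r (c'.φ x)⟩ : Chart (quotient Y r))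
        (Quotient.mk r (c.φ v)) = w := by
    intro v w hw h
    have h1 : Quotient.mk r (c.φ v) = Quotient.mk r (c'.φ w) := Quotient.sound h
    rw [h1]
    exact gd'.inv_φ hw
  rcases (hr _ _).1 (r.symm (Quotient.exact hwu)) with h | h
  · refine ⟨_, gc.isOpen_inter_preimage gc'.isOpen_image, ⟨hu, w, hw, h⟩, ?_⟩
    refine ((hY.smoothTransition hc hc').mono inter_subset_right).congr ?_
    rintro v ⟨-, hv, hvc⟩
    refine hinv v _ (Chart.inv_mem hvc) ?_
    rw [Chart.φ_inv hvc]
  · have hcont : Continuous s := continuousOn_univ.1 hsm.1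
    refine ⟨_, gc.isOpen_inter_preimage (gc'.isOpen_image.preimage hcont), ⟨hu, w, hw, h⟩, ?_⟩
    refine ((hsm.2 c hc c' hc').mono ?_).congr ?_
    · rintro v ⟨-, hv, hvc⟩
      exact ⟨hv, mem_univ _, hvc⟩
    · rintro v ⟨-, hv, hvc⟩
      refine hinv v _ (Chart.inv_mem hvc) ?_
      rw [Chart.φ_inv hvc]
      exact (hr _ _).2 (Or.inr rfl)

include hne in
theorem exists_nhd_injOn (y : Y) : ∃ V, IsOpenNhd V y ∧ InjOn (quotientMk Y r) V := by
  have := hY.t2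
  obtain ⟨A, B, hA, hB, hyA, hyB, hAB⟩ := t2_separation (hne y).symm
  refine ⟨A ∩ s ⁻¹' B, ⟨hA.inter (hB.preimage (continuousOn_univ.1 hsm.1)), hyA, hyB⟩, ?_⟩
  intro v hv w hw hvw
  rcases (hr _ _).1 (Quotient.exact hvw) with h | h
  · exact h.symm
  · exact absurd hw.1 (disjoint_right.1 hAB (h ▸ hv.2))

include hne

theorem isGManifold_quotient : IsGManifold (quotient Y r) := by
  have hcont : Continuous s := continuousOn_univ.1 hsm.1
  have hopen : IsOpenMap (quotientMk Y r) := fun O hO => isOpenMap_quotientMk hcont hr hO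
  refine isGManifold_of_atlas (X := quotient Y r) (A := quotientCharts Y r) ⟨?_⟩ ?_
    (fun d hd => isGChart_of_mem_quotientCharts hY hsm hr hd)
    (fun d hd d' hd' => smoothTransition_of_mem_quotientCharts hY hsm hr hd hd') ?_ rfl
  · intro p q hpq
    obtain ⟨y, rfl⟩ := Quotient.exists_rep p
    obtain ⟨z, rfl⟩ := Quotient.exists_rep q
    have := hY.t2
    -- Different orbits require `y` to be separated from both `z` and `s z`; intersecting the
    -- neighbourhoods makes their images disjoint.
    have h1 : y ≠ z := fun h => hpq (congrArg _ h)
    have h2 : y ≠ s z := fun h => hpq (Quotient.sound (r.symm ((hr z y).2 (Or.inr h))))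
    obtain ⟨A, B, hA, hB, hyA, hzB, hAB⟩ := t2_separation h1
    obtain ⟨C, D, hC, hD, hyC, hzD, hCD⟩ := t2_separation h2
    refine ⟨quotientMk Y r '' (A ∩ C), quotientMk Y r '' (B ∩ s ⁻¹' D), hopen _ (hA.inter hC),
      hopen _ (hB.inter (hD.preimage hcont)), ⟨y, ⟨hyA, hyC⟩, rfl⟩, ⟨z, ⟨hzB, hzD⟩, rfl⟩, ?_⟩
    rw [Set.disjoint_left]
    rintro _ ⟨a, ha, rfl⟩ ⟨b, hb, hba⟩
    rcases (hr _ _).1 (Quotient.exact hba) with h | h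
    · exact disjoint_left.1 hAB ha.1 (h ▸ hb.1)
    · exact disjoint_left.1 hCD ha.2 (h ▸ hb.2)
  · have := hY.secondCountable
    exact TopologicalSpace.Quotient.secondCountableTopology hopen
  · intro p
    obtain ⟨y, rfl⟩ := Quotient.exists_rep p
    obtain ⟨V, hV, hi⟩ := exists_nhd_injOn hY hsm hne hr y
    obtain ⟨c, hc, u, hu, rfl⟩ := hY.cover y
    have gc := hY.isGChart c hc
    refine ⟨_, ⟨_, hY.restrict_mem hc (gc.isOpen_inter_preimage hV.1) inter_subset_left
      (ψ := c.φ) (fun _ _ => rfl), ?_, rfl⟩, u, ⟨hu, hV.2⟩, rfl⟩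
    intro v hv w hw hvw
    exact gc.injOn hv.1 hw.1 (hi hv.2 hw.2 hvw)

/-- A local isomorphism whose fibres are the orbits of the involution is a quotient map. -/
theorem exists_equiv_quotient {Z : GSpace.{u}} (hZ : IsGManifold Z) {f : Y → Z}
    (hf : LocallyIso f) (hsurj : Function.Surjective f) (hfr : ∀ y z, f y = f z ↔ r y z) :
    ∃ Ψ : Z ≃ quotient Y r, IsDiffeo Ψ ∧ ∀ y, Ψ.symm (quotientMk Y r y) = f y := by
  let g : quotient Y r → Z := Quotient.lift f fun y z h => (hfr y z).2 h
  have hg : ∀ y, g (quotientMk Y r y) = f y := fun y => rfl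
  have hbij : Function.Bijective g := by
    refine ⟨fun p q h => ?_, fun z => ?_⟩
    · obtain ⟨y, rfl⟩ := Quotient.exists_rep p
      obtain ⟨z, rfl⟩ := Quotient.exists_rep q
      exact Quotient.sound ((hfr y z).1 h)
    · obtain ⟨y, rfl⟩ := hsurj z
      exact ⟨quotientMk Y r y, rfl⟩
  have hQ := isGManifold_quotient hY hsm hne hr
  have hloc : LocallyIso g := by
    intro p
    obtain ⟨y, rfl⟩ := Quotient.exists_rep p
    obtain ⟨V, hV, hi⟩ := exists_nhd_injOn hY hsm hne hr y
    obtain ⟨m, P, D, φ, φ', hc, hd, ⟨u, hu, rfl⟩, h, hDV⟩ := hf.exists_subset hY hZ hV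
    have gc := hY.isGChart _ hc
    refine ⟨m, P, D, fun v => quotientMk Y r (φ v), φ', ?_, hd, ⟨u, hu, rfl⟩, h⟩
    refine subset_maximalAtlas (fun d hd => isGChart_of_mem_quotientCharts hY hsm hr hd)
      (fun d hd d' hd' => ⟨smoothTransition_of_mem_quotientCharts hY hsm hr hd hd',
        smoothTransition_of_mem_quotientCharts hY hsm hr hd' hd⟩) ?_
    refine ⟨⟨m, P, D, φ⟩, hc, fun v hv w hw hvw => ?_, rfl⟩
    exact gc.injOn hv hw (hi (hDV v hv) (hDV w hw) hvw)
  refine ⟨(Equiv.ofBijective g hbij).symm, ?_, fun y => rfl⟩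
  exact LocallyIso.isDiffeo hZ hQ (LocallyIso.symm (e := Equiv.ofBijective g hbij) hloc)

end Quotient

/-! ### The natural projections from iterated boundaries to corners -/

section NaturalProjection

variable {X : GSpace.{u}} {k : ℕ}

/-- The interior of `∂^k X` near `y` is mapped into `γ`. -/
def MapsInterior (y : bd X k) (γ : LocalCorner X k (bdProjIter X k y)) : Prop :=
  ∀ V, IsOpenNhd V (bdProjIter X k y) → ∃ V', IsOpenNhd V' y ∧
    bdProjIter X k '' (V' ∩ depthStratum (bd X k) 0) ⊆ γ.comp V

theorem nonempty_inter_interior (hX : IsGManifold X) {x : X} {V : Set X} (hV : IsOpenNhd V x) :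
    (V ∩ depthStratum X 0).Nonempty := by
  obtain ⟨c, hc, u, hu, rfl⟩ := hX.cover x
  obtain ⟨z, hz, hzF⟩ := nonempty_inter_stratum hX hc hu (IsFace.refl c.P) (GCorners.supp_le u) hV
  exact ⟨z, hz, stratum_subset_depthStratum hX hc (Nat.add_zero _) hzF⟩

/-- Every neighbourhood of `y` contains interior points, and their images lie in both components. -/
theorem MapsInterior.unique (hX : IsGManifold X) {y : bd X k}
    {γ γ' : LocalCorner X k (bdProjIter X k y)} (h : MapsInterior y γ) (h' : MapsInterior y γ') :
    γ = γ' := by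
  refine LocalCorner.ext_of_inter fun V hV => ?_
  obtain ⟨W, hW, hWγ⟩ := h V hV
  obtain ⟨W', hW', hWγ'⟩ := h' V hV
  obtain ⟨z, hz, hz0⟩ := nonempty_inter_interior (isGManifold_bd hX k) (x := y) (V := W ∩ W')
    ⟨hW.1.inter hW'.1, hW.2, hW'.2⟩
  exact ⟨_, hWγ ⟨z, ⟨hz.1, hz0⟩, rfl⟩, hWγ' ⟨z, ⟨hz.2, hz0⟩, rfl⟩⟩

variable {c : Chart X} {F : ℕ → AddSubmonoid (Fin c.m → ℤ)} {u : XP c.P}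

/-- In the flag chart, points of depth zero have support exactly `F k`, so their images lie in the
stratum of `F k`, which near the base point is contained in the component. -/
theorem mapsInterior_of_represents (hX : IsGManifold X) (hc : c ∈ X.atlas) (hF : IsFlag c.P F k)
    (hu : u ∈ c.U) {y : bd X k} (hy : IsFlagPt c F k u y) {γ : LocalCorner X k (bdProjIter X k y)}
    (hγ : Represents γ (c.stratum (F k))) : MapsInterior y γ := by
  intro V hV
  have hY := isGManifold_bd hX k
  obtain ⟨φ, hφ⟩ := exists_parametrizes hX hc hF y
  obtain ⟨h1, h2, h3⟩ := hφ.eq_of_isFlagPt hX hc hu hy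
  obtain ⟨W, hW, hWV, hWc, hWγ⟩ := hγ.exists_subset_comp hX hc hu hy.proj hV
  have gc := hX.isGChart c hc
  have ge := hY.isGChart _ hφ.1
  refine ⟨φ '' (inclFace hF.isFace ⁻¹' (c.U ∩ c.φ ⁻¹' W)), ⟨ge.isOpen_image_of_subset
    ((gc.isOpen_inter_preimage hW.1).preimage (continuous_inclFace hF.isFace)) fun v hv => hv.1,
    _, ⟨h1, ?_⟩, h2⟩, ?_⟩
  · rw [mem_preimage, h3, hy.proj]
    exact hW.2
  · rintro _ ⟨_, ⟨⟨v, ⟨hv, hvW⟩, rfl⟩, h0⟩, rfl⟩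
    have h4 : HasDepth v 0 := (mem_depthStratum_iff hY hφ.1 (y := v) hv).1 h0
    have h5 : supp v = F k := (supp_isFace v).eq_of_rank_le (by
      unfold HasDepth HasCodim at h4
      omega)
    rw [← (hφ.2 v hv).proj]
    exact hWγ ⟨hvW, _, ⟨(supp_inclFace _ v).trans h5, hv⟩, rfl⟩

theorem exists_represents_proj (hX : IsGManifold X) (hc : c ∈ X.atlas) (hF : IsFlag c.P F k)
    (hu : u ∈ c.U) {y : bd X k} (hy : IsFlagPt c F k u y) :
    ∃ γ : LocalCorner X k (bdProjIter X k y), Represents γ (c.stratum (F k)) :=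
  hy.proj ▸ exists_represents hX hc hu hF.isFace hF.hasCodim (hy.supp_le hX hc hF hu)

/-- The last clause says that in charts the projection keeps only the last face of a flag;
everything else about `π` is deduced from it. -/
theorem exists_naturalProj (hX : IsGManifold X) (k : ℕ) : ∃ π : bd X k → corners X k,
    (∀ π', IsNaturalProj X k π' ↔ π' = π) ∧
    ∀ c ∈ X.atlas, ∀ F : ℕ → AddSubmonoid (Fin c.m → ℤ), IsFlag c.P F k → ∀ u ∈ c.U,
      ∀ y : bd X k, IsFlagPt c F k u y → IsCorner c (F k) u (π y) := by
  have hex : ∀ y : bd X k, ∃ γ : LocalCorner X k (bdProjIter X k y), MapsInterior y γ := by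
    intro y
    obtain ⟨c, hc, u, hu, hux⟩ := hX.cover (bdProjIter X k y)
    obtain ⟨F, hF, hy⟩ := exists_flag_of_proj_eq hX hc hu y hux
    obtain ⟨γ, hγ⟩ := exists_represents_proj hX hc hF hu hy
    exact ⟨γ, mapsInterior_of_represents hX hc hF hu hy hγ⟩
  choose γ hγ using hex
  refine ⟨fun y => (⟨_, γ y⟩ : CornerSet X k), fun π' => ⟨fun h => funext fun y => ?_, ?_⟩, ?_⟩
  · obtain ⟨γ', h1, h2⟩ := h y
    rw [h1, MapsInterior.unique hX h2 (hγ y)]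
  · rintro rfl y
    exact ⟨γ y, rfl, hγ y⟩
  · intro c hc F hF u hu y hy
    obtain ⟨γ', hγ'⟩ := exists_represents_proj hX hc hF hu hy
    refine ⟨hy.proj, ?_⟩
    change Represents (γ y) _
    rwa [(hγ y).unique hX (mapsInterior_of_represents hX hc hF hu hy hγ')]

section

variable {π : bd X k → corners X k} (hπ : ∀ c ∈ X.atlas, ∀ F : ℕ → AddSubmonoid (Fin c.m → ℤ),
  IsFlag c.P F k → ∀ u ∈ c.U, ∀ y : bd X k, IsFlagPt c F k u y → IsCorner c (F k) u (π y))

include hπ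

/-- The flag chart on `∂^k X` and the corner chart on `C_k(X)` have the same model `X_{F k}` and the
same domain, and `π` is the identity between them. -/
theorem locallyIso_naturalProj (hX : IsGManifold X) : LocallyIso π := by
  intro y
  obtain ⟨c, hc, u, hu, hux⟩ := hX.cover (bdProjIter X k y)
  obtain ⟨F, hF, hy⟩ := exists_flag_of_proj_eq hX hc hu y hux
  obtain ⟨φ, hφ⟩ := exists_parametrizes hX hc hF y
  obtain ⟨h1, h2, -⟩ := hφ.eq_of_isFlagPt hX hc hu hy
  obtain ⟨ψ, he, hψ⟩ := exists_cornerChart hX hc hF.isFace hF.hasCodim (π y)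
  refine ⟨_, _, _, φ, ψ, hφ.1, cornerCharts_subset_atlas hX he, ⟨_, h1, h2⟩, fun v hv => ?_⟩
  exact (IsCorner.eq_cornerChart hX hc hψ hv (hπ c hc F hF _ hv _ (hφ.2 v hv))).symm

theorem surjective_naturalProj (hX : IsGManifold X) : Function.Surjective π := by
  rintro ⟨x, γ⟩
  change LocalCorner X k x at γ
  obtain ⟨c, hc, u, hu, rfl⟩ := hX.cover x
  obtain ⟨G, hG⟩ := γ.exists_face hX hc hu rfl
  obtain ⟨F, h0, rfl, hF⟩ := hG.isFace.exists_flag k (hX.isGChart c hc).weaklyToric.fg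
    (hG.codim hX hc)
  have hF' : IsFlag c.P F k := ⟨h0, fun i hi => (hF i hi).1, fun i hi => (hF i hi).2⟩
  obtain ⟨y, hy⟩ := exists_isFlagPt hX hc hF' hu (hG.supp_le hX hc hu rfl)
  exact ⟨y, (hπ c hc F hF' u hu y hy).unique hX hc hu ⟨rfl, hG⟩⟩

end

end NaturalProjection

/-! ### The involution of the second boundary -/

section Involution

variable {X : GSpace.{u}} {k : ℕ}

/-- This writes the chart of a second flag over the same model `X_G` as that of the first, so that a
map between them can be the identity. -/
theorem exists_parametrizes_of_eq (hX : IsGManifold X) {c : Chart X} (hc : c ∈ X.atlas)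
    {F : ℕ → AddSubmonoid (Fin c.m → ℤ)} (hF : IsFlag c.P F k) {G : AddSubmonoid (Fin c.m → ℤ)}
    (hG : IsFace G c.P) (hFG : F k = G) (y : bd X k) : ∃ φ : XP G → bd X k,
      (⟨c.m, G, inclFace hG ⁻¹' c.U, φ⟩ : Chart (bd X k)) ∈ (bd X k).atlas ∧
        ∀ v, inclFace hG v ∈ c.U → IsFlagPt c F k (inclFace hG v) (φ v) := by
  subst hFG
  exact exists_parametrizes hX hc hF y

/-- A map which changes the flags of points, but not their last faces, is a local
isomorphism. -/
theorem locallyIso_of_flags (hX : IsGManifold X) {f : bd X k → bd X k}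
    (hf : ∀ c ∈ X.atlas, ∀ F : ℕ → AddSubmonoid (Fin c.m → ℤ), IsFlag c.P F k →
      ∃ F' : ℕ → AddSubmonoid (Fin c.m → ℤ), IsFlag c.P F' k ∧ F' k = F k ∧
        ∀ u ∈ c.U, ∀ y : bd X k, IsFlagPt c F k u y → IsFlagPt c F' k u (f y)) : LocallyIso f := by
  intro y
  obtain ⟨c, hc, u, hu, hux⟩ := hX.cover (bdProjIter X k y)
  obtain ⟨F, hF, hy⟩ := exists_flag_of_proj_eq hX hc hu y hux
  obtain ⟨F', hF', hk, hFF'⟩ := hf c hc F hF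
  obtain ⟨φ, hφ⟩ := exists_parametrizes hX hc hF y
  obtain ⟨h1, h2, -⟩ := hφ.eq_of_isFlagPt hX hc hu hy
  obtain ⟨ψ, he, hψ⟩ := exists_parametrizes_of_eq hX hc hF' hF.isFace hk y
  exact ⟨_, _, _, φ, ψ, hφ.1, he, ⟨_, h1, h2⟩, fun v hv =>
    (hFF' _ hv _ (hφ.2 v hv)).unique hX hc hF' hv (hψ v hv)⟩

/-- The other flag with the same face of codimension two. -/
theorem IsFlag.exists_other_flag {m : ℕ} {P : AddSubmonoid (Fin m → ℤ)} (hP : P.FG)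
    {F : ℕ → AddSubmonoid (Fin m → ℤ)} (hF : IsFlag P F 2) :
    ∃ F' : ℕ → AddSubmonoid (Fin m → ℤ), IsFlag P F' 2 ∧ F' 1 ≠ F 1 ∧ F' 2 = F 2 := by
  obtain ⟨K, hK, hKk, hFK, hne⟩ := hF.exists_other hP
  have hF1 := hF.mono (l := 1) (by omega)
  have hinf := hF.isFace.inf_eq hF1.isFace hK hF.hasCodim hF1.hasCodim hKk
    (hF.face 1 (by omega)).le hFK hne.symm
  refine ⟨_, isFlag_two hK hF1.isFace hKk (by rw [inf_comm, hinf]; exact hF.hasCodim), hne, ?_⟩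
  change K ⊓ F 1 = F 2
  rw [inf_comm, hinf]

theorem perm_fin_two (g : Equiv.Perm (Fin 2)) : g = 1 ∨ g = Equiv.swap 0 1 := by
  revert g
  decide

/-- The action of `S_2` given by an involution. -/
theorem exists_hom_of_involution {Y : Type u} {s : Equiv.Perm Y} (hs : ∀ y, s (s y) = y) :
    ∃ ρ : Equiv.Perm (Fin 2) →* Equiv.Perm Y, ρ (Equiv.swap 0 1) = s := by
  classical
  have hs' : s * s = 1 := Equiv.ext hs
  have hne : (Equiv.swap 0 1 : Equiv.Perm (Fin 2)) ≠ 1 := by decide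
  refine ⟨MonoidHom.mk' (fun g => if g = 1 then 1 else s) fun g h => ?_, by simp [hne]⟩
  rcases perm_fin_two g with rfl | rfl <;> rcases perm_fin_two h with rfl | rfl <;>
    simp [hne, hs', Equiv.swap_mul_self]

theorem orbitSetoid_iff {Y : Type u} {s : Equiv.Perm Y}
    {ρ : Equiv.Perm (Fin 2) →* Equiv.Perm Y} (hρ : ρ (Equiv.swap 0 1) = s) (y z : Y) :
    orbitSetoid ρ y z ↔ z = y ∨ z = s y := by
  constructor
  · rintro ⟨g, rfl⟩
    rcases perm_fin_two g with rfl | rfl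
    · exact Or.inl (by simp)
    · exact Or.inr (by rw [hρ])
  · rintro (rfl | rfl)
    · exact ⟨1, by simp⟩
    · exact ⟨Equiv.swap 0 1, by rw [hρ]⟩

theorem exists_action_secondBoundary (hX : IsGManifold X) :
    ∃ ρ : Equiv.Perm (Fin 2) →* Equiv.Perm (bd X 2),
      (∀ σ : bd X 2 → bd X 2, IsSwap X σ ↔ σ = ρ (Equiv.swap 0 1)) ∧
      (∀ g, IsDiffeo (X := bd X 2) (Y := bd X 2) (ρ g)) ∧
      (∀ g y, ρ g y = y → g = 1) ∧
      IsGManifold (quotient (bd X 2) (orbitSetoid ρ)) ∧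
      ∃ Ψ : corners X 2 ≃ quotient (bd X 2) (orbitSetoid ρ), IsDiffeo Ψ ∧
        ∀ (y : bd X 2) (x : X) (β₁ β₂ : LocalCorner X 1 x),
          Describes (X := X) y ⟨x, (β₁, β₂)⟩ →
          boundingSet X (Ψ.symm (quotientMk _ _ y)) = ⟨x, {β₁, β₂}⟩ := by
  obtain ⟨s, hs, hss, hne, hsF⟩ := exists_swap hX
  obtain ⟨ρ, hρ⟩ := exists_hom_of_involution hss
  have hY := isGManifold_bd hX 2
  have hsloc : LocallyIso (s : bd X 2 → bd X 2) := locallyIso_of_flags hX fun c hc F hF => by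
    obtain ⟨F', hF', h1, h2⟩ := hF.exists_other_flag (hX.isGChart c hc).weaklyToric.fg
    exact ⟨F', hF', h2, hsF c hc F F' hF hF' h1 h2⟩
  have hid : LocallyIso ((1 : Equiv.Perm (bd X 2)) : bd X 2 → bd X 2) :=
    locallyIso_of_flags hX fun c hc F hF => ⟨F, hF, rfl, fun u hu y hy => hy⟩
  have hr := orbitSetoid_iff hρ
  have hsm := hsloc.smooth hY hY
  obtain ⟨π, -, hπ⟩ := exists_naturalProj hX 2
  -- Points with the same image have flags with the same `F 2`; either `F 1` agrees too, or it is
  -- the other facet and the exchange relates the points.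
  have hfib : ∀ y z, π y = π z ↔ orbitSetoid ρ y z := by
    intro y z
    rw [hr]
    obtain ⟨c, hc, u, hu, hux⟩ := hX.cover (bdProjIter X 2 y)
    obtain ⟨F, hF, hy⟩ := exists_flag_of_proj_eq hX hc hu y hux
    have py := hπ c hc F hF u hu y hy
    constructor
    · intro h
      have hz : c.φ u = bdProjIter X 2 z := by
        obtain ⟨d, hd, w, hw, hwx⟩ := hX.cover (bdProjIter X 2 z)
        obtain ⟨G, hG, hz⟩ := exists_flag_of_proj_eq hX hd hw z hwx
        rw [h] at py
        exact py.1.trans ((hπ d hd G hG w hw z hz).1.symm.trans hwx)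
      obtain ⟨F', hF', hz'⟩ := exists_flag_of_proj_eq hX hc hu z hz
      have pz := hπ c hc F' hF' u hu z hz'
      rw [h] at py
      have h2 : F' 2 = F 2 := pz.2.face_unique hX hc hu pz.1 py.2
      by_cases h1 : F' 1 = F 1
      · refine Or.inl (hz'.unique hX hc hF' hu (hy.congr fun i hi => ?_))
        interval_cases i
        · rw [hF.zero, hF'.zero]
        · exact h1
        · exact h2
      · exact Or.inr (hz'.unique hX hc hF' hu (hsF c hc F F' hF hF' h1 h2 u hu y hy))
    · rintro (rfl | rfl)
      · rfl
      · obtain ⟨F', hF', h1, h2⟩ := hF.exists_other_flag (hX.isGChart c hc).weaklyToric.fg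
        have pz := hπ c hc F' hF' u hu _ (hsF c hc F F' hF hF' h1 h2 u hu y hy)
        rw [h2] at pz
        exact py.unique hX hc hu pz
  refine ⟨ρ, by rw [hρ]; exact hs, fun g => ?_, fun g y hg => ?_,
    isGManifold_quotient hY hsm hne hr, ?_⟩
  · rcases perm_fin_two g with rfl | rfl
    · rw [map_one]; exact hid.isDiffeo hY hY
    · rw [hρ]; exact hsloc.isDiffeo hY hY
  · rcases perm_fin_two g with rfl | rfl
    · rfl
    · rw [hρ] at hg
      exact absurd hg (hne y)
  obtain ⟨Ψ, hΨ, hΨπ⟩ := exists_equiv_quotient hY hsm hne hr (isGManifold_corners hX 2)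
    (locallyIso_naturalProj hπ hX) (surjective_naturalProj hπ hX) hfib
  refine ⟨Ψ, hΨ, fun y x β₁ β₂ h => ?_⟩
  rw [hΨπ]
  obtain ⟨c, hc, u, hu, hux⟩ := hX.cover (bdProjIter X 2 y)
  obtain ⟨F, hF, hy⟩ := exists_flag_of_proj_eq hX hc (k := 2) hu y hux
  have hx : c.φ u = x := hux.trans h.proj
  subst hx
  obtain ⟨K₁, h₁⟩ := β₁.exists_face hX hc hu rfl
  obtain ⟨K₂, h₂⟩ := β₂.exists_face hX hc hu rfl
  obtain ⟨rfl, hne', hle⟩ := (describes_iff hX hc hF hu hy h₁ h₂).1 h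
  obtain ⟨hp₁, hp₂⟩ := hπ c hc F hF u hu y hy
  generalize π y = p at hp₁ hp₂
  obtain ⟨x, γ⟩ := p
  change c.φ u = x at hp₁
  change LocalCorner X 2 x at γ
  subst hp₁
  change (⟨c.φ u, {β | InClosure γ β}⟩ : Σ x : X, Set (LocalCorner X 1 x)) = _
  rw [setOf_inClosure_eq hX hc hu hp₂ h₁ h₂ hne'.symm (hF.face 1 (by omega)).le hle]

end Involution

/-! ### Maps of boundaries induced by diffeomorphisms -/

section BoundaryMap

variable {Y : GSpace.{u}}

/-- The image of a local corner component under a homeomorphism which preserves the depth. -/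
def LocalCorner.map (h : Y ≃ₜ Y) {k : ℕ} (hk : ∀ x, h x ∈ depthStratum Y k ↔ x ∈ depthStratum Y k)
    {x : Y} (β : LocalCorner Y k x) : LocalCorner Y k (h x) where
  comp V := h '' (β.comp (h ⁻¹' V))
  isComponent V hV := by
    obtain ⟨y, hy, hyV⟩ := β.isComponent (h ⁻¹' V) ⟨hV.1.preimage h.continuous, hV.2⟩
    refine ⟨h y, ⟨hy.1, (hk y).2 hy.2⟩, ?_⟩
    rw [hyV, h.image_connectedComponentIn hy]
    congr 1
    ext z
    constructor
    · rintro ⟨w, hw, rfl⟩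
      exact ⟨hw.1, (hk w).2 hw.2⟩
    · rintro ⟨hz, hz'⟩
      obtain ⟨w, rfl⟩ := h.surjective z
      exact ⟨w, ⟨hz, (hk w).1 hz'⟩, rfl⟩
  mem_closure V hV := by
    rw [← h.image_closure]
    exact mem_image_of_mem h (β.mem_closure _ ⟨hV.1.preimage h.continuous, hV.2⟩)
  compat V V' hV hV' := by
    rw [← image_inter h.injective, ← h.image_closure]
    exact mem_image_of_mem h (β.compat _ _ ⟨hV.1.preimage h.continuous, hV.2⟩
      ⟨hV'.1.preimage h.continuous, hV'.2⟩)
  junk V hV := by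
    rw [β.junk, image_empty]
    exact fun hV' => hV ⟨h.isOpen_preimage.1 hV'.1, hV'.2⟩

/-- The map of boundaries induced by a diffeomorphism exists and is unique. -/
theorem exists_boundaryMap (hY : IsGManifold Y) {e : Equiv.Perm Y} (he : LocallyIso (e : Y → Y)) :
    ∃ g : boundary Y → boundary Y, ∀ σ, IsBoundaryMap e σ ↔ σ = g := by
  let h : Y ≃ₜ Y := ⟨e, he.continuous hY hY, he.symm.continuous hY hY⟩
  have hk : ∀ x, h x ∈ depthStratum Y 1 ↔ x ∈ depthStratum Y 1 := fun x =>
    he.mem_depthStratum_iff hY hY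
  refine ⟨fun p => (⟨h (Sigma.fst (β := LocalCorner Y 1) p), LocalCorner.map h hk
    (Sigma.snd (β := LocalCorner Y 1) p)⟩ : CornerSet Y 1), fun σ => ⟨fun hσ => ?_, ?_⟩⟩
  · funext p
    obtain ⟨x, β⟩ := p
    obtain ⟨β', h1, h2⟩ := hσ x β
    refine h1.trans ?_
    have : β' = LocalCorner.map h hk β := LocalCorner.ext (funext fun V => by
      by_cases hV : IsOpenNhd V (e x)
      · exact h2 V hV
      · rw [β'.junk V hV]
        exact ((LocalCorner.map h hk β).junk V hV).symm)
    rw [this]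
    rfl
  · rintro rfl x β
    exact ⟨LocalCorner.map h hk β, rfl, fun V _ => rfl⟩

theorem Represents.of_comp_eq {e : Y → Y} (he : Continuous e) {k : ℕ} {x : Y}
    {β : LocalCorner Y k x} {β' : LocalCorner Y k (e x)}
    (hβ : ∀ V, IsOpenNhd V (e x) → β'.comp V = e '' (β.comp (e ⁻¹' V))) {S T : Set Y}
    (hS : Represents β S) (hST : ∀ y ∈ S, e y ∈ T) : Represents β' T := by
  intro V hV
  have h1 := hS (e ⁻¹' V) ⟨hV.1.preimage he, hV.2⟩
  refine closure_mono ?_ (image_closure_subset_closure_image he (mem_image_of_mem e h1))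
  rintro _ ⟨y, ⟨hy, hyS⟩, rfl⟩
  exact ⟨hβ V hV ▸ mem_image_of_mem e hy, hST y hyS⟩

variable {X : GSpace.{u}}

/-- The induced map carries components to their images, so it changes the first `k` faces as `e`
does and leaves the last face alone. -/
theorem IsBoundaryMap.isFlagPt {k : ℕ} {e : bd X k → bd X k} (he : Continuous e)
    {g : bd X (k + 1) → bd X (k + 1)} (hg : IsBoundaryMap e g) {c : Chart X}
    {F F' : ℕ → AddSubmonoid (Fin c.m → ℤ)} (hk : F' (k + 1) = F (k + 1))
    (hF : ∀ u ∈ c.U, ∀ y : bd X k, IsFlagPt c F k u y → IsFlagPt c F' k u (e y)) {u : XP c.P}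
    (hu : u ∈ c.U) {y : bd X (k + 1)} (hy : IsFlagPt c F (k + 1) u y) :
    IsFlagPt c F' (k + 1) u (g y) := by
  obtain ⟨x, β⟩ := y
  change LocalCorner (bd X k) 1 x at β
  obtain ⟨β', h1, h2⟩ := hg x β
  rw [h1]
  refine ⟨hF u hu x hy.1, ?_⟩
  refine Represents.of_comp_eq he h2 hy.2 ?_
  rintro z ⟨v, hv, hvF, hz⟩
  exact ⟨v, hv, hvF.trans hk.symm, hF v hv z hz⟩

end BoundaryMap

/-! ### The involutions of iterated boundaries -/

section SwapAt

variable {X : GSpace.{u}} {j k n : ℕ}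

theorem IsFlag.shift {m : ℕ} {P : AddSubmonoid (Fin m → ℤ)} {F : ℕ → AddSubmonoid (Fin m → ℤ)}
    (hF : IsFlag P F n) (hj : j + k ≤ n) : IsFlag (F j) (fun i => F (j + i)) k :=
  ⟨rfl, fun i hi => hF.face (j + i) (by omega), fun i hi => hF.codim (j + i) (by omega)⟩

/-- Inside `F j` the face `F (j + 2)` has codimension two, hence lies in a second facet of `F j`,
which can replace `F (j + 1)`. -/
theorem IsFlag.exists_update {m : ℕ} {P : AddSubmonoid (Fin m → ℤ)} (hP : P.FG)
    {F : ℕ → AddSubmonoid (Fin m → ℤ)} (hF : IsFlag P F n) (hj : j + 2 ≤ n) :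
    ∃ F' : ℕ → AddSubmonoid (Fin m → ℤ), IsFlag P F' n ∧ (∀ i, i ≠ j + 1 → F' i = F i) ∧
      F' (j + 1) ≠ F (j + 1) := by
  obtain ⟨G, hG, h1, h2⟩ := (hF.shift hj).exists_other_flag
    ((hF.mono (l := j) (by omega)).isFace.fg hP)
  change G 1 ≠ F (j + 1) at h1
  change G 2 = F (j + 2) at h2
  have hne : ∀ i, i ≠ j + 1 → Function.update F (j + 1) (G 1) i = F i := fun i hi =>
    Function.update_of_ne hi _ _
  have hs : Function.update F (j + 1) (G 1) (j + 1) = G 1 := Function.update_self _ _ _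
  have key : ∀ i < n, IsFace (Function.update F (j + 1) (G 1) (i + 1))
      (Function.update F (j + 1) (G 1) i) ∧ HasCodim (Function.update F (j + 1) (G 1) (i + 1))
      (Function.update F (j + 1) (G 1) i) 1 := by
    intro i hi
    by_cases h3 : i = j
    · subst h3
      rw [hs, hne i (by omega), ← show G 0 = F i from hG.zero]
      exact ⟨hG.face 0 (by omega), hG.codim 0 (by omega)⟩
    · by_cases h4 : i = j + 1
      · subst h4
        rw [hs, hne (j + 1 + 1) (by omega), ← show G 2 = F (j + 1 + 1) from h2]
        exact ⟨hG.face 1 (by omega), hG.codim 1 (by omega)⟩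
      · rw [hne i h4, hne (i + 1) (by omega)]
        exact ⟨hF.face i hi, hF.codim i hi⟩
  refine ⟨Function.update F (j + 1) (G 1), ⟨(hne 0 (by omega)).trans hF.zero,
    fun i hi => (key i hi).1, fun i hi => (key i hi).2⟩, hne, by rwa [hs]⟩

/-- `f` exchanges the two choices for the face number `j + 1` in flags of faces. -/
def ExchangesFlags (X : GSpace.{u}) (j n : ℕ) (f : bd X n → bd X n) : Prop :=
  ∀ c ∈ X.atlas, ∀ F F' : ℕ → AddSubmonoid (Fin c.m → ℤ), IsFlag c.P F n → IsFlag c.P F' n →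
    (∀ i ≤ n, i ≠ j + 1 → F' i = F i) → F' (j + 1) ≠ F (j + 1) → ∀ u ∈ c.U, ∀ y : bd X n,
      IsFlagPt c F n u y → IsFlagPt c F' n u (f y)

namespace ExchangesFlags

variable {f : bd X n → bd X n}

theorem involutive (hX : IsGManifold X) (hj : j + 2 ≤ n) (hf : ExchangesFlags X j n f) :
    Function.Involutive f := by
  intro y
  obtain ⟨c, hc, u, hu, hux⟩ := hX.cover (bdProjIter X n y)
  obtain ⟨F, hF, hy⟩ := exists_flag_of_proj_eq hX hc hu y hux
  obtain ⟨F', hF', h1, h2⟩ := hF.exists_update (hX.isGChart c hc).weaklyToric.fg hj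
  exact (hf c hc F' F hF' hF (fun i _ hi => (h1 i hi).symm) h2.symm u hu _
    (hf c hc F F' hF hF' (fun i _ hi => h1 i hi) h2 u hu y hy)).unique hX hc hF hu hy

theorem locallyIso (hX : IsGManifold X) (hj : j + 2 ≤ n) (hf : ExchangesFlags X j n f) :
    LocallyIso f :=
  locallyIso_of_flags hX fun c hc F hF => by
    obtain ⟨F', hF', h1, h2⟩ := hF.exists_update (hX.isGChart c hc).weaklyToric.fg hj
    exact ⟨F', hF', h1 n (by omega), hf c hc F F' hF hF' (fun i _ hi => h1 i hi) h2⟩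

end ExchangesFlags

section Shift

variable {c : Chart X} {F G : ℕ → AddSubmonoid (Fin c.m → ℤ)}

theorem isFlagPt_shift_one (hX : IsGManifold X) (hc : c ∈ X.atlas) (hF : IsFlag c.P F k)
    {φ : XP (F k) → bd X k} (hφ : Parametrizes c hF φ) (hG : ∀ i ≤ k, G i = F i)
    (hle : G (k + 1) ≤ F k) {u : XP c.P} (hu : u ∈ c.U) (huF : supp u ≤ F k)
    {y : bd X (k + 1)} :
    IsFlagPt c G (k + 1) u y ↔ IsFlagPt (X := bd X k) (flagChart c hF φ) (fun i => G (k + i)) 1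
      (restr hF.isFace.le u) y := by
  have h1 := inclFace_restr hF.isFace huF
  have h2 := hφ.2 (restr hF.isFace.le u) (by rwa [h1])
  rw [h1] at h2
  have h3 : {z | ∃ v ∈ c.U, supp v = G (k + 1) ∧ IsFlagPt c G k v z} =
      (flagChart c hF φ).stratum (G (k + 1)) := by
    rw [hφ.stratum_eq' hX hc hle]
    simp only [isFlagPt_congr hG]
  refine Iff.trans (and_congr ⟨fun h => ?_, fun h => ?_⟩ ?_)
    (isFlagPt_one_iff (X := bd X k) (c := flagChart c hF φ) (F := fun i => G (k + i))
      (u := restr hF.isFace.le u) (y := y)).symm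
  · exact h2.unique hX hc hF hu ((isFlagPt_congr hG).1 h)
  · have h' : φ (restr hF.isFace.le u) = bdProj (bd X k) y := h
    rw [← h']
    exact h2.congr hG
  · exact ⟨fun h => h3 ▸ h, fun h => h3 ▸ h⟩

/-- This identifies `∂^{k+2} X` with `∂²(∂^k X)` at the level of flags. The flag `G` need only agree
with `F` up to `k`, so one chart of `∂^k X` serves both flags related by an exchange. -/
theorem isFlagPt_shift_two (hX : IsGManifold X) (hc : c ∈ X.atlas) (hF : IsFlag c.P F k)
    {φ : XP (F k) → bd X k} (hφ : Parametrizes c hF φ) (hG : ∀ i ≤ k, G i = F i)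
    (hle : G (k + 1) ≤ F k) (hle' : G (k + 2) ≤ F k) {u : XP c.P}
    (hu : u ∈ c.U) (huF : supp u ≤ F k) {y : bd X (k + 2)} :
    IsFlagPt c G (k + 2) u y ↔ IsFlagPt (X := bd X k) (flagChart c hF φ) (fun i => G (k + i)) 2
      (restr hF.isFace.le u) y := by
  have hset : {z | ∃ v ∈ c.U, supp v = G (k + 2) ∧ IsFlagPt c G (k + 1) v z} =
      {z | ∃ v ∈ (flagChart c hF φ).U, supp v = G (k + 2) ∧
        IsFlagPt (X := bd X k) (flagChart c hF φ) (fun i => G (k + i)) 1 v z} := by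
    ext z
    constructor
    · rintro ⟨v, hv, hvF, hz⟩
      have hle2 := hvF.le.trans hle'
      have h1 := inclFace_restr hF.isFace hle2
      refine ⟨restr hF.isFace.le v, ?_, ?_,
        (isFlagPt_shift_one hX hc hF hφ hG hle hv hle2).1 hz⟩
      · change inclFace _ _ ∈ c.U
        rwa [h1]
      · rw [← supp_inclFace hF.isFace, h1, hvF]
    · rintro ⟨v, hv, hvF, hz⟩
      refine ⟨inclFace hF.isFace v, hv, (supp_inclFace _ v).trans hvF,
        (isFlagPt_shift_one hX hc hF hφ hG hle hv (supp_inclFace_le _ v)).2 ?_⟩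
      rwa [restr_inclFace]
  refine and_congr (isFlagPt_shift_one hX hc hF hφ hG hle hu huF) ?_
  exact ⟨fun h => hset ▸ h, fun h => hset ▸ h⟩

end Shift

/-- The description of the exchange on `∂²(∂^k X)` is applied in a flag chart of `∂^k X`, whose
monoid is `F k`. -/
theorem exists_swap_exchangesFlags (hX : IsGManifold X) (k : ℕ) :
    ∃ f : bd X (k + 2) → bd X (k + 2), (∀ σ, IsSwap (bd X k) σ ↔ σ = f) ∧
      ExchangesFlags X k (k + 2) f := by
  obtain ⟨s, hs, -, -, hsF⟩ := exists_swap (isGManifold_bd hX k)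
  refine ⟨s, hs, fun c hc F F' hF hF' h1 h2 u hu y hy => ?_⟩
  have hFk := hF.mono (l := k) (by omega)
  have hle := (hF.face k (by omega)).le
  have hle2 := (hF.face (k + 1) (by omega)).le.trans hle
  have hF'k := h1 k (by omega) (by omega)
  have hle' : F' (k + 1) ≤ F k := hF'k ▸ (hF'.face k (by omega)).le
  have huF := (hy.supp_le hX hc hF hu).trans hle2
  obtain ⟨φ, hφ⟩ := exists_parametrizes hX hc hFk (bdProj (bd X k) (bdProj (bd X (k + 1)) y))
  obtain ⟨e1, -, -⟩ := hφ.eq_of_isFlagPt hX hc hu hy.1.1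
  have hG : ∀ i ≤ k, F' i = F i := fun i hi => h1 i (by omega) (by omega)
  have hle2' : F' (k + 2) ≤ F k := (h1 (k + 2) le_rfl (by omega)).le.trans hle2
  have hG2 : IsFlag (F k) (fun i => F' (k + i)) 2 := hF'k ▸ hF'.shift (k := 2) (by omega)
  refine (isFlagPt_shift_two hX hc hFk hφ hG hle' hle2' hu huF).2 ?_
  exact hsF _ hφ.1 (fun i => F (k + i)) _ (hF.shift (k := 2) (by omega)) hG2 h2
    (h1 (k + 2) le_rfl (by omega)) _ e1 y
    ((isFlagPt_shift_two hX hc hFk hφ (fun _ _ => rfl) hle hle2 hu huF).1 hy)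

/-- The `j`-th involution of `∂^{k+2} X`. -/
theorem exists_isSwapAt (hX : IsGManifold X) (hjk : j ≤ k) :
    ∃ f : bd X (k + 2) → bd X (k + 2), (∀ σ, IsSwapAt X j (k + 2) σ ↔ σ = f) ∧
      ExchangesFlags X j (k + 2) f := by
  induction k with
  | zero =>
    obtain rfl : j = 0 := by omega
    obtain ⟨f, hf, hfF⟩ := exists_swap_exchangesFlags hX 0
    refine ⟨f, fun σ => ⟨?_, fun h => Or.inl ⟨rfl, (hf σ).2 h⟩⟩, hfF⟩
    rintro (⟨-, h⟩ | ⟨h, -⟩)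
    · exact (hf σ).1 h
    · exact absurd h (lt_irrefl 0)
  | succ k ih =>
    rcases hjk.eq_or_lt with rfl | hjk
    · obtain ⟨f, hf, hfF⟩ := exists_swap_exchangesFlags hX (k + 1)
      refine ⟨f, fun σ => ⟨?_, fun h => Or.inl ⟨rfl, (hf σ).2 h⟩⟩, hfF⟩
      rintro (⟨-, h⟩ | ⟨h, -⟩)
      · exact (hf σ).1 h
      · exact absurd h (lt_irrefl _)
    · obtain ⟨f, hf, hfF⟩ := ih (by omega)
      have hinv := hfF.involutive hX (by omega)
      -- Being an involution makes `f` a bijection, as the construction of the induced map needs a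
      -- homeomorphism preserving the depth.
      obtain ⟨g, hg⟩ := exists_boundaryMap (isGManifold_bd hX (k + 2)) (e := hinv.toPerm)
        (hfF.locallyIso hX (by omega))
      refine ⟨g, fun σ => ⟨?_, fun h => Or.inr ⟨hjk, f, (hf f).2 rfl, (hg σ).2 h⟩⟩, ?_⟩
      · rintro (⟨h, -⟩ | ⟨-, τ, h, hτ⟩)
        · exact absurd h hjk.ne
        · obtain rfl := (hf τ).1 h
          exact (hg σ).1 hτ
      · intro c hc F F' hF hF' h1 h2 u hu y hy
        refine IsBoundaryMap.isFlagPt ((hfF.locallyIso hX (by omega)).continuous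
          (isGManifold_bd hX _) (isGManifold_bd hX _)) ((hg g).2 rfl)
          (h1 (k + 3) le_rfl (by omega)) ?_ hu hy
        exact hfF c hc F F' (hF.mono (by omega)) (hF'.mono (by omega))
          (fun i hi => h1 i (by omega)) h2

theorem exists_perm_isSwapAt (hX : IsGManifold X) (m : ℕ) :
    ∃ s : Fin (m + 1) → Equiv.Perm (bd X (m + 2)),
      (∀ (j : Fin (m + 1)) (σ : bd X (m + 2) → bd X (m + 2)),
        IsSwapAt X j (m + 2) σ ↔ σ = s j) ∧
      ∀ j : Fin (m + 1), ExchangesFlags X j (m + 2) (s j) := by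
  choose f hf hfF using fun j : Fin (m + 1) => exists_isSwapAt hX (Nat.lt_succ_iff.1 j.2)
  exact ⟨fun j => ((hfF j).involutive hX (by omega)).toPerm, hf, hfF⟩

end SwapAt

/-! ### Presentation of the symmetric group -/

section Coxeter

variable {G : Type u} [Group G] {t : ℕ → G} {n : ℕ}

/-- The product `t i * t (i + 1) * ⋯ * t (i + l - 1)`. -/
def ascProd (t : ℕ → G) : ℕ → ℕ → G
  | _, 0 => 1
  | i, l + 1 => t i * ascProd t (i + 1) l

/-- The relations of the symmetric group between `t 0, …, t (n - 1)`. -/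
structure BraidRelations (t : ℕ → G) (n : ℕ) : Prop where
  mul_self : ∀ i < n, t i * t i = 1
  braid : ∀ i, i + 1 < n → t i * t (i + 1) * t i = t (i + 1) * t i * t (i + 1)
  comm : ∀ i j, i + 1 < j → j < n → t i * t j = t j * t i

namespace BraidRelations

theorem mono (h : BraidRelations t (n + 1)) : BraidRelations t n :=
  ⟨fun i hi => h.1 i (by omega), fun i hi => h.2 i (by omega),
    fun i j hi hj => h.3 i j hi (by omega)⟩

theorem mul_ascProd_of_lt (h : BraidRelations t n) (l : ℕ) : ∀ {i j : ℕ}, j + 1 < i → i + l ≤ n →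
    t j * ascProd t i l = ascProd t i l * t j := by
  induction l with
  | zero => intro i j _ _; simp [ascProd]
  | succ l ih =>
    intro i j hj hi
    rw [ascProd, ← mul_assoc, h.comm j i hj (by omega), mul_assoc, ih (by omega) (by omega),
      mul_assoc]

/-- Commuting past the early factors, the generator meets `t j * t (j + 1)`; the braid relation
lowers its index by one, and it then commutes with the remaining factors. -/
theorem mul_ascProd_of_gt (h : BraidRelations t n) (l : ℕ) : ∀ {i j : ℕ}, i ≤ j →
    j + 1 < i + l → i + l ≤ n → t (j + 1) * ascProd t i l = ascProd t i l * t j := by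
  induction l with
  | zero => intro i j _ _ _; omega
  | succ l ih =>
    intro i j hij hj hi
    rcases hij.eq_or_lt with rfl | hij
    · obtain ⟨l, rfl⟩ : ∃ l', l = l' + 1 := ⟨l - 1, by omega⟩
      have h1 := h.mul_ascProd_of_lt l (i := i + 1 + 1) (j := i) (by omega) (by omega)
      calc t (i + 1) * ascProd t i (l + 1 + 1)
          = t (i + 1) * t i * t (i + 1) * ascProd t (i + 1 + 1) l := by
            simp only [ascProd, mul_assoc]
        _ = t i * t (i + 1) * (t i * ascProd t (i + 1 + 1) l) := by
            rw [← h.braid i (by omega)]; simp only [mul_assoc]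
        _ = ascProd t i (l + 1 + 1) * t i := by
            rw [h1]; simp only [ascProd, mul_assoc]
    · rw [ascProd, ← mul_assoc, ← h.comm i (j + 1) (by omega) (by omega), mul_assoc,
        ih (by omega) (by omega) (by omega), mul_assoc]

/-- Coset enumeration: every element generated by `t 0, …, t n` is `t i ⋯ t n` times an element
generated by the first `n` generators. There are `n + 2` choices of `i`, the last being the empty
product, so the bound is multiplied by `n + 2`. -/
theorem exists_finset (h : BraidRelations t n) : ∃ T : Finset G, T.card ≤ (n + 1).factorial ∧
    (Subgroup.closure (t '' Iio n) : Set G) ⊆ T := by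
  classical
  induction n with
  | zero => exact ⟨{1}, by simp, by simp⟩
  | succ n ih =>
    obtain ⟨T, hT, hK⟩ := ih h.mono
    refine ⟨(Finset.range (n + 2) ×ˢ T).image fun p => ascProd t p.1 (n + 1 - p.1) * p.2, ?_, ?_⟩
    · refine Finset.card_image_le.trans ?_
      rw [Finset.card_product, Finset.card_range, Nat.factorial_succ]
      exact Nat.mul_le_mul_left _ hT
    · have hmem : ∀ j < n, t j ∈ Subgroup.closure (t '' Iio n) := fun j hj =>
        Subgroup.subset_closure ⟨j, hj, rfl⟩
      -- Multiplying by `t j` on the left lengthens the product if `j + 1 = i`, shortens it if `j =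
      -- i`, and otherwise passes through as `t j` or `t (j - 1)` into the smaller subgroup.
      have hstep : ∀ j < n + 1, ∀ i ≤ n + 1, ∀ k ∈ Subgroup.closure (t '' Iio n),
          ∃ i' ≤ n + 1, ∃ k' ∈ Subgroup.closure (t '' Iio n),
            t j * (ascProd t i (n + 1 - i) * k) = ascProd t i' (n + 1 - i') * k' := by
        intro j hj i hi k hk
        rcases lt_trichotomy j i with hji | rfl | hji
        · rcases (Nat.succ_le_of_lt hji).eq_or_lt with rfl | hji
          · refine ⟨j, hj.le, k, hk, ?_⟩
            rw [show n + 1 - j = n + 1 - (j + 1) + 1 by omega, ascProd, mul_assoc]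
          · refine ⟨i, hi, t j * k, mul_mem (hmem j (by omega)) hk, ?_⟩
            rw [← mul_assoc, h.mul_ascProd_of_lt _ hji (by omega), mul_assoc]
        · refine ⟨j + 1, hj, k, hk, ?_⟩
          rw [show n + 1 - j = n + 1 - (j + 1) + 1 by omega, ascProd, ← mul_assoc, ← mul_assoc,
            h.mul_self j hj, one_mul]
        · obtain ⟨j, rfl⟩ : ∃ j', j = j' + 1 := ⟨j - 1, by omega⟩
          refine ⟨i, hi, t j * k, mul_mem (hmem j (by omega)) hk, ?_⟩
          rw [← mul_assoc, h.mul_ascProd_of_gt _ (by omega) (by omega) (by omega), mul_assoc]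
      have key : ∀ g ∈ Subgroup.closure (t '' Iio (n + 1)), ∃ i ≤ n + 1,
          ∃ k ∈ Subgroup.closure (t '' Iio n), g = ascProd t i (n + 1 - i) * k := by
        intro g hg
        induction hg using Subgroup.closure_induction_left with
        | one => exact ⟨n + 1, le_rfl, 1, one_mem _, by simp [ascProd]⟩
        | mul_left x hx y hy ih =>
          obtain ⟨j, hj, rfl⟩ := hx
          obtain ⟨i, hi, k, hk, rfl⟩ := ih
          exact hstep j hj i hi k hk
        | inv_mul_cancel x hx y hy ih =>
          obtain ⟨j, hj, rfl⟩ := hx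
          obtain ⟨i, hi, k, hk, rfl⟩ := ih
          rw [inv_eq_of_mul_eq_one_left (h.mul_self j hj)]
          exact hstep j hj i hi k hk
      intro g hg
      obtain ⟨i, hi, k, hk, rfl⟩ := key g hg
      exact Finset.mem_coe.2 (Finset.mem_image.2
        ⟨(i, k), Finset.mem_product.2 ⟨Finset.mem_range.2 (by omega), hK hk⟩, rfl⟩)

end BraidRelations

theorem closure_adjSwap (m : ℕ) : Subgroup.closure (range (adjSwap (m := m))) = ⊤ := by
  rw [eq_top_iff, ← Subgroup.toSubmonoid_le, Subgroup.top_toSubmonoid]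
  refine (Equiv.Perm.mclosure_swap_castSucc_succ (m + 1)).ge.trans ?_
  rw [Submonoid.closure_le]
  exact Subgroup.subset_closure

theorem swap_braid {α : Type*} [DecidableEq α] {a b c : α} (hab : a ≠ b) (hac : a ≠ c)
    (hbc : b ≠ c) : Equiv.swap a b * Equiv.swap b c * Equiv.swap a b =
      Equiv.swap b c * Equiv.swap a b * Equiv.swap b c := by
  rw [Equiv.swap_mul_swap_mul_swap hab hac, Equiv.swap_comm a b, Equiv.swap_comm b c,
    Equiv.swap_mul_swap_mul_swap hbc.symm hac.symm, Equiv.swap_comm]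

theorem coxeterRelations_adjSwap (m : ℕ) : CoxeterRelations (adjSwap (m := m)) := by
  refine ⟨fun j => Equiv.swap_mul_self _ _, fun i j hij => ?_, fun i j hij => ?_⟩
  · have h1 : i.succ = j.castSucc := Fin.ext hij
    have h2 : i.castSucc ≠ j.castSucc := fun h => by
      have := congrArg Fin.val h
      simp at this
      omega
    have h3 : i.castSucc ≠ j.succ := fun h => by
      have := congrArg Fin.val h
      simp at this
      omega
    have h4 : j.castSucc ≠ j.succ := Fin.castSucc_lt_succ.ne
    unfold adjSwap
    rw [h1, swap_braid h2 h3 h4]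
  · unfold adjSwap
    refine (Equiv.Perm.Disjoint.commute (Equiv.Perm.disjoint_swap_swap ?_)).eq
    simp [Fin.ext_iff]
    omega

theorem CoxeterRelations.map {H : Type v} [Group H] {m : ℕ} {s : Fin (m + 1) → G}
    (h : CoxeterRelations s) (f : G →* H) : CoxeterRelations fun j => f (s j) :=
  ⟨fun j => by rw [← map_mul, h.1 j, map_one],
    fun i j hij => by simp only [← map_mul, h.2.1 i j hij],
    fun i j hij => by simp only [← map_mul, h.2.2 i j hij]⟩

/-- The pairs `(adjSwap j, s j)` satisfy the relations, so they generate a subgroup of the product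
with at most `(m + 2)!` elements. It surjects onto the symmetric group, hence is the graph of a
homomorphism. -/
theorem CoxeterRelations.exists_hom {m : ℕ} {s : Fin (m + 1) → G} (h : CoxeterRelations s) :
    ∃ ρ : Equiv.Perm (Fin (m + 2)) →* G, ∀ j, ρ (adjSwap j) = s j := by
  let t : Fin (m + 1) → Equiv.Perm (Fin (m + 2)) × G := fun j => (adjSwap j, s j)
  have hc := coxeterRelations_adjSwap m
  let t' : ℕ → Equiv.Perm (Fin (m + 2)) × G := fun j => if hj : j < m + 1 then t ⟨j, hj⟩ else 1
  have ht' : ∀ j (hj : j < m + 1), t' j = t ⟨j, hj⟩ := fun j hj => dif_pos hj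
  have hb : BraidRelations t' (m + 1) := by
    refine ⟨fun i hi => ?_, fun i hi => ?_, fun i j hij hj => ?_⟩
    · rw [ht' i hi]
      exact Prod.ext (hc.1 _) (h.1 _)
    · rw [ht' i (by omega), ht' _ hi]
      exact Prod.ext (hc.2.1 _ _ rfl) (h.2.1 _ _ rfl)
    · rw [ht' i (by omega), ht' j hj]
      exact Prod.ext (hc.2.2 _ _ hij) (h.2.2 _ _ hij)
  obtain ⟨T, hT, hsub⟩ := hb.exists_finset
  let H := Subgroup.closure (t' '' Iio (m + 1))
  have htH : ∀ j, t j ∈ H := fun j => Subgroup.subset_closure ⟨j, j.2, ht' j j.2⟩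
  have hfin : Finite H := (T.finite_toSet.subset hsub).to_subtype
  have hcard : Nat.card H ≤ (m + 2).factorial := by
    refine le_trans ?_ hT
    have := Nat.card_mono T.finite_toSet hsub
    simpa using this
  let f : H →* Equiv.Perm (Fin (m + 2)) := (MonoidHom.fst _ _).comp H.subtype
  have hsurj : Function.Surjective f := by
    rw [← MonoidHom.range_eq_top, eq_top_iff, ← closure_adjSwap, Subgroup.closure_le]
    rintro _ ⟨j, rfl⟩
    exact ⟨⟨t j, htH j⟩, rfl⟩
  have hbij : Function.Bijective f := hsurj.bijective_of_nat_card_le (by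
    rw [Nat.card_perm, Nat.card_fin]
    exact hcard)
  let e := MulEquiv.ofBijective f hbij
  refine ⟨((MonoidHom.snd _ _).comp H.subtype).comp e.symm.toMonoidHom, fun j => ?_⟩
  have h1 : e.symm (adjSwap j) = ⟨t j, htH j⟩ := e.symm_apply_eq.2 rfl
  change (e.symm (adjSwap j)).1.2 = s j
  rw [h1]

theorem bijOn_coxeterRelations (m : ℕ) (Y : Type v) : BijOn
    (fun (ρ : Equiv.Perm (Fin (m + 2)) →* Equiv.Perm Y) (j : Fin (m + 1)) => ρ (adjSwap j))
    univ {s | CoxeterRelations s} := by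
  refine ⟨fun ρ _ => (coxeterRelations_adjSwap m).map ρ, fun ρ _ ρ' _ h => ?_, fun s hs => ?_⟩
  · refine MonoidHom.eq_of_eqOn_dense (closure_adjSwap m) ?_
    rintro _ ⟨j, rfl⟩
    exact congrFun h j
  · obtain ⟨ρ, hρ⟩ := CoxeterRelations.exists_hom hs
    exact ⟨ρ, mem_univ _, funext hρ⟩

end Coxeter

/-! ### Ordinary corners -/

section OrdinaryCorners

/-- The flag `F 0, …, F n` of faces of `P` is given by successive vanishing of the coordinates
`b 0, …, b (n - 1)` in `I`. -/
structure IsCoordFlag {m : ℕ} (P : AddSubmonoid (Fin m → ℤ)) (I : Set (Fin m))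
    (F : ℕ → AddSubmonoid (Fin m → ℤ)) (n : ℕ) (b : ℕ → Fin m) : Prop where
  isFlag : IsFlag P F n
  mem : ∀ l < n, b l ∈ I
  mem_iff : ∀ i ≤ n, ∀ p, p ∈ F i ↔ p ∈ P ∧ ∀ l < i, p (b l) = 0

variable {m n : ℕ} {P : AddSubmonoid (Fin m → ℤ)} {I : Set (Fin m)}

/-- A face of codimension one of a face of an orthant is given by the vanishing of a
coordinate. -/
theorem exists_coord_of_codim_one (hP : ∀ p, p ∈ P ↔ ∀ i ∈ I, 0 ≤ p i)
    {Q K : AddSubmonoid (Fin m → ℤ)} (hQ : IsFace Q P) {J : Set (Fin m)}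
    (hQJ : ∀ p, p ∈ Q ↔ p ∈ P ∧ ∀ i ∈ J, p i = 0) (hK : IsFace K Q) (hk : HasCodim K Q 1) :
    ∃ i ∈ I, ∀ p, p ∈ K ↔ p ∈ Q ∧ p i = 0 := by
  classical
  have hnn : ∀ {p}, p ∈ Q → ∀ i ∈ I, 0 ≤ p i := fun hp => (hP _).1 (hQ.le hp)
  -- Otherwise each coordinate in `I` not identically zero on `Q` is positive somewhere on `K`, and
  -- a sum of such points is positive in all of them. A multiple of the sum dominates any `q ∈ Q` in
  -- these coordinates, so `q ∈ K` and `K = Q`, contrary to codimension one.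
  have hex : ∃ i ∈ I, (∀ p ∈ K, p i = 0) ∧ ∃ q ∈ Q, q i ≠ 0 := by
    by_contra! hcon
    have h1 : ∀ i, ∃ p ∈ K, i ∈ I → (∃ q ∈ Q, q i ≠ 0) → 1 ≤ p i := by
      intro i
      by_cases h : i ∈ I ∧ ∃ q ∈ Q, q i ≠ 0
      · obtain ⟨hi, q, hq, hqi⟩ := h
        by_contra! hcon'
        refine hqi (hcon i hi (fun p hp => ?_) q hq)
        have h2 := (hcon' p hp).2.2
        have h3 := hnn (hK.le hp) i hi
        omega
      · exact ⟨0, K.zero_mem, fun hi hq => absurd ⟨hi, hq⟩ h⟩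
    choose p hpK hp using h1
    have hsum : ∑ i, p i ∈ K := sum_mem fun i _ => hpK i
    have hle : ∀ i ∈ I, (∃ q ∈ Q, q i ≠ 0) → 1 ≤ (∑ l, p l) i := by
      intro i hi hq
      rw [Finset.sum_apply]
      exact (hp i hi hq).trans (Finset.single_le_sum (f := fun l => p l i)
        (fun l _ => hnn (hK.le (hpK l)) i hi) (Finset.mem_univ i))
    have hKQ : K = Q := by
      refine le_antisymm hK.le fun q hq => ?_
      let N : ℕ := ∑ i, (q i).toNat
      have hN : ∀ i, q i ≤ N := fun i => by
        have h2 : (q i).toNat ≤ N := Finset.single_le_sum (f := fun i => (q i).toNat)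
          (fun _ _ => Nat.zero_le _) (Finset.mem_univ i)
        omega
      have hNK : N • ∑ i, p i ∈ K := nsmul_mem hsum N
      have hd : N • (∑ i, p i) - q ∈ Q := by
        refine (hQJ _).2 ⟨(hP _).2 fun i hi => ?_, fun i hi => ?_⟩
        · rw [Pi.sub_apply, Pi.smul_apply, nsmul_eq_mul]
          by_cases h : ∃ q ∈ Q, q i ≠ 0
          · have h3 := hle i hi h
            have h4 := hN i
            nlinarith
          · push Not at h
            rw [h q hq, h _ (hK.le hsum)]
            simp
        · rw [Pi.sub_apply, ((hQJ _).1 hq).2 i hi, ((hQJ _).1 (hK.le hNK)).2 i hi, sub_zero]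
      exact (hK.of_add_mem q hq _ hd (by rwa [add_sub_cancel])).1
    rw [hKQ] at hk
    unfold HasCodim at hk
    omega
  obtain ⟨i, hi, hKi, q, hq, hqi⟩ := hex
  let R : AddSubmonoid (Fin m → ℤ) :=
    { carrier := {p | p ∈ Q ∧ p i = 0}
      zero_mem' := ⟨Q.zero_mem, rfl⟩
      add_mem' := fun ha hb => ⟨Q.add_mem ha.1 hb.1, by rw [Pi.add_apply, ha.2, hb.2, add_zero]⟩ }
  have hR : IsFace R Q := ⟨fun p hp => hp.1, fun p hp q hq hpq => by
    have h1 := hnn hp i hi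
    have h2 := hnn hq i hi
    have h3 : p i + q i = 0 := hpq.2
    exact ⟨⟨hp, by omega⟩, hq, by omega⟩⟩
  have hKR : K ≤ R := fun p hp => ⟨hK.le hp, hKi p hp⟩
  have hlt := hR.rank_lt fun h => hqi (show q ∈ R from h ▸ hq).2
  have : K = R := (hK.of_le hKR hR.le).eq_of_rank_le (by unfold HasCodim at hk; omega)
  exact ⟨i, hi, fun p => by rw [this]; exact Iff.rfl⟩

/-- The induction is strong because finding the next coordinate uses the description of the current
face by all earlier ones. Nonemptiness provides the irrelevant terms from `n` on. -/
theorem IsFlag.exists_isCoordFlag (hP : ∀ p, p ∈ P ↔ ∀ i ∈ I, 0 ≤ p i) (hm : Nonempty (Fin m))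
    {F : ℕ → AddSubmonoid (Fin m → ℤ)} (hF : IsFlag P F n) : ∃ b, IsCoordFlag P I F n b := by
  have hex : ∀ l, ∃ i, l < n → i ∈ I ∧ ∀ p, p ∈ F (l + 1) ↔ p ∈ F l ∧ p i = 0 := by
    intro l
    induction l using Nat.strong_induction_on with
    | _ l ih =>
      choose b hb using ih
      by_cases hl : l < n
      · have hmem : ∀ i ≤ l, ∀ p, p ∈ F i ↔ p ∈ P ∧ ∀ l' (h : l' < i), ∀ h' : l' < l,
            p (b l' h') = 0 := by
          intro i
          induction i with
          | zero => intro _ p; simp [hF.zero]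
          | succ i ih =>
            intro hi p
            rw [(hb i hi (by omega)).2 p, ih (by omega) p]
            constructor
            · rintro ⟨⟨h1, h2⟩, h3⟩
              refine ⟨h1, fun l' hl' h' => ?_⟩
              rcases (Nat.lt_succ_iff.1 hl').eq_or_lt with rfl | hl'
              · exact h3
              · exact h2 l' hl' h'
            · rintro ⟨h1, h2⟩
              exact ⟨⟨h1, fun l' hl' h' => h2 l' (by omega) h'⟩, h2 i (by omega) hi⟩
        obtain ⟨i, hi, hi'⟩ := exists_coord_of_codim_one hP (hF.mono hl.le).isFace
          (J := {i | ∃ l', ∃ h' : l' < l, i = b l' h'}) (fun p => by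
            rw [hmem l le_rfl p]
            refine and_congr_right fun _ => ⟨?_, fun h l' hl' h' => h _ ⟨l', h', rfl⟩⟩
            rintro h _ ⟨l', h', rfl⟩
            exact h l' h' h') (hF.face l hl) (hF.codim l hl)
        exact ⟨i, fun _ => ⟨hi, hi'⟩⟩
      · exact ⟨Classical.choice hm, fun h => absurd h hl⟩
  choose b hb using hex
  refine ⟨b, hF, fun l hl => (hb l hl).1, fun i => ?_⟩
  induction i with
  | zero => intro _ p; simp [hF.zero]
  | succ i ih =>
    intro hi p
    rw [(hb i hi).2 p, ih (by omega) p, and_assoc]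
    exact and_congr_right fun _ => Nat.forall_lt_succ_right.symm

theorem IsCoordFlag.eq {F F' : ℕ → AddSubmonoid (Fin m → ℤ)} {b : ℕ → Fin m}
    (h : IsCoordFlag P I F n b) (h' : IsCoordFlag P I F' n b) {i : ℕ} (hi : i ≤ n) :
    F i = F' i := by
  ext p
  rw [h.mem_iff i hi, h'.mem_iff i hi]

/-- Between `F j` and `F (j + 2)` there are only the facets given by `b j` and `b (j + 1)`, so
changing the middle face transposes these two labels. -/
theorem IsCoordFlag.swap (hP : ∀ p, p ∈ P ↔ ∀ i ∈ I, 0 ≤ p i)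
    {F F' : ℕ → AddSubmonoid (Fin m → ℤ)} {b : ℕ → Fin m} (h : IsCoordFlag P I F n b) {j : ℕ}
    (hj : j + 2 ≤ n) (hF' : IsFlag P F' n) (hFF' : ∀ i, i ≠ j + 1 → F' i = F i)
    (hne : F' (j + 1) ≠ F (j + 1)) : IsCoordFlag P I F' n (b ∘ Equiv.swap j (j + 1)) := by
  classical
  obtain ⟨i, hi, hiF⟩ := exists_coord_of_codim_one hP (hF'.mono (l := j) (by omega)).isFace
    (J := {i | ∃ l < j, i = b l}) (fun p => by
      rw [hFF' j (by omega), h.mem_iff j (by omega)]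
      refine and_congr_right fun _ => ⟨?_, fun h l hl => h _ ⟨l, hl, rfl⟩⟩
      rintro h _ ⟨l, hl, rfl⟩
      exact h l hl) (hF'.face j (by omega)) (hF'.codim j (by omega))
  rw [hFF' j (by omega)] at hiF
  have hib : i = b (j + 1) := by
    by_contra hib
    -- The unit vector in direction `i` is not in `F (j + 2)`, so `i` is one of `b 0, …, b (j + 1)`.
    -- An earlier label would give `F' (j + 1) = F' j`, and `b j` would give back `F (j + 1)`.
    have hP1 : (Pi.single i 1 : Fin m → ℤ) ∈ P := (hP _).2 fun l _ => by
      by_cases h : l = i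
      · subst h; simp
      · simp [h]
    have h1 : ¬ (Pi.single i 1 : Fin m → ℤ) ∈ F (j + 2) := fun h1 => by
      rw [← hFF' (j + 2) (by omega)] at h1
      have h2 := ((hiF _).1 ((hF'.face (j + 1) (by omega)).le h1)).2
      simp at h2
    rw [h.mem_iff _ hj] at h1
    push Not at h1
    obtain ⟨l, hl, hl'⟩ := h1 hP1
    have hli : b l = i := by
      by_contra hli
      exact hl' (Pi.single_eq_of_ne hli _)
    rcases lt_trichotomy l j with h2 | rfl | h2
    · have h3 : F' (j + 1) = F' j := by
        ext p
        rw [hiF, hFF' j (by omega)]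
        refine ⟨And.left, fun hp => ⟨hp, ?_⟩⟩
        rw [← hli]
        exact ((h.mem_iff j (by omega) p).1 hp).2 l h2
      have h4 := hF'.codim j (by omega)
      rw [h3] at h4
      unfold HasCodim at h4
      omega
    · refine hne ?_
      ext p
      rw [hiF, h.mem_iff l (by omega), h.mem_iff (l + 1) (by omega), ← hli, and_assoc]
      exact and_congr_right fun _ => Nat.forall_lt_succ_right.symm
    · obtain rfl : l = j + 1 := by omega
      exact hib hli.symm
  have hlt : ∀ l, l < j → Equiv.swap j (j + 1) l = l := fun l hl =>
    Equiv.swap_apply_of_ne_of_ne (by omega) (by omega)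
  have hsw : ∀ l < n, Equiv.swap j (j + 1) l < n := by
    intro l hl
    rw [Equiv.swap_apply_def]
    split_ifs <;> omega
  refine ⟨hF', fun l hl => h.mem _ (hsw l hl), fun i' hi' p => ?_⟩
  by_cases h1 : i' = j + 1
  · subst h1
    rw [hiF, h.mem_iff j (by omega), hib, and_assoc, Nat.forall_lt_succ_right]
    refine and_congr_right fun _ => and_congr ?_ ?_
    · exact forall₂_congr fun l hl => by rw [Function.comp_apply, hlt l hl]
    · rw [Function.comp_apply, Equiv.swap_apply_left]
  · rw [hFF' i' h1, h.mem_iff i' hi']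
    refine and_congr_right fun _ => ?_
    have hsw' : ∀ l < i', Equiv.swap j (j + 1) l < i' := by
      intro l hl
      rw [Equiv.swap_apply_def]
      split_ifs <;> omega
    refine ⟨fun h l hl => h _ (hsw' l hl), fun h l hl => ?_⟩
    have := h _ (hsw' l hl)
    rwa [Function.comp_apply, Equiv.swap_apply_self] at this

variable {X : GSpace.{u}}

theorem ExchangesFlags.isCoordFlag {c : Chart X} (hX : IsGManifold X) (hc : c ∈ X.atlas)
    {I : Set (Fin c.m)} (hP : ∀ p, p ∈ c.P ↔ ∀ i ∈ I, 0 ≤ p i) {j : ℕ} {f : bd X n → bd X n}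
    (hf : ExchangesFlags X j n f) (hj : j + 2 ≤ n) {b : ℕ → Fin c.m} {u : XP c.P} (hu : u ∈ c.U)
    {y : bd X n} (hy : ∃ F, IsCoordFlag c.P I F n b ∧ IsFlagPt c F n u y) :
    ∃ F, IsCoordFlag c.P I F n (b ∘ Equiv.swap j (j + 1)) ∧ IsFlagPt c F n u (f y) := by
  obtain ⟨F, hF, hy⟩ := hy
  obtain ⟨F', hF', h1, h2⟩ := hF.isFlag.exists_update (hX.isGChart c hc).weaklyToric.fg hj
  exact ⟨F', hF.swap hP hj hF' h1 h2,
    hf c hc F F' hF.isFlag hF' (fun i _ hi => h1 i hi) h2 u hu y hy⟩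

/-- Over a fixed point of `X`, a sequence of coordinates determines at most one point of the
iterated boundary, and the involutions act by adjacent transpositions of the sequence. Relations
between transpositions therefore hold for the involutions. -/
theorem coxeterRelations_of_ordinaryCorners (hX : IsGManifold X) (ho : HasOrdinaryCorners X)
    {m : ℕ} {s : Fin (m + 1) → Equiv.Perm (bd X (m + 2))}
    (hs : ∀ j : Fin (m + 1), ExchangesFlags X j (m + 2) (s j)) : CoxeterRelations s := by
  have hlt : ∀ j : Fin (m + 1), (j : ℕ) + 2 ≤ m + 2 := fun j => by omega
  -- The labels are packaged as a set `Z` with a right action of the permutations of `ℕ`, so that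
  -- the three relations can be checked without reference to charts.
  have key : ∀ y : bd X (m + 2), ∃ (Z : Type) (R : Z → bd X (m + 2) → Prop)
      (a : Z → Equiv.Perm ℕ → Z) (z : Z), R z y ∧ (∀ z σ τ, a (a z σ) τ = a z (σ * τ)) ∧
        (∀ z, a z 1 = z) ∧
        (∀ (j : Fin (m + 1)) z y, R z y → R (a z (Equiv.swap j (j + 1))) (s j y)) ∧
        ∀ z y y', R z y → R z y' → y = y' := by
    intro y
    obtain ⟨c, hc, ⟨u, hu, hux⟩, d, -, hd⟩ := ho (bdProjIter X (m + 2) y)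
    let I : Set (Fin c.m) := {i | (i : ℕ) < d}
    obtain ⟨F, hF, hy⟩ := exists_flag_of_proj_eq hX hc hu y hux
    have hm : Nonempty (Fin c.m) := by
      obtain ⟨h, -⟩ := hF.exists_update (hX.isGChart c hc).weaklyToric.fg (j := 0) (by omega)
      by_contra hm
      rw [not_nonempty_iff] at hm
      have h1 := hF.hasCodim
      have h2 := rank_le c.P
      have h3 : c.m = 0 := by
        by_contra h3
        exact hm.elim ⟨0, by omega⟩
      unfold HasCodim at h1
      omega
    obtain ⟨b, hb⟩ := hF.exists_isCoordFlag (I := I) hd hm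
    refine ⟨ℕ → Fin c.m, fun b y => ∃ F, IsCoordFlag c.P I F (m + 2) b ∧ IsFlagPt c F (m + 2) u y,
      fun b σ => b ∘ σ, b, ⟨F, hb, hy⟩, fun _ _ _ => rfl, fun _ => rfl,
      fun j b y h => (hs j).isCoordFlag hX hc hd (hlt j) hu h, ?_⟩
    rintro b y y' ⟨F, hF, hy⟩ ⟨F', hF', hy'⟩
    exact (hy.congr fun i hi => hF'.eq hF hi).unique hX hc hF'.isFlag hu hy'
  have hne : ∀ i : ℕ, i ≠ i + 1 ∧ i ≠ i + 1 + 1 ∧ i + 1 ≠ i + 1 + 1 := fun i => by omega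
  refine ⟨fun j => ?_, fun i j hij => ?_, fun i j hij => ?_⟩ <;> ext1 y <;>
    obtain ⟨Z, R, a, z, hz, ha, ha1, hR, huniq⟩ := key y
  · have h1 := hR j _ _ (hR j _ _ hz)
    rw [ha, Equiv.swap_mul_self, ha1] at h1
    exact huniq _ _ _ h1 hz
  · have h1 := hR i _ _ (hR j _ _ (hR i _ _ hz))
    have h2 := hR j _ _ (hR i _ _ (hR j _ _ hz))
    rw [ha, ha, ← hij, ← mul_assoc, swap_braid (hne i).1 (hne i).2.1 (hne i).2.2] at h1
    rw [ha, ha, ← hij, ← mul_assoc] at h2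
    exact huniq _ _ _ h1 h2
  · have h1 := hR i _ _ (hR j _ _ hz)
    have h2 := hR j _ _ (hR i _ _ hz)
    rw [ha] at h1 h2
    rw [(Equiv.Perm.Disjoint.commute (Equiv.Perm.disjoint_swap_swap (by simp; omega))).eq] at h1
    exact huniq _ _ _ h1 h2

end OrdinaryCorners

/-! ### Model spaces as manifolds -/

section ModelSpace

variable {m : ℕ} (P : AddSubmonoid (Fin m → ℤ))

/-- The model space `X_P` as a manifold with g-corners. -/
def modelSpace : GSpace.{0} where
  carrier := XP P
  top := inferInstance
  dim := rank P
  atlas := maximalAtlas (rank P) {⟨m, P, univ, fun x => x⟩}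

variable {P}

theorem isGChart_id (hP : WeaklyToric P) :
    IsGChart (rank P) (⟨m, P, univ, fun x => x⟩ : Chart (XP P)) :=
  .of_isOpen_image hP rfl isOpen_univ continuousOn_id (fun _ _ _ _ h => h) fun O _ hO => by
    change IsOpen ((fun x => x) '' O)
    rwa [image_id']

theorem smoothTransition_id (hP : WeaklyToric P) : SmoothTransition
    (⟨m, P, univ, fun x => x⟩ : Chart (XP P)) (⟨m, P, univ, fun x => x⟩ : Chart (XP P)) :=
  (modelSmoothOn_id _).congr fun x _ => (isGChart_id hP).inv_φ (mem_univ x)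

theorem isGManifold_modelSpace (hP : WeaklyToric P) : IsGManifold (modelSpace P) := by
  refine isGManifold_of_atlas (X := modelSpace P) (A := {⟨m, P, univ, fun x => x⟩})
    (inferInstanceAs (T2Space (XP P))) (inferInstanceAs (SecondCountableTopology (XP P)))
    ?_ ?_ (fun x => ⟨⟨m, P, univ, fun x => x⟩, rfl, ⟨(x : XP P), mem_univ _, rfl⟩⟩) rfl
  · rintro _ rfl
    exact isGChart_id hP
  · rintro _ rfl _ rfl
    exact smoothTransition_id hP

theorem mem_atlas_modelSpace (hP : WeaklyToric P) :
    (⟨m, P, univ, fun x => x⟩ : Chart (XP P)) ∈ (modelSpace P).atlas :=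
  subset_maximalAtlas (by rintro _ rfl; exact isGChart_id hP)
    (by rintro _ rfl _ rfl; exact ⟨smoothTransition_id hP, smoothTransition_id hP⟩) rfl

end ModelSpace

/-! ### Polyhedral monoids -/

section Polyhedral

variable {m : ℕ} {ι : Type} (f : ι → (Fin m → ℤ) →+ ℤ)

/-- The monoid of integral points on which finitely many functionals are nonnegative. -/
def polyMonoid : AddSubmonoid (Fin m → ℤ) where
  carrier := {p | ∀ i, 0 ≤ f i p}
  zero_mem' i := by rw [map_zero]
  add_mem' ha hb i := by rw [map_add]; exact add_nonneg (ha i) (hb i)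

/-- The face on which the functionals in `S` vanish. -/
def polyFace (S : Set ι) : AddSubmonoid (Fin m → ℤ) where
  carrier := {p | p ∈ polyMonoid f ∧ ∀ i ∈ S, f i p = 0}
  zero_mem' := ⟨zero_mem _, fun i _ => map_zero _⟩
  add_mem' ha hb := ⟨add_mem ha.1 hb.1, fun i hi => by
    rw [map_add, ha.2 i hi, hb.2 i hi, add_zero]⟩

theorem polyFace_mono {S T : Set ι} (h : S ⊆ T) : polyFace f T ≤ polyFace f S :=
  fun _ hp => ⟨hp.1, fun i hi => hp.2 i (h hi)⟩

theorem isFace_polyFace {S T : Set ι} (h : S ⊆ T) : IsFace (polyFace f T) (polyFace f S) := by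
  refine ⟨polyFace_mono f h, fun p hp q hq hpq => ?_⟩
  have key : ∀ i ∈ T, f i p = 0 ∧ f i q = 0 := fun i hi => by
    have h1 := hpq.2 i hi
    have h2 := hp.1 i
    have h3 := hq.1 i
    rw [map_add] at h1
    omega
  exact ⟨⟨hp.1, fun i hi => (key i hi).1⟩, hq.1, fun i hi => (key i hi).2⟩

theorem polyFace_empty : polyFace f ∅ = polyMonoid f :=
  le_antisymm (fun _ hp => hp.1) fun _ hp => ⟨hp, fun _ hi => absurd hi (notMem_empty _)⟩

variable {f}

/-- The functionals embed the monoid into `ℕ^ι`, with an image closed under those differences which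
stay in `ℕ^ι`. Such subtractive submonoids are finitely generated. -/
theorem weaklyToric_polyMonoid [Finite ι] (hf : ∀ p, (∀ i, f i p = 0) → p = 0) :
    WeaklyToric (polyMonoid f) := by
  constructor
  · let e : (Fin m → ℤ) →+ (ι → ℤ) := AddMonoidHom.pi f
    have he : Function.Injective e := (injective_iff_map_eq_zero e).2 fun p hp =>
      hf p fun i => congrFun hp i
    let c : (ι → ℕ) →+ (ι → ℤ) := (Nat.castAddMonoidHom ℤ).compLeft ι
    have hQ : (((polyMonoid f).map e).comap c).FG := by
      refine AddSubmonoid.fg_of_subtractive fun x hx y hxy => ?_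
      obtain ⟨p, hp, hpx⟩ := hx
      obtain ⟨q, hq, hqx⟩ := hxy
      have h1 : e (q - p) = c y := by
        rw [map_sub, hpx, hqx, map_add, add_sub_cancel_left]
      refine ⟨q - p, fun i => ?_, h1⟩
      have h2 : f i (q - p) = (y i : ℤ) := congrFun h1 i
      rw [h2]
      exact Int.natCast_nonneg _
    have h3 := hQ.map c
    have h4 : (((polyMonoid f).map e).comap c).map c = (polyMonoid f).map e := by
      refine le_antisymm (by rintro _ ⟨x, hx, rfl⟩; exact hx) ?_
      rintro _ ⟨p, hp, rfl⟩
      have h5 : c (fun i => (f i p).toNat) = e p := funext fun i => Int.toNat_of_nonneg (hp i)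
      refine ⟨fun i => (f i p).toNat, ?_, h5⟩
      change c _ ∈ (polyMonoid f).map e
      rw [h5]
      exact ⟨p, hp, rfl⟩
    rw [h4] at h3
    exact h3.map_injective e he
  · intro p _ n hn hp i
    have h1 : 0 ≤ f i (n • p) := hp i
    rw [map_nsmul, nsmul_eq_mul] at h1
    exact nonneg_of_mul_nonneg_right h1 (by exact_mod_cast hn)

/-- A strictly decreasing sequence of faces whose length is at least the rank is a flag. -/
theorem isFlag_of_ne {n : ℕ} {F : ℕ → AddSubmonoid (Fin m → ℤ)}
    (hF : ∀ i < n, IsFace (F (i + 1)) (F i)) (hne : ∀ i < n, F (i + 1) ≠ F i)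
    (hn : rank (F 0) ≤ n) : IsFlag (F 0) F n ∧ rank (F 0) = n := by
  -- Counting strict drops of rank from the top bounds the ranks above, and counting from the bottom
  -- bounds them below; since the total is at most `n`, every drop is exactly one.
  have h1 : ∀ i ≤ n, rank (F i) + i ≤ rank (F 0) := by
    intro i
    induction i with
    | zero => intro _; exact le_rfl
    | succ i ih =>
      intro hi
      have := (hF i hi).rank_lt (hne i hi)
      have := ih (by omega)
      omega
  have h2 : ∀ d ≤ n, d ≤ rank (F (n - d)) := by
    intro d
    induction d with
    | zero => intro _; exact Nat.zero_le _
    | succ d ih =>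
      intro hd
      have h3 := hF (n - (d + 1)) (by omega)
      have h4 := h3.rank_lt (hne (n - (d + 1)) (by omega))
      rw [show n - (d + 1) + 1 = n - d by omega] at h4
      have := ih (by omega)
      omega
  have h3 : ∀ i ≤ n, rank (F i) + i = n := by
    intro i hi
    have h4 := h1 i hi
    have h5 := h2 (n - i) (by omega)
    rw [show n - (n - i) = i by omega] at h5
    omega
  refine ⟨⟨rfl, hF, fun i hi => ?_⟩, by simpa using h3 0 (by omega)⟩
  have h4 := h3 i hi.le
  have h5 := h3 (i + 1) hi
  unfold HasCodim
  omega

end Polyhedral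

/-! ### A cone over a polygon, times an orthant -/

section Polygon

variable {r N : ℕ}

/-- The value at `x` of the quadratic polynomial with the first three coordinates as
coefficients. -/
def evalQuad (r : ℕ) (x : ℤ) : (Fin (r + 3) → ℤ) →+ ℤ :=
  AddMonoidHom.mk' (fun p => p ⟨0, by omega⟩ + x * p ⟨1, by omega⟩ + x ^ 2 * p ⟨2, by omega⟩)
    fun p q => by simp only [Pi.add_apply]; ring

/-- The functionals defining the facets of the product of a cone over an `N`-gon and an
orthant. -/
def polygonFun (r N : ℕ) : Fin N ⊕ Fin r → (Fin (r + 3) → ℤ) →+ ℤ :=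
  Sum.elim (fun i => evalQuad r i) fun t => Pi.evalAddMonoidHom _ ⟨t + 3, by omega⟩

/-- The vector of coefficients of a quadratic polynomial. -/
def quadVec (r : ℕ) (a b c : ℤ) (k : Fin (r + 3)) : ℤ :=
  match (k : ℕ) with
  | 0 => a
  | 1 => b
  | 2 => c
  | _ => 0

theorem evalQuad_quadVec (x a b c : ℤ) : evalQuad r x (quadVec r a b c) = a + x * b + x ^ 2 * c :=
  rfl

theorem quadVec_mem {a b c : ℤ} (h : ∀ i < N, 0 ≤ a + (i : ℕ) * b + (i : ℕ) ^ 2 * c) :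
    quadVec r a b c ∈ polyMonoid (polygonFun r N) := by
  rintro (i | t)
  · exact h i i.2
  · exact le_rfl

/-- A quadratic polynomial which vanishes at `0`, `1` and `2` is zero, so three evaluations together
with the remaining coordinates separate points. The polygon is realised by quadratics nonnegative at
`0, …, N - 1`, one edge for each evaluation point. -/
theorem weaklyToric_polygon (hN : 3 ≤ N) : WeaklyToric (polyMonoid (polygonFun r N)) := by
  refine weaklyToric_polyMonoid fun p hp => ?_
  have h0 : p ⟨0, by omega⟩ + 0 * p ⟨1, by omega⟩ + 0 ^ 2 * p ⟨2, by omega⟩ = 0 :=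
    hp (Sum.inl ⟨0, by omega⟩)
  have h1 : p ⟨0, by omega⟩ + 1 * p ⟨1, by omega⟩ + 1 ^ 2 * p ⟨2, by omega⟩ = 0 :=
    hp (Sum.inl ⟨1, by omega⟩)
  have h2 : p ⟨0, by omega⟩ + 2 * p ⟨1, by omega⟩ + 2 ^ 2 * p ⟨2, by omega⟩ = 0 :=
    hp (Sum.inl ⟨2, by omega⟩)
  funext ⟨k, hk⟩
  rcases k with _ | _ | _ | t
  · change p ⟨0, _⟩ = 0
    linarith
  · change p ⟨1, _⟩ = 0
    linarith
  · change p ⟨2, _⟩ = 0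
    linarith
  · exact hp (Sum.inr ⟨t, by omega⟩)

/-- The functionals which vanish on the terms of the flag of faces given by two adjacent edges
of the polygon. -/
def polygonSet (r N i j l : ℕ) : Set (Fin N ⊕ Fin r) :=
  {x | Sum.elim (fun a : Fin N => (1 ≤ l ∧ (a : ℕ) = i) ∨ (2 ≤ l ∧ (a : ℕ) = j) ∨ 3 ≤ l)
    (fun t : Fin r => (t : ℕ) + 3 < l) x}

/-- As `l` grows the conditions accumulate: edge `i` at `l = 1`, its vertex with edge `j` at `2`,
the apex of the cone at `3`, and then the orthant coordinates one at a time. -/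
theorem polygonSet_subset (i j l : ℕ) : polygonSet r N i j l ⊆ polygonSet r N i j (l + 1) := by
  rintro (a | t) h
  · rcases h with h | h | h
    · exact Or.inl ⟨by omega, h.2⟩
    · exact Or.inr (Or.inl ⟨by omega, h.2⟩)
    · exact Or.inr (Or.inr (by omega))
  · exact Nat.lt_succ_of_lt h

/-- The flag of faces given by two adjacent edges of the polygon. -/
def polygonFlag (r N i j l : ℕ) : AddSubmonoid (Fin (r + 3) → ℤ) :=
  polyFace (polygonFun r N) (polygonSet r N i j l)

/-- The edges `i` and `j` of the polygon are adjacent. -/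
def AdjacentEdges (N i j : ℕ) : Prop :=
  i + 1 = j ∨ j + 1 = i ∨ (i + 1 = N ∧ j = 0) ∨ (j + 1 = N ∧ i = 0)

/-- The witness is `±(x - i)(x - j)`. It has constant sign on `0, …, N - 1` precisely because no
integer lies strictly between consecutive `i, j`, while all lie between `0` and `N - 1`, where the
sign is reversed. -/
theorem AdjacentEdges.exists_mem {i j : ℕ} (hi : i < N) (hj : j < N) (h : AdjacentEdges N i j) :
    ∃ w ∈ polyMonoid (polygonFun r N), (∀ k : ℕ, evalQuad r k w = 0 ↔ k = i ∨ k = j) ∧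
      ∀ t : Fin r, w ⟨t + 3, by omega⟩ = 0 := by
  obtain ⟨ε, hε0, hε⟩ : ∃ ε : ℤ, ε ≠ 0 ∧ ∀ k < N, 0 ≤ ε * (((k : ℕ) - i) * (k - j)) := by
    have h1 : ∀ i : ℕ, ∀ k : ℤ, 0 ≤ (k - i) * (k - (i + 1 : ℕ)) := by
      intro i k
      push_cast
      rcases le_or_gt k i with h | h
      · exact mul_nonneg_of_nonpos_of_nonpos (by linarith) (by linarith)
      · exact mul_nonneg (by linarith) (by linarith)
    have h2 : ∀ k < N, ∀ i : ℕ, i + 1 = N → 0 ≤ (k : ℤ) * (i - k) := by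
      intro k hk i hi
      have : (k : ℤ) ≤ i := by exact_mod_cast (by omega : k ≤ i)
      exact mul_nonneg (Int.natCast_nonneg _) (by linarith)
    rcases h with rfl | rfl | ⟨h, rfl⟩ | ⟨h, rfl⟩
    · exact ⟨1, one_ne_zero, fun k _ => by rw [one_mul]; exact h1 i k⟩
    · exact ⟨1, one_ne_zero, fun k _ => by rw [one_mul, mul_comm]; exact h1 j k⟩
    · refine ⟨-1, by norm_num, fun k hk => ?_⟩
      have := h2 k hk i h
      push_cast
      linarith
    · refine ⟨-1, by norm_num, fun k hk => ?_⟩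
      have := h2 k hk j h
      push_cast
      linarith
  have hw : ∀ k : ℤ, ε * (i * j) + k * (-ε * (i + j)) + k ^ 2 * ε = ε * ((k - i) * (k - j)) :=
    fun k => by ring
  refine ⟨quadVec r (ε * (i * j)) (-ε * (i + j)) ε, quadVec_mem fun k hk => ?_, fun k => ?_,
    fun t => rfl⟩
  · rw [hw]
    exact hε k hk
  · rw [evalQuad_quadVec, hw, mul_eq_zero, or_iff_right hε0, mul_eq_zero, sub_eq_zero,
      sub_eq_zero, Nat.cast_inj, Nat.cast_inj]

/-- The witness is `(x - i)²`. -/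
theorem exists_mem_edge (i : ℕ) : ∃ w ∈ polyMonoid (polygonFun r N),
    (∀ k : ℕ, evalQuad r k w = 0 ↔ k = i) := by
  have hw : ∀ k : ℤ, (i : ℤ) ^ 2 + k * (-(2 * i)) + k ^ 2 * 1 = (k - i) ^ 2 := fun k => by ring
  refine ⟨quadVec r (i ^ 2) (-(2 * i)) 1, quadVec_mem fun k hk => ?_, fun k => ?_⟩
  · rw [hw]
    exact sq_nonneg _
  · rw [evalQuad_quadVec, hw, sq_eq_zero_iff, sub_eq_zero, Nat.cast_inj]

theorem mem_polygonFlag_one {i j : ℕ} (hi : i < N) {p : Fin (r + 3) → ℤ} :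
    p ∈ polygonFlag r N i j 1 ↔ p ∈ polyMonoid (polygonFun r N) ∧ evalQuad r i p = 0 := by
  refine and_congr_right fun _ => ⟨fun h => h (Sum.inl ⟨i, hi⟩) (Or.inl ⟨le_rfl, rfl⟩), ?_⟩
  rintro h (a | t) hx
  · rcases hx with hx | hx | hx
    · change evalQuad r (a : ℕ) p = 0
      rwa [hx.2]
    · omega
    · omega
  · exact absurd hx (by change ¬ (t : ℕ) + 3 < 1; omega)

theorem mem_polygonFlag_two {i j : ℕ} (hi : i < N) (hj : j < N) {p : Fin (r + 3) → ℤ} :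
    p ∈ polygonFlag r N i j 2 ↔
      p ∈ polyMonoid (polygonFun r N) ∧ evalQuad r i p = 0 ∧ evalQuad r j p = 0 := by
  refine and_congr_right fun _ => ⟨fun h => ⟨h (Sum.inl ⟨i, hi⟩) (Or.inl ⟨by omega, rfl⟩),
    h (Sum.inl ⟨j, hj⟩) (Or.inr (Or.inl ⟨le_rfl, rfl⟩))⟩, ?_⟩
  rintro ⟨h, h'⟩ (a | t) hx
  · rcases hx with hx | hx | hx
    · change evalQuad r (a : ℕ) p = 0
      rwa [hx.2]
    · change evalQuad r (a : ℕ) p = 0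
      rwa [hx.2]
    · omega
  · exact absurd hx (by change ¬ (t : ℕ) + 3 < 2; omega)

theorem polygonFlag_one_ne {i j i' j' : ℕ} (hi : i < N) (hi' : i' < N) (h : i ≠ i') :
    polygonFlag r N i j 1 ≠ polygonFlag r N i' j' 1 := by
  obtain ⟨w, hw, hwk⟩ := exists_mem_edge (r := r) (N := N) i
  intro heq
  have h1 : w ∈ polygonFlag r N i j 1 := (mem_polygonFlag_one hi).2 ⟨hw, (hwk i).2 rfl⟩
  rw [heq, mem_polygonFlag_one hi', hwk] at h1
  exact h h1.2.symm

theorem polygonFlag_two_ne {i j k : ℕ} (hi : i < N) (hj : j < N) (hk : k < N)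
    (hij : AdjacentEdges N i j) (h1 : k ≠ i) (h2 : k ≠ j) :
    polygonFlag r N i k 2 ≠ polygonFlag r N i j 2 := by
  obtain ⟨w, hw, hwk, -⟩ := hij.exists_mem (r := r) hi hj
  intro heq
  have h3 : w ∈ polygonFlag r N i j 2 :=
    (mem_polygonFlag_two hi hj).2 ⟨hw, (hwk i).2 (Or.inl rfl), (hwk j).2 (Or.inr rfl)⟩
  rw [← heq, mem_polygonFlag_two hi hk, hwk k] at h3
  exact h3.2.2.elim h1 h2

/-- Each inclusion is strict, as shown in turn by the constant `1`, a square, a product of two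
linear factors, and unit vectors of the orthant. With `r + 3` strict steps in rank at most `r + 3`,
all codimensions are one. -/
theorem isFlag_polygonFlag (hN : 3 ≤ N) {i j : ℕ} (hi : i < N) (hj : j < N)
    (hij : AdjacentEdges N i j) :
    IsFlag (polyMonoid (polygonFun r N)) (polygonFlag r N i j) (r + 3) ∧
      rank (polyMonoid (polygonFun r N)) = r + 3 := by
  have h0 : polygonFlag r N i j 0 = polyMonoid (polygonFun r N) := by
    rw [← polyFace_empty]
    refine congrArg _ (eq_empty_of_forall_notMem ?_)
    rintro (a | t) h
    · rcases h with h | h | h <;> omega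
    · exact Nat.not_lt_zero _ h
  have hne' : i ≠ j := by unfold AdjacentEdges at hij; omega
  have key : ∀ l < r + 3, ∃ p ∈ polygonFlag r N i j l, p ∉ polygonFlag r N i j (l + 1) := by
    intro l hl
    rcases l with _ | _ | _ | t
    · refine ⟨quadVec r 1 0 0, ?_, fun h => ?_⟩
      · rw [h0]
        exact quadVec_mem fun k _ => by norm_num
      · have h1 := ((mem_polygonFlag_one hi).1 h).2
        rw [evalQuad_quadVec] at h1
        norm_num at h1
    · obtain ⟨w, hw, hwk⟩ := exists_mem_edge (r := r) (N := N) i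
      refine ⟨w, (mem_polygonFlag_one hi).2 ⟨hw, (hwk i).2 rfl⟩, fun h => ?_⟩
      exact hne' ((hwk j).1 ((mem_polygonFlag_two hi hj).1 h).2.2).symm
    · obtain ⟨w, hw, hwk, -⟩ := hij.exists_mem (r := r) hi hj
      refine ⟨w, (mem_polygonFlag_two hi hj).2 ⟨hw, (hwk i).2 (Or.inl rfl),
        (hwk j).2 (Or.inr rfl)⟩, fun h => ?_⟩
      obtain ⟨k, hk, hki, hkj⟩ : ∃ k < N, k ≠ i ∧ k ≠ j := by
        by_contra! hcon
        have h1 := hcon 0 (by omega)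
        have h2 := hcon 1 (by omega)
        have h3 := hcon 2 (by omega)
        omega
      exact ((hwk k).1 (h.2 (Sum.inl ⟨k, hk⟩) (Or.inr (Or.inr le_rfl)))).elim hki hkj
    · have ht : t < r := by omega
      let e : Fin (r + 3) → ℤ := fun k => if (k : ℕ) = t + 3 then 1 else 0
      have he : ∀ x, evalQuad r x e = 0 := fun x => by
        change (if 0 = t + 3 then (1 : ℤ) else 0) + x * (if 1 = t + 3 then (1 : ℤ) else 0) +
          x ^ 2 * (if 2 = t + 3 then (1 : ℤ) else 0) = 0
        rw [if_neg (by omega), if_neg (by omega), if_neg (by omega)]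
        ring
      refine ⟨e, ⟨?_, ?_⟩, fun h => ?_⟩
      · rintro (a | t')
        · exact (he a).ge
        · change 0 ≤ if (t' : ℕ) + 3 = t + 3 then (1 : ℤ) else 0
          split_ifs <;> norm_num
      · rintro (a | t') h
        · exact he a
        · have h' : (t' : ℕ) + 3 < t + 3 := h
          exact if_neg (by change ¬ (t' : ℕ) + 3 = t + 3; omega)
      · have h1 : (if t + 3 = t + 3 then (1 : ℤ) else 0) = 0 :=
          h.2 (Sum.inr ⟨t, ht⟩) (by change t + 3 < t + 3 + 1; omega)
        rw [if_pos rfl] at h1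
        exact one_ne_zero h1
  have h := isFlag_of_ne (F := polygonFlag r N i j) (n := r + 3)
    (fun l _ => isFace_polyFace _ (polygonSet_subset i j l))
    (fun l hl heq => by
      obtain ⟨p, hp, hp'⟩ := key l hl
      exact hp' (heq ▸ hp)) (rank_le _)
  rwa [h0] at h

/-- Interchanging the two edges changes only the first face, as the first involution does;
`polygonFlag_congr` below changes only the second face. -/
theorem polygonFlag_comm {i j l : ℕ} (hl : l ≠ 1) :
    polygonFlag r N j i l = polygonFlag r N i j l := by
  refine congrArg _ (Set.ext ?_)
  rintro (a | t)
  · change (1 ≤ l ∧ (a : ℕ) = j) ∨ (2 ≤ l ∧ (a : ℕ) = i) ∨ 3 ≤ l ↔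
      (1 ≤ l ∧ (a : ℕ) = i) ∨ (2 ≤ l ∧ (a : ℕ) = j) ∨ 3 ≤ l
    omega
  · exact Iff.rfl

theorem polygonFlag_congr {i j k l : ℕ} (hl : l ≠ 2) :
    polygonFlag r N i k l = polygonFlag r N i j l := by
  refine congrArg _ (Set.ext ?_)
  rintro (a | t)
  · change (1 ≤ l ∧ (a : ℕ) = i) ∨ (2 ≤ l ∧ (a : ℕ) = k) ∨ 3 ≤ l ↔
      (1 ≤ l ∧ (a : ℕ) = i) ∨ (2 ≤ l ∧ (a : ℕ) = j) ∨ 3 ≤ l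
    omega
  · exact Iff.rfl

theorem polygonFlag_of_three_le {i j i' j' l : ℕ} (hl : 3 ≤ l) :
    polygonFlag r N i j l = polygonFlag r N i' j' l := by
  refine congrArg _ (Set.ext ?_)
  rintro (a | t)
  · exact iff_of_true (Or.inr (Or.inr hl)) (Or.inr (Or.inr hl))
  · exact Iff.rfl

/-- On the product of a cone over an `N`-gon and an orthant, the product of the first two
involutions moves the flags around the polygon. -/
theorem dvd_of_pow_eq_one (hN : 3 ≤ N)
    {f g : Equiv.Perm (bd (modelSpace (polyMonoid (polygonFun r N))) (r + 3))}
    (hf : ExchangesFlags (modelSpace (polyMonoid (polygonFun r N))) 0 (r + 3) f)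
    (hg : ExchangesFlags (modelSpace (polyMonoid (polygonFun r N))) 1 (r + 3) g) {n : ℕ}
    (hn : (g * f) ^ n = 1) : N ∣ n := by
  have hP := weaklyToric_polygon (r := r) hN
  have hX := isGManifold_modelSpace hP
  have hc := mem_atlas_modelSpace hP
  have hlt : ∀ n, n % N < N := fun n => Nat.mod_lt _ (by omega)
  have hmod : ∀ n, (n + 1) % N = if n % N + 1 = N then 0 else n % N + 1 := by
    intro n
    have h1 := hlt n
    rw [Nat.add_mod_eq_ite, Nat.mod_eq_of_lt (by omega : 1 < N)]
    split_ifs <;> omega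
  have hadj : ∀ n, AdjacentEdges N (n % N) ((n + 1) % N) := by
    intro n
    rw [hmod n]
    unfold AdjacentEdges
    split_ifs <;> omega
  have hadj' : ∀ n, AdjacentEdges N ((n + 1) % N) (n % N) := by
    intro n
    have := hadj n
    unfold AdjacentEdges at *
    omega
  have hflag := fun n => (isFlag_polygonFlag (r := r) hN (hlt n) (hlt (n + 1)) (hadj n)).1
  have hflag' := fun n => (isFlag_polygonFlag (r := r) hN (hlt (n + 1)) (hlt n) (hadj' n)).1
  -- The base point is taken over the last face, which all these flags share, so each of them
  -- defines a point of the iterated boundary over it.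
  obtain ⟨w⟩ : Nonempty (XP (polygonFlag r N (0 % N) ((0 + 1) % N) (r + 3))) := inferInstance
  have hu := supp_inclFace_le (hflag 0).isFace w
  generalize inclFace (hflag 0).isFace w = u at hu
  have hex : ∀ n, ∃ y, IsFlagPt (X := modelSpace (polyMonoid (polygonFun r N)))
      ⟨r + 3, polyMonoid (polygonFun r N), univ, fun x => x⟩
      (polygonFlag r N (n % N) ((n + 1) % N)) (r + 3) u y := fun n =>
    exists_isFlagPt hX hc (hflag n) (mem_univ u)
      (hu.trans (polygonFlag_of_three_le (by omega)).le)
  choose y hy using hex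
  -- First `f` turns the edges `(n, n + 1)` into `(n + 1, n)`, then `g` moves to the other vertex of
  -- edge `n + 1`, giving `(n + 1, n + 2)`.
  have hstep : ∀ n, (g * f) (y n) = y (n + 1) := by
    intro n
    have h1 := hf _ hc _ _ (hflag n) (hflag' n) (fun l _ hl => polygonFlag_comm hl)
      (polygonFlag_one_ne (hlt _) (hlt _) (by
        have := hmod n
        split_ifs at this <;> omega)) u (mem_univ u) _ (hy n)
    have h2 := hg _ hc _ _ (hflag' n) (hflag (n + 1)) (fun l _ hl => polygonFlag_congr hl)
      (polygonFlag_two_ne (hlt _) (hlt _) (hlt _) (hadj' n) (by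
        have := hmod (n + 1)
        split_ifs at this <;> omega) (by
        have h3 := hmod n
        have h4 := hmod (n + 1)
        split_ifs at h3 h4 <;> omega)) u (mem_univ u) _ h1
    exact h2.unique hX hc (hflag (n + 1)) (mem_univ u) (hy (n + 1))
  have hpow : ∀ n, ((g * f) ^ n) (y 0) = y n := by
    intro n
    induction n with
    | zero => rfl
    | succ n ih => rw [pow_succ', Equiv.Perm.mul_apply, ih, hstep]
  have h1 := hpow n
  rw [hn, Equiv.Perm.one_apply] at h1
  have h2 := (hy n).flag_unique hX hc (hflag n) (hflag 0) (mem_univ u) (h1 ▸ hy 0) 1 (by omega)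
  by_contra hcon
  refine polygonFlag_one_ne (hlt n) (hlt 0) (fun h => hcon ?_) h2
  exact Nat.dvd_of_mod_eq_zero (h.trans (Nat.zero_mod N))

/-- Take `N` prime with `N ≥ r + 4 > k = r + 3`. Every exponent killing the product of the first two
involutions is a multiple of `N`, whereas the relations would give exponent `3` and an isomorphism
with `S_k` the exponent `k!`, which `N` does not divide. -/
theorem exists_not_coxeterRelations (m : ℕ) (hm : 1 ≤ m) :
    ∃ X : GSpace.{0}, IsGManifold X ∧ m + 2 ≤ X.dim ∧
      ∃ s : Fin (m + 1) → Equiv.Perm (bd X (m + 2)),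
        (∀ j : Fin (m + 1), IsSwapAt X j (m + 2) (s j)) ∧ ¬ CoxeterRelations s ∧
        IsEmpty (Subgroup.closure (Set.range s) ≃* Equiv.Perm (Fin (m + 2))) := by
  obtain ⟨r, rfl⟩ : ∃ r, m = r + 1 := ⟨m - 1, by omega⟩
  obtain ⟨N, hN, hp⟩ := Nat.exists_infinite_primes (r + 4)
  have hX := isGManifold_modelSpace (weaklyToric_polygon (r := r) (N := N) (by omega))
  have hr := (isFlag_polygonFlag (r := r) (N := N) (i := 0) (j := 1) (by omega) (by omega)
    (by omega) (Or.inl rfl)).2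
  obtain ⟨s, hs, hsF⟩ := exists_perm_isSwapAt hX (r + 1)
  have key : ∀ n, (s ⟨1, by omega⟩ * s ⟨0, by omega⟩) ^ n = 1 → N ∣ n := fun n hn =>
    dvd_of_pow_eq_one (by omega) (hsF ⟨0, by omega⟩) (hsF ⟨1, by omega⟩) hn
  refine ⟨_, hX, hr.ge, s, fun j => (hs j (s j)).2 rfl, fun h => ?_, ⟨fun e => ?_⟩⟩
  · have h0 := h.1 ⟨0, by omega⟩
    have h1 := h.1 ⟨1, by omega⟩
    have h2 := h.2.1 ⟨0, by omega⟩ ⟨1, by omega⟩ rfl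
    generalize s ⟨0, by omega⟩ = a at h0 h2 key
    generalize s ⟨1, by omega⟩ = b at h1 h2 key
    have h3 : (b * a) ^ 3 = 1 := by
      calc (b * a) ^ 3 = b * (a * b * a) * (b * a) := by simp only [pow_succ, pow_zero, mul_assoc,
            one_mul]
        _ = (b * b) * a * (b * b) * a := by rw [h2]; simp only [mul_assoc]
        _ = 1 := by rw [h1, one_mul, mul_one, h0]
    have h4 := Nat.le_of_dvd (by omega) (key 3 h3)
    omega
  · have ha : s ⟨1, by omega⟩ * s ⟨0, by omega⟩ ∈ Subgroup.closure (Set.range s) :=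
      mul_mem (Subgroup.subset_closure ⟨_, rfl⟩) (Subgroup.subset_closure ⟨_, rfl⟩)
    have h1 : (⟨_, ha⟩ : Subgroup.closure (Set.range s)) ^ (r + 1 + 2).factorial = 1 := by
      refine e.injective ?_
      have h2 : Nat.card (Equiv.Perm (Fin (r + 1 + 2))) = (r + 1 + 2).factorial := by
        rw [Nat.card_perm, Nat.card_fin]
      rw [map_pow, map_one, ← h2, pow_card_eq_one']
    have h2 := key _ (congrArg Subtype.val h1)
    have h3 := (hp.dvd_factorial).1 h2
    omega

end Polygon

end GCorners

end

/-! ### The proposition, assembled from its parts -/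

theorem proposition3 :
    -- Properties of an arbitrary manifold with g-corners `X`.
    (∀ X : GCorners.GSpace.{u}, GCorners.IsGManifold X →
      -- The corners and iterated boundaries of `X` are manifolds with g-corners.
      (∀ k ≤ X.dim, GCorners.IsGManifold (GCorners.corners X k) ∧
        (GCorners.corners X k).dim = X.dim - k ∧
        GCorners.IsGManifold (GCorners.bd X k) ∧ (GCorners.bd X k).dim = X.dim - k) ∧
      -- (a) The description of `C_2(X)`.
      Set.BijOn (GCorners.boundingSet X) Set.univ
        {q | ∃ β₁ β₂ : GCorners.LocalCorner X 1 q.1, β₁ ≠ β₂ ∧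
          GCorners.MeetInCodim β₁ β₂ 2 ∧ q.2 = {β₁, β₂}} ∧
      -- (a) The description of `∂²X`.
      (∃ Θ : GCorners.bd X 2 → GCorners.Triple X,
        (∀ y t, GCorners.Describes (X := X) y t ↔ t = Θ y) ∧
        Set.BijOn Θ Set.univ
          {t | t.2.1 ≠ t.2.2 ∧ GCorners.MeetInCodim t.2.1 t.2.2 2}) ∧
      -- (a) The free action of `S_2` on `∂²X` and its quotient.
      (∃ ρ : Equiv.Perm (Fin 2) →* Equiv.Perm (GCorners.bd X 2),
        (∀ σ : GCorners.bd X 2 → GCorners.bd X 2,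
          GCorners.IsSwap X σ ↔ σ = ρ (Equiv.swap 0 1)) ∧
        (∀ g, GCorners.IsDiffeo (X := GCorners.bd X 2) (Y := GCorners.bd X 2) (ρ g)) ∧
        (∀ g y, ρ g y = y → g = 1) ∧
        GCorners.IsGManifold
          (GCorners.quotient (GCorners.bd X 2) (GCorners.orbitSetoid ρ)) ∧
        ∃ Ψ : GCorners.corners X 2 ≃
            GCorners.quotient (GCorners.bd X 2) (GCorners.orbitSetoid ρ),
          GCorners.IsDiffeo Ψ ∧
          ∀ (y : GCorners.bd X 2) (x : X) (β₁ β₂ : GCorners.LocalCorner X 1 x),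
            GCorners.Describes (X := X) y ⟨x, (β₁, β₂)⟩ →
            GCorners.boundingSet X (Ψ.symm (GCorners.quotientMk _ _ y)) = ⟨x, {β₁, β₂}⟩) ∧
      -- (b) The natural projections `∂^k X → C_k(X)`.
      (∀ k ≤ X.dim, ∃ π : GCorners.bd X k → GCorners.corners X k,
        (∀ π', GCorners.IsNaturalProj X k π' ↔ π' = π) ∧
        GCorners.Smooth π ∧ Function.Surjective π ∧ GCorners.IsEtale π) ∧
      -- (c) The `k - 1` actions of `S_2` on `∂^k X`, for `k = m + 2`.
      (∀ m : ℕ, m + 2 ≤ X.dim →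
        ∃ s : Fin (m + 1) → Equiv.Perm (GCorners.bd X (m + 2)),
          (∀ (j : Fin (m + 1)) (σ : GCorners.bd X (m + 2) → GCorners.bd X (m + 2)),
            GCorners.IsSwapAt X j (m + 2) σ ↔ σ = s j) ∧
          (∀ j, s j * s j = 1) ∧
          (∀ j, GCorners.IsDiffeo (X := GCorners.bd X (m + 2)) (Y := GCorners.bd X (m + 2))
            (s j)) ∧
          (GCorners.HasOrdinaryCorners X → GCorners.CoxeterRelations s ∧
            ∃ ρ : Equiv.Perm (Fin (m + 2)) →* Equiv.Perm (GCorners.bd X (m + 2)),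
              ∀ j, ρ (GCorners.adjSwap j) = s j))) ∧
    -- (c) `S_k` is generated by two-cycles, and an action of `S_k` is equivalent to `k - 1`
    -- actions of `S_2` satisfying relations, for `k = m + 2`.
    (∀ m : ℕ,
      Subgroup.closure (Set.range (GCorners.adjSwap (m := m))) = ⊤ ∧
      ∀ Y : Type v, Set.BijOn
        (fun (ρ : Equiv.Perm (Fin (m + 2)) →* Equiv.Perm Y) (j : Fin (m + 1)) =>
          ρ (GCorners.adjSwap j))
        Set.univ {s | GCorners.CoxeterRelations s}) ∧
    -- (c) For every `k = m + 2 ≥ 3` the relations fail for some manifold with g-corners `X`, and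
    -- the group generated by the actions of `S_2` is not isomorphic to `S_k`.
    (∀ m : ℕ, 1 ≤ m → ∃ X : GCorners.GSpace.{0}, GCorners.IsGManifold X ∧ m + 2 ≤ X.dim ∧
      ∃ s : Fin (m + 1) → Equiv.Perm (GCorners.bd X (m + 2)),
        (∀ j : Fin (m + 1), GCorners.IsSwapAt X j (m + 2) (s j)) ∧
        ¬ GCorners.CoxeterRelations s ∧
        IsEmpty (Subgroup.closure (Set.range s) ≃* Equiv.Perm (Fin (m + 2)))) := by
  refine ⟨fun X hX => ⟨fun k _ => ⟨GCorners.isGManifold_corners hX k, rfl,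
    GCorners.isGManifold_bd hX k, GCorners.dim_bd X k⟩, GCorners.bijOn_boundingSet hX,
    GCorners.exists_theta hX, GCorners.exists_action_secondBoundary hX, fun k _ => ?_,
    fun m _ => ?_⟩, fun m => ⟨GCorners.closure_adjSwap m, GCorners.bijOn_coxeterRelations m⟩,
    GCorners.exists_not_coxeterRelations⟩
  · obtain ⟨π, h, hπ⟩ := GCorners.exists_naturalProj hX k
    have hl := GCorners.locallyIso_naturalProj hπ hX
    have hY := GCorners.isGManifold_bd hX k
    have hZ := GCorners.isGManifold_corners hX k
    exact ⟨π, h, hl.smooth hY hZ, GCorners.surjective_naturalProj hπ hX, hl.isEtale hY hZ⟩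
  · obtain ⟨s, hs, hsF⟩ := GCorners.exists_perm_isSwapAt hX m
    have hY := GCorners.isGManifold_bd hX (m + 2)
    refine ⟨s, hs, fun j => Equiv.ext ((hsF j).involutive hX (by omega)),
      fun j => ((hsF j).locallyIso hX (by omega)).isDiffeo hY hY, fun ho => ?_⟩
    have h := GCorners.coxeterRelations_of_ordinaryCorners hX ho hsF
    exact ⟨h, h.exists_hom⟩
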